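/- **Setting.** Let $q,\sigma\in\mathbb C$, $0<|q|<1$, fix a value of $\log q$ and put $q^{\sigma}=e^{\sigma\log q}$, with $|q^{\sigma+1}|<1$; let $a_1,a_2,a_3,a_4\in\mathbb C\setminus\{0\}$. Fix a branch of $\log$ on $\mathbb C\setminus\{0\}$ with $\log(qx)=\log x+\log q$ and put $x^\sigma=e^{\sigma\log x}$. Write $(a;q)_m=\prod_{i=0}^{m-1}(1-aq^i)$, $(a;q)_\infty=\prod_{i\ge0}(1-aq^i)$, $(a,b;q)_\bullet=(a;q)_\bullet(b;q)_\bullet$ (and similarly for more arguments), $$ {}_2\phi_1(a,b;c\,|\,q;z)=\sum_{m\ge0}z^m\frac{(a,b;q)_m}{(c,q;q)_m},\qquad \int_0^c f\,d_qx=c(1-q)\sum_{k\ge0}q^kf(cq^k),\qquad \int_a^b=\int_0^b-\int_0^a, $$ $\theta_q(z)=(q,-qz,-1/z;q)_\infty$ and $e_{q,c}(x)=\theta_q(x)\theta_q(c)/\theta_q(cx)$, so that $e_{q,c}(qx)=c\,e_{q,c}(x)$ and $e_{q,qc}(x)=x\,e_{q,c}(x)$. The deformed little $q$-Jacobi weight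 is $$ w(x,t)=\frac{x^\sigma\,(x/(a_1t),x/a_3;q)_\infty}{(x/(a_2t),x/a_4;q)_\infty}, $$ and, for fixed $E_0,E_1\in\{0,\,qa_3,\,qa_1t\}$ (the same choice of ends for all $t$; the main case is $E_0=qa_3$, $E_1=qa_1t$), its moments are $\mu_k(t)=\int_{E_0}^{E_1}x^kw(x,t)\,d_qx$. Put $$\Delta_n=\det(\mu_{i+j})_{0\le i,j\le n-1},\qquad \Delta_0=1,\qquad \Sigma_0=0,$$ and for $n\ge1$ let $\Sigma_n$ be the determinant obtained from $\Delta_n$ by replacing its last column $(\mu_{i+n-1})_{0\le i\le n-1}$ by $(\mu_{i+n})_{0\le i\le n-1}$. Call $t\ne0$ *admissible* if $(E/(a_2t),E/a_4;q)_\infty\neq0$ for $E=E_0,E_1$; the numbers $e_{q,qa_1}(t)$, $e_{q,qa_2}(t)$ are finite and nonzero; $\theta_q(a_1a_2a_3a_4tq^\sigma)\ne0$; and there is a system of polynomials $p_n(x)=\gamma_nx^n+\cdots$, $\gamma_n\neq0$ $(n\ge0)$, with $L(p_ip_j)=\delta_{ij}$, where $L(x^k)=\mu_k(t)$. Let $\epsilon_n$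 be the part with negative powers of the expansion at $x=\infty$ of $p_n(x)\sum_{k\ge0}\mu_kx^{-k-1}$. Put $$\kappa_1=q^{n+\sigma}a_1a_3,\quad \kappa_2=a_2a_4q^{-n},\quad \theta_1=q^\sigma a_1a_2a_3a_4,\quad \theta_2=a_1a_2a_3a_4,$$ $$ Y_n^*=\frac{e_{q,a_1a_2a_3a_4tq^\sigma}(x)}{(x/(a_2t),x/a_4;q)_\infty}\begin{pmatrix}\dfrac{a_2a_4q^{-n}}{e_{q,qa_2}(t)\gamma_n}&0\\0&\dfrac{\gamma_{n-1}}{e_{q,qa_1}(t)}\end{pmatrix}\begin{pmatrix}p_n&\epsilon_n/w\\p_{n-1}&\epsilon_{n-1}/w\end{pmatrix}, $$ with the conventions $\gamma_{-1}p_{-1}=0$, $\gamma_{-1}\epsilon_{-1}=1$ for $n=0$. A matrix $A_n^*(x,t)$ polynomial in $x$ is called the coefficient matrix if $Y_n^*(qx,t)=A_n^*(x,t)Y_n^*(x,t)$ for all $x$ with $|qx|>|E_0|,|E_1|$ at which $w$ and $e_{q,a_1a_2a_3a_4tq^\sigma}$ are finite and nonzero. *Natural variables* $w_n\neq0$, $y_n$,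 $z_n$ at $t$ are numbers for which, with some $z_1,z_2,\alpha,\beta,\gamma,\delta$, $$ A_n^*=\begin{pmatrix}\kappa_1((x-y_n)(x-\alpha)+z_1)&\kappa_2w_n(x-y_n)\\ \kappa_1(\gamma x+\delta)/w_n&\kappa_2((x-y_n)(x-\beta)+z_2)\end{pmatrix},$$ $$ q\kappa_1z_n\,z_1=(y_n-a_1t)(y_n-a_2t),\qquad z_2=q\kappa_1z_n(y_n-a_3)(y_n-a_4).$$ Write $\hat g(t)=g(qt)$ and $\underline g(t)=g(t/q)$ (the paper's under-hat). **Statement.** Let $T$ be any set of admissible values of $t$. 1. *(Moments.)* For $t\in T$ and $k\ge0$, $\mu_k(t)=H_k(E_1)-H_k(E_0)$, where $H_k(0)=0$, $$H_k(qa_1t)=\frac{(qa_1t)^{\sigma+k+1}(1-q)\,(a_1q^{\sigma+k+2}/a_2,q;q)_\infty}{(q^{\sigma+k+1},qa_1/a_2;q)_\infty}\;{}_2\phi_1\!\left(\tfrac{a_4}{a_3},q^{\sigma+k+1};\tfrac{a_1q^{\sigma+k+2}}{a_2}\Big|q;\tfrac{qa_1t}{a_4}\right),$$ $$H_k(qa_3)=\frac{(qa_3)^{\sigma+k+1}(1-q)\,(a_3q^{\sigma+k+2}/a_4,q;q)_\infty}{(q^{\sigma+k+1},qa_3/a_4;q)_\infty}\;{}_2\phi_1\!\left(\tfrac{a_2}{a_1},q^{\sigma+k+1};\tfrac{a_3q^{\sigma+k+2}}{a_4}\Big|q;\tfrac{qa_3}{a_2t}\right),$$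 provided that each ${}_2\phi_1$ that occurs has argument of modulus less than $1$ and third parameter $c$ with $(c;q)_\infty\ne0$. 2. *(Determinantal formulas.)* Let $n\ge0$ with $q\kappa_1\ne\kappa_2$. For each $t\in T$ the coefficient matrix $A_n^*$ exists and is unique, $A_n^*(0,t)$ has eigenvalues $\theta_1t,\theta_2t$ (with multiplicity), $\Delta_n\Delta_{n+1}\neq0$, and the upper right entry of $A_n^*$ is $\kappa_2w_n(x-y_n)$ with $$ w_n=\frac{e_{q,qa_1}(t)(\kappa_2-q\kappa_1)\Delta_{n+1}}{q\,e_{q,qa_2}(t)\Delta_n},$$ $$ y_n=\frac{q\kappa_1(a_2t+a_4)-\kappa_2(a_1t+a_3)}{q\kappa_1-\kappa_2}+\frac{\kappa_1-\kappa_2}{q\kappa_1-\kappa_2}\frac{\Sigma_n}{\Delta_n}-\frac{q\kappa_1-\kappa_2/q}{q\kappa_1-\kappa_2}\frac{\Sigma_{n+1}}{\Delta_{n+1}}.$$ If moreover $t/q\in T$, put $$ z_n=\frac{a_1\Delta_{n+1}\underline{\Delta}_n-a_2\Delta_n\underline{\Delta}_{n+1}}{a_1\kappa_2\Delta_{n+1}\underline{\Delta}_n-qa_2\kappa_1\Delta_n\underline{\Delta}_{n+1}}.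 $$ If the denominator of $z_n$ is nonzero, these $w_n,y_n,z_n$ are natural variables at $t$. Conversely, any natural variables at $t\in T$ have these values of $w_n$ and $y_n$; and if $t/q\in T$ and $(y_n-a_1t)(y_n-a_2t)\ne0$ or $(y_n-a_3)(y_n-a_4)\neq0$, then the denominator of $z_n$ is nonzero and the third natural variable equals this $z_n$. 3. *(Solution of $q$-$\mathrm P_{\mathrm{VI}}$.)* Let $n\ge0$ with $q\kappa_1\ne\kappa_2$. If $t/q,t,qt\in T$ and the denominators of $z_n(t)$ and $z_n(qt)$ are nonzero, then the functions of part 2 satisfy, with $a_5=a_1a_2/\theta_1$, $a_6=a_1a_2/\theta_2$, $a_7=1/(q\kappa_1)$, $a_8=1/\kappa_2$, $$ \hat w_n=w_n\frac{q\kappa_1\hat z_n-1}{\kappa_2\hat z_n-1},\qquad \hat z_nz_n\,(y_n-a_3)(y_n-a_4)=a_7a_8(y_n-a_1t)(y_n-a_2t),$$ $$ \hat y_ny_n=\frac{a_3a_4(\hat z_n-a_5t)(\hat z_n-a_6t)}{(\hat z_n-a_7)(\hat z_n-a_8)},$$ with nonvanishing denominators $\kappa_2\hat z_n-1$, $\hat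 z_n-a_7$, $\hat z_n-a_8$. -/

import Mathlib

open Polynomial

noncomputable section

/-! ### Elementary `q`-calculus -/

/-- The finite `q`-Pochhammer symbol `(a;q)_m`. -/
def qPoch (q a : ℂ) (m : ℕ) : ℂ := ∏ i ∈ Finset.range m, (1 - a * q ^ i)

/-- The infinite `q`-Pochhammer symbol `(a;q)_∞`. -/
def qPochInf (q a : ℂ) : ℂ := ∏' i : ℕ, (1 - a * q ^ i)

/-- Heine's basic hypergeometric series `₂φ₁(a, b; c | q; z)`. -/
def heinePhi (q a b c z : ℂ) : ℂ :=
  ∑' m : ℕ, z ^ m * (qPoch q a m * qPoch q b m) / (qPoch q c m * qPoch q q m)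

/-- Jackson's integral of `f` from `0` to `c`. -/
def jacksonInt₀ (q : ℂ) (f : ℂ → ℂ) (c : ℂ) : ℂ :=
  c * (1 - q) * ∑' k : ℕ, q ^ k * f (c * q ^ k)

/-- Jackson's integral of `f` from `a` to `b`. -/
def jacksonInt (q : ℂ) (f : ℂ → ℂ) (a b : ℂ) : ℂ :=
  jacksonInt₀ q f b - jacksonInt₀ q f a

/-- The theta function `θ_q(z) = (q, -qz, -1/z; q)_∞`; it satisfies `θ_q(qz) = θ_q(z) / (qz)`. -/
def qTheta (q z : ℂ) : ℂ := qPochInf q q * qPochInf q (-(q * z)) * qPochInf q (-(1 / z))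

/-- The `q`-character, normalised so that `e_{q,c}(qx) = c e_{q,c}(x)` and
`e_{q,qc}(x) = x e_{q,c}(x)`. It is nonzero (in particular not a division by zero)
exactly when `θ_q(x)`, `θ_q(c)` and `θ_q(cx)` are all nonzero. -/
def qChar (q c x : ℂ) : ℂ := qTheta q x * qTheta q c / qTheta q (c * x)

/-! ### Orthogonal polynomials with respect to a moment sequence -/

/-- The linear functional `L` on polynomials with `L(x^k) = μ k`. -/
def momentFunctional (μ : ℕ → ℂ) (p : ℂ[X]) : ℂ := p.sum fun k c => c * μ k

/-- `p 0, p 1, …` is an orthonormal polynomial system for the moment sequence `μ`. -/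
def IsOrthonormalSystem (μ : ℕ → ℂ) (p : ℕ → ℂ[X]) : Prop :=
  (∀ m, (p m).degree = m) ∧
    ∀ i j, momentFunctional μ (p i * p j) = if i = j then 1 else 0

/-- The Hankel determinant `Δ_n = det (μ_{i+j})_{0 ≤ i, j < n}`, with `Δ_0 = 1`. -/
def hankelDelta (μ : ℕ → ℂ) (n : ℕ) : ℂ :=
  (Matrix.of fun i j : Fin n => μ (i.val + j.val)).det

/-- The determinant `Σ_n`: the Hankel matrix of `Δ_n` with its last column
`(μ_{i+n-1})_i` replaced by `(μ_{i+n})_i`; moreover `Σ_0 = 0`. -/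
def hankelSigma (μ : ℕ → ℂ) : ℕ → ℂ
  | 0 => 0
  | n + 1 => (Matrix.of fun i j : Fin (n + 1) =>
      μ (i.val + if j.val = n then n + 1 else j.val)).det

/-- The Stieltjes function `f(x) = ∑ μ_k x^{-k-1}`. -/
def stieltjes (μ : ℕ → ℂ) (x : ℂ) : ℂ := ∑' k : ℕ, μ k / x ^ (k + 1)

/-- The polynomial part of the Laurent expansion at infinity of `f p`. -/
def assocPoly (μ : ℕ → ℂ) (p : ℂ[X]) : ℂ[X] :=
  p.sum fun j c => ∑ i ∈ Finset.range j, C (c * μ i) * X ^ (j - 1 - i)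

/-- The associated function `ε = f p - φ`, where `φ` is the polynomial part of `f p`. -/
def assocFun (μ : ℕ → ℂ) (p : ℂ[X]) (x : ℂ) : ℂ :=
  stieltjes μ x * p.eval x - (assocPoly μ p).eval x

/-! ### The deformed little `q`-Jacobi weight -/

/-- The parameters of the deformed little `q`-Jacobi weight. The powers `x^σ` are formed with
a branch `logBr` of the logarithm on `ℂ \ {0}` that is compatible with the `q`-shift, so that
`(q x)^σ = q^σ x^σ` with `q^σ = exp (σ logq)`. (For `0 < q < 1` the principal branch is one.)
The last field is the condition `|q^{σ+1}| < 1` for the moments to converge. -/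
structure LittleQJacobi where
  q : ℂ
  σ : ℂ
  a₁ : ℂ
  a₂ : ℂ
  a₃ : ℂ
  a₄ : ℂ
  logq : ℂ
  logBr : ℂ → ℂ
  q_ne_zero : q ≠ 0
  norm_q_lt_one : ‖q‖ < 1
  a₁_ne_zero : a₁ ≠ 0
  a₂_ne_zero : a₂ ≠ 0
  a₃_ne_zero : a₃ ≠ 0
  a₄_ne_zero : a₄ ≠ 0
  exp_logq : Complex.exp logq = q
  exp_logBr : ∀ x, x ≠ 0 → Complex.exp (logBr x) = x
  logBr_mul : ∀ x, x ≠ 0 → logBr (q * x) = logBr x + logq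
  norm_lt_one : ‖Complex.exp ((σ + 1) * logq)‖ < 1

/-- The possible end points of the support of the weight. -/
inductive SupportEnd
  | zero
  | atA₃
  | atA₁t

namespace LittleQJacobi

variable (P : LittleQJacobi)

/-- `q^σ`. -/
def qσ : ℂ := Complex.exp (P.σ * P.logq)

/-- `x^σ`. -/
def powσ (x : ℂ) : ℂ := Complex.exp (P.σ * P.logBr x)

/-- The deformed weight
`w(x,t) = x^σ (x/(a₁t), x/a₃; q)_∞ / (x/(a₂t), x/a₄; q)_∞`. With Lean's `y / 0 = 0` it is
nonzero exactly when none of the four infinite products vanishes. -/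
def weight (t x : ℂ) : ℂ :=
  P.powσ x * (qPochInf P.q (x / (P.a₁ * t)) * qPochInf P.q (x / P.a₃)) /
    (qPochInf P.q (x / (P.a₂ * t)) * qPochInf P.q (x / P.a₄))

/-- The end points of integration `0`, `q a₃`, `q a₁ t`. -/
def endpoint (t : ℂ) : SupportEnd → ℂ
  | .zero => 0
  | .atA₃ => P.q * P.a₃
  | .atA₁t => P.q * P.a₁ * t

/-- The moments `μ_k(t) = ∫ x^k w(x,t) d_q x` over the support from `e₀` to `e₁`. -/
def moment (e₀ e₁ : SupportEnd) (t : ℂ) (k : ℕ) : ℂ :=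
  jacksonInt P.q (fun x => x ^ k * P.weight t x) (P.endpoint t e₀) (P.endpoint t e₁)

/-- The weight has no pole on the lattice attached to the end point `e`. -/
def RegularAt (t : ℂ) (e : SupportEnd) : Prop :=
  qPochInf P.q (P.endpoint t e / (P.a₂ * t)) ≠ 0 ∧ qPochInf P.q (P.endpoint t e / P.a₄) ≠ 0

/-- The contribution of one end point to the `k`-th moment, through Heine's function. -/
def heineTerm (t : ℂ) (k : ℕ) : SupportEnd → ℂ
  | .zero => 0
  | .atA₃ =>
      P.powσ (P.q * P.a₃) * (P.q * P.a₃) ^ (k + 1) * (1 - P.q) *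
        (qPochInf P.q (P.a₃ * (P.qσ * P.q ^ (k + 2)) / P.a₄) * qPochInf P.q P.q) /
        (qPochInf P.q (P.qσ * P.q ^ (k + 1)) * qPochInf P.q (P.q * P.a₃ / P.a₄)) *
        heinePhi P.q (P.a₂ / P.a₁) (P.qσ * P.q ^ (k + 1))
          (P.a₃ * (P.qσ * P.q ^ (k + 2)) / P.a₄) (P.q * P.a₃ / (P.a₂ * t))
  | .atA₁t =>
      P.powσ (P.q * P.a₁ * t) * (P.q * P.a₁ * t) ^ (k + 1) * (1 - P.q) *
        (qPochInf P.q (P.a₁ * (P.qσ * P.q ^ (k + 2)) / P.a₂) * qPochInf P.q P.q) /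
        (qPochInf P.q (P.qσ * P.q ^ (k + 1)) * qPochInf P.q (P.q * P.a₁ / P.a₂)) *
        heinePhi P.q (P.a₄ / P.a₃) (P.qσ * P.q ^ (k + 1))
          (P.a₁ * (P.qσ * P.q ^ (k + 2)) / P.a₂) (P.q * P.a₁ * t / P.a₄)

/-- The series `₂φ₁` in `heineTerm` has argument of modulus `< 1` and no vanishing
denominator. -/
def HeineConverges (t : ℂ) (k : ℕ) : SupportEnd → Prop
  | .zero => True
  | .atA₃ => ‖P.q * P.a₃ / (P.a₂ * t)‖ < 1 ∧
      qPochInf P.q (P.a₃ * (P.qσ * P.q ^ (k + 2)) / P.a₄) ≠ 0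
  | .atA₁t => ‖P.q * P.a₁ * t / P.a₄‖ < 1 ∧
      qPochInf P.q (P.a₁ * (P.qσ * P.q ^ (k + 2)) / P.a₂) ≠ 0

/-! ### The linear problem -/

/-- `κ₁ = q^{n+σ} a₁ a₃`. -/
def κ₁ (n : ℕ) : ℂ := P.q ^ n * P.qσ * P.a₁ * P.a₃

/-- `κ₂ = a₂ a₄ q^{-n}`. -/
def κ₂ (n : ℕ) : ℂ := P.a₂ * P.a₄ / P.q ^ n

/-- `θ₁ = q^σ a₁ a₂ a₃ a₄`. -/
def θ₁ : ℂ := P.qσ * P.a₁ * P.a₂ * P.a₃ * P.a₄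

/-- `θ₂ = a₁ a₂ a₃ a₄`. -/
def θ₂ : ℂ := P.a₁ * P.a₂ * P.a₃ * P.a₄

/-- The constant `c = a₁ a₂ a₃ a₄ t q^σ` of the `q`-character in the gauge factor. -/
def gaugeConst (t : ℂ) : ℂ := P.a₁ * P.a₂ * P.a₃ * P.a₄ * t * P.qσ

/-- The scalar gauge factor `e_{q,a₁a₂a₃a₄tq^σ}(x) / (x/(a₂t), x/a₄; q)_∞`. -/
def gauge (t x : ℂ) : ℂ :=
  qChar P.q (P.gaugeConst t) x /
    (qPochInf P.q (x / (P.a₂ * t)) * qPochInf P.q (x / P.a₄))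

/-- The row `γ_{n-1} (p_{n-1}, ε_{n-1} / w)`, where `γ_m` is the leading coefficient of `p_m`.
For `n = 0` the usual conventions `γ_{-1} p_{-1} = 0` and `γ_{-1} ε_{-1} = 1` are used. -/
def lowerRow (μ : ℕ → ℂ) (p : ℕ → ℂ[X]) (t x : ℂ) : ℕ → Fin 2 → ℂ
  | 0 => ![0, 1 / P.weight t x]
  | m + 1 => ![(p m).leadingCoeff * (p m).eval x,
      (p m).leadingCoeff * (assocFun μ (p m) x / P.weight t x)]

/-- The gauge-transformed matrix `Y_n^* = Z_n Y_n`, with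
`Y_n = ((p_n, ε_n/w), (p_{n-1}, ε_{n-1}/w))` and
`Z_n = gauge · diag (a₂a₄q^{-n} / (e_{q,qa₂}(t) γ_n), γ_{n-1} / e_{q,qa₁}(t))`. -/
def Ystar (μ : ℕ → ℂ) (p : ℕ → ℂ[X]) (n : ℕ) (t x : ℂ) : Matrix (Fin 2) (Fin 2) ℂ :=
  P.gauge t x • Matrix.of
    ![(P.a₂ * P.a₄ / P.q ^ n / (qChar P.q (P.q * P.a₂) t * (p n).leadingCoeff)) •
        ![(p n).eval x, assocFun μ (p n) x / P.weight t x],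
      (1 / qChar P.q (P.q * P.a₁) t) • P.lowerRow μ p t x n]

/-- `A` is the polynomial coefficient matrix `A_n^*` of `Y_n^*(qx,t) = A_n^*(x,t) Y_n^*(x,t)`,
an equation between the values at all `x` for which the Stieltjes series converges at `x` and
`qx` and the weight and the gauge factor are finite and nonzero. -/
def IsCoeffMatrix (e₀ e₁ : SupportEnd) (p : ℕ → ℂ[X]) (n : ℕ) (t : ℂ)
    (A : Matrix (Fin 2) (Fin 2) ℂ[X]) : Prop :=
  ∀ x : ℂ, ‖P.endpoint t e₀‖ < ‖P.q * x‖ → ‖P.endpoint t e₁‖ < ‖P.q * x‖ →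
    P.weight t x ≠ 0 → qChar P.q (P.gaugeConst t) x ≠ 0 →
    P.Ystar (P.moment e₀ e₁ t) p n t (P.q * x) =
      A.map (Polynomial.eval x) * P.Ystar (P.moment e₀ e₁ t) p n t x

/-- The natural variables: `w`, `y`, `z` parameterize `A` in the Jimbo-Sakai form
`A = ((κ₁((x-y)(x-α)+z₁), κ₂w(x-y)), (κ₁(γx+δ)/w, κ₂((x-y)(x-β)+z₂)))` with
`z₁ = (y-a₁t)(y-a₂t)/(qκ₁z)` (denominator cleared) and `z₂ = qκ₁z(y-a₃)(y-a₄)`. -/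
def IsNatural (n : ℕ) (t : ℂ) (A : Matrix (Fin 2) (Fin 2) ℂ[X]) (w y z : ℂ) : Prop :=
  w ≠ 0 ∧ ∃ z₁ z₂ α β γ δ : ℂ,
    A = !![C (P.κ₁ n) * ((X - C y) * (X - C α) + C z₁), C (P.κ₂ n * w) * (X - C y);
           C (P.κ₁ n / w) * (C γ * X + C δ), C (P.κ₂ n) * ((X - C y) * (X - C β) + C z₂)] ∧
    z₁ * (P.q * P.κ₁ n * z) = (y - P.a₁ * t) * (y - P.a₂ * t) ∧
    z₂ = P.q * P.κ₁ n * z * ((y - P.a₃) * (y - P.a₄))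

/-! ### The determinantal expressions -/

/-- The determinantal expression for `w_n`. -/
def wDet (e₀ e₁ : SupportEnd) (n : ℕ) (t : ℂ) : ℂ :=
  qChar P.q (P.q * P.a₁) t * (P.κ₂ n - P.q * P.κ₁ n) * hankelDelta (P.moment e₀ e₁ t) (n + 1) /
    (P.q * qChar P.q (P.q * P.a₂) t * hankelDelta (P.moment e₀ e₁ t) n)

/-- The determinantal expression for `y_n`. -/
def yDet (e₀ e₁ : SupportEnd) (n : ℕ) (t : ℂ) : ℂ :=
  (P.q * P.κ₁ n * (P.a₂ * t + P.a₄) - P.κ₂ n * (P.a₁ * t + P.a₃)) / (P.q * P.κ₁ n - P.κ₂ n) +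
    (P.κ₁ n - P.κ₂ n) / (P.q * P.κ₁ n - P.κ₂ n) *
      (hankelSigma (P.moment e₀ e₁ t) n / hankelDelta (P.moment e₀ e₁ t) n) -
    (P.q * P.κ₁ n - P.κ₂ n / P.q) / (P.q * P.κ₁ n - P.κ₂ n) *
      (hankelSigma (P.moment e₀ e₁ t) (n + 1) / hankelDelta (P.moment e₀ e₁ t) (n + 1))

/-- The denominator of the determinantal expression for `z_n`. -/
def zDenom (e₀ e₁ : SupportEnd) (n : ℕ) (t : ℂ) : ℂ :=
  P.a₁ * P.κ₂ n * hankelDelta (P.moment e₀ e₁ t) (n + 1) *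
      hankelDelta (P.moment e₀ e₁ (t / P.q)) n -
    P.q * P.a₂ * P.κ₁ n * hankelDelta (P.moment e₀ e₁ t) n *
      hankelDelta (P.moment e₀ e₁ (t / P.q)) (n + 1)

/-- The determinantal expression for `z_n`. -/
def zDet (e₀ e₁ : SupportEnd) (n : ℕ) (t : ℂ) : ℂ :=
  (P.a₁ * hankelDelta (P.moment e₀ e₁ t) (n + 1) * hankelDelta (P.moment e₀ e₁ (t / P.q)) n -
    P.a₂ * hankelDelta (P.moment e₀ e₁ t) n * hankelDelta (P.moment e₀ e₁ (t / P.q)) (n + 1)) /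
    P.zDenom e₀ e₁ n t

/-- Everything presupposed at the value `t` of the deformation parameter: `t ≠ 0`, the weight
has no pole on its support, the gauge matrix is finite and invertible, and `p` is an orthonormal
polynomial system for the moments. -/
def Admissible (e₀ e₁ : SupportEnd) (p : ℕ → ℂ[X]) (t : ℂ) : Prop :=
  t ≠ 0 ∧ P.RegularAt t e₀ ∧ P.RegularAt t e₁ ∧
    qChar P.q (P.q * P.a₁) t ≠ 0 ∧ qChar P.q (P.q * P.a₂) t ≠ 0 ∧
    qTheta P.q (P.gaugeConst t) ≠ 0 ∧
    IsOrthonormalSystem (P.moment e₀ e₁ t) p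

end LittleQJacobi

/-- The step `t ↦ qt` of `q`-P_VI from `(y, z)` to `(y', z')`, with parameters `b 0, …, b 7`
standing for `a₁, …, a₈`:
`z' z = a₇a₈(y-a₁t)(y-a₂t)/((y-a₃)(y-a₄))` (denominator cleared, so that it also makes sense
where `y` meets `a₃` or `a₄`) and `y' y = a₃a₄(z'-a₅t)(z'-a₆t)/((z'-a₇)(z'-a₈))`. -/
def IsQPVIStep (b : Fin 8 → ℂ) (t y z y' z' : ℂ) : Prop :=
  z' * z * ((y - b 2) * (y - b 3)) = b 6 * b 7 * ((y - b 0 * t) * (y - b 1 * t)) ∧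
    z' ≠ b 6 ∧ z' ≠ b 7 ∧
    y' * y = b 2 * b 3 * ((z' - b 4 * t) * (z' - b 5 * t)) / ((z' - b 6) * (z' - b 7))

/-- The parameters `a₁, …, a₈` of `q`-P_VI:
`a₅ = a₁a₂/θ₁`, `a₆ = a₁a₂/θ₂`, `a₇ = 1/(qκ₁)`, `a₈ = 1/κ₂`. -/
def LittleQJacobi.qpviParams (P : LittleQJacobi) (n : ℕ) : Fin 8 → ℂ :=
  ![P.a₁, P.a₂, P.a₃, P.a₄, P.a₁ * P.a₂ / P.θ₁, P.a₁ * P.a₂ / P.θ₂,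
    1 / (P.q * P.κ₁ n), 1 / P.κ₂ n]

end

/-! ### Infinite `q`-products: convergence, zeros, bounds -/

open Filter Topology
open Bornology (cobounded)

/-! The weight satisfies a Pearson equation A(x) w(qx) = B(x) w(x) with A = (x - a₁t)(x - a₃) and B
= b(x - a₂t)(x - a₄). It passes to the moments because every nonzero end point E has A(E/q) = 0, so
that the boundary term of the shifted lattice sum vanishes. Hence the Stieltjes function f satisfies
A(x) f(qx) = B(x) f(x) + c(x) with a polynomial c. Comparing t with t/q gives two more relations of
this kind, with coefficients of degree one: one between f_t(x) and f_{t/q}(x), one between f_t(qx)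
and f_{t/q}(x).

Let U be the matrix with rows (p, fp - φ) and (g, fg - ψ), where p is the monic orthogonal
polynomial of degree n, g = γ_{n-1} p_{n-1}, and φ, ψ are the polynomial parts (`Frame`).
Orthogonality is the decay of the second column at infinity, and it forces det U = 1. A relation
between two Stieltjes functions makes U'(lx) diag(b, a) U(x)⁻¹ a polynomial matrix of determinant ab
(`connMatrix`, `connEntry_eval`), whose degrees and leading coefficients are read off at infinity.
For x ↦ qx this is the coefficient matrix up to the gauge. Its upper right entry is linear, and the
two coefficients give w_n and y_n, because the expansion coefficients of p and fp - φ are quotients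
of Hankel determinants (`IsOrthonormalSystem.frame_hankel`).

The two relations between t and t/q give connection matrices R and S with constant upper right
entries r and s (`zNum`, `zDen`). Now S adj R is a multiple of the shift matrix at t, and adj R(qx)
S is a multiple of the one at t/q (`exists_factorization`): a step in t interchanges the factors. At
the zero y_n of the upper right entry the diagonal entries are determined by r/s and det R, det S,
so z_n is a multiple of r/s; the opposite order at t/q gives the product of consecutive z. At x = 0
the upper right entries at t and t/q multiply to a quadratic form in r and s, fixed by det R(0), det
S(0) and a known trace, which gives the product of consecutive y (`pair_relations`, `qpvi_step`). -/

theorem summable_norm_mul_pow {q : ℂ} (hq : ‖q‖ < 1) (a : ℂ) :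
    Summable fun i : ℕ => ‖-(a * q ^ i)‖ := by
  simp only [norm_neg, norm_mul, norm_pow]
  exact (summable_geometric_of_lt_one (norm_nonneg q) hq).mul_left _

theorem multipliable_qPoch {q : ℂ} (hq : ‖q‖ < 1) (a : ℂ) :
    Multipliable fun i : ℕ => 1 - a * q ^ i := by
  simpa [sub_eq_add_neg] using multipliable_one_add_of_summable (summable_norm_mul_pow hq a)

theorem tendsto_qPoch {q : ℂ} (hq : ‖q‖ < 1) (a : ℂ) :
    Tendsto (qPoch q a) atTop (𝓝 (qPochInf q a)) :=
  (multipliable_qPoch hq a).tendsto_prod_tprod_nat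

theorem qPochInf_eq_qPoch_mul {q : ℂ} (hq : ‖q‖ < 1) (a : ℂ) (n : ℕ) :
    qPochInf q a = qPoch q a n * qPochInf q (a * q ^ n) := by
  have h := Multipliable.prod_mul_tprod_nat_mul' (f := fun i : ℕ => 1 - a * q ^ i) (k := n)
    (by simpa [pow_add, mul_assoc, mul_comm, mul_left_comm] using
      multipliable_qPoch hq (a * q ^ n))
  rw [qPochInf, ← h, qPoch, qPochInf]
  congr 2
  funext i
  ring

theorem qPochInf_eq_mul {q : ℂ} (hq : ‖q‖ < 1) (a : ℂ) :
    qPochInf q a = (1 - a) * qPochInf q (q * a) := by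
  rw [qPochInf_eq_qPoch_mul hq a 1]
  simp [qPoch, mul_comm]

theorem qPoch_ne_zero_of_qPochInf {q a : ℂ} (hq : ‖q‖ < 1) (h : qPochInf q a ≠ 0) (n : ℕ) :
    qPoch q a n ≠ 0 := fun h0 => h (by rw [qPochInf_eq_qPoch_mul hq a n, h0, zero_mul])

theorem qPochInf_mul_pow_ne_zero {q a : ℂ} (hq : ‖q‖ < 1) (h : qPochInf q a ≠ 0) (n : ℕ) :
    qPochInf q (a * q ^ n) ≠ 0 := fun h0 => h (by rw [qPochInf_eq_qPoch_mul hq a n, h0, mul_zero])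

theorem exists_mul_pow_eq_one_of_qPochInf {q a : ℂ} (hq : ‖q‖ < 1) (h : qPochInf q a = 0) :
    ∃ i : ℕ, a * q ^ i = 1 := by
  by_contra! hne
  refine tprod_one_add_ne_zero_of_summable (f := fun i : ℕ => -(a * q ^ i)) (fun i hi => hne i ?_)
    (summable_norm_mul_pow hq a) ?_
  · linear_combination -hi
  · simpa [qPochInf, sub_eq_add_neg] using h

theorem qPochInf_ne_zero {q a : ℂ} (hq : ‖q‖ < 1) (ha : ‖a‖ < 1) : qPochInf q a ≠ 0 := by
  intro h
  obtain ⟨i, hi⟩ := exists_mul_pow_eq_one_of_qPochInf hq h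
  have h1 : ‖a * q ^ i‖ < 1 := by
    rw [norm_mul, norm_pow]
    exact mul_lt_one_of_nonneg_of_lt_one_left (norm_nonneg a) ha
      (pow_le_one₀ (norm_nonneg q) hq.le)
  rw [hi] at h1
  simp at h1

theorem countable_qPochInf_eq_zero {q : ℂ} (hq : ‖q‖ < 1) (hq0 : q ≠ 0) {c : ℂ} :
    {x : ℂ | qPochInf q (c * x) = 0}.Countable := by
  refine (Set.countable_range fun i : ℕ => 1 / (c * q ^ i)).mono fun x hx => ?_
  obtain ⟨i, hi⟩ := exists_mul_pow_eq_one_of_qPochInf hq hx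
  have hc : c ≠ 0 := by rintro rfl; simp at hi
  refine ⟨i, ?_⟩
  have := pow_ne_zero i hq0
  simp only
  field_simp
  linear_combination -hi

theorem exists_norm_qPoch_div_le {q a c : ℂ} (hq : ‖q‖ < 1) (hc : qPochInf q c ≠ 0) :
    ∃ M : ℝ, ∀ n, ‖qPoch q a n / qPoch q c n‖ ≤ M := by
  have h := ((tendsto_qPoch hq a).div (tendsto_qPoch hq c) hc)
  obtain ⟨M, hM⟩ := (Metric.isBounded_range_of_tendsto _ h).exists_norm_le
  exact ⟨M, fun n => hM _ ⟨n, rfl⟩⟩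

/-- The quotient is a constant times (c;q)_n / (a;q)_n, and this converges if (a;q)_∞ ≠ 0. The bound
is what makes the lattice sums of the weight converge absolutely. -/
theorem exists_norm_qPochInf_mul_pow_le {q : ℂ} (hq : ‖q‖ < 1) (a c : ℂ)
    (hc : qPochInf q c ≠ 0) :
    ∃ M : ℝ, ∀ n : ℕ, ‖qPochInf q (a * q ^ n) / qPochInf q (c * q ^ n)‖ ≤ M := by
  -- If a q^i = 1, the terms with n ≤ i vanish; the argument restarts at a q^(i+1) = q, where the
  -- product is nonzero.
  by_cases ha : qPochInf q a = 0
  · obtain ⟨i, hi⟩ := exists_mul_pow_eq_one_of_qPochInf hq ha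
    have hnz : qPochInf q (a * q ^ (i + 1)) ≠ 0 := by
      rw [pow_succ, ← mul_assoc, hi, one_mul]
      exact qPochInf_ne_zero hq hq
    have hcz := qPochInf_mul_pow_ne_zero hq hc (i + 1)
    obtain ⟨M, hM⟩ := exists_norm_qPoch_div_le (a := c * q ^ (i + 1)) hq hnz
    have hM0 : 0 ≤ M := (norm_nonneg _).trans (hM 0)
    refine ⟨‖qPochInf q (a * q ^ (i + 1)) / qPochInf q (c * q ^ (i + 1))‖ * M, fun n => ?_⟩
    rcases Nat.lt_or_ge i n with hin | hin
    · obtain ⟨k, rfl⟩ := Nat.exists_eq_add_of_le (Nat.succ_le_of_lt hin)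
      have e1 := qPochInf_eq_qPoch_mul hq (a * q ^ (i + 1)) k
      have e2 := qPochInf_eq_qPoch_mul hq (c * q ^ (i + 1)) k
      rw [mul_assoc, ← pow_add] at e1 e2
      have n1 := qPoch_ne_zero_of_qPochInf hq hnz k
      have n2 := qPoch_ne_zero_of_qPochInf hq hcz k
      have n3 : qPochInf q (c * q ^ (i + 1 + k)) ≠ 0 := qPochInf_mul_pow_ne_zero hq hc _
      have : qPochInf q (a * q ^ (i + 1 + k)) / qPochInf q (c * q ^ (i + 1 + k)) =
          qPochInf q (a * q ^ (i + 1)) / qPochInf q (c * q ^ (i + 1)) *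
            (qPoch q (c * q ^ (i + 1)) k / qPoch q (a * q ^ (i + 1)) k) := by
        rw [e1, e2]
        field_simp
      rw [Nat.succ_eq_add_one, this, norm_mul]
      exact mul_le_mul_of_nonneg_left (hM k) (norm_nonneg _)
    · have : qPochInf q (a * q ^ n) = 0 := by
        obtain ⟨k, rfl⟩ := Nat.exists_eq_add_of_le hin
        rw [qPochInf_eq_qPoch_mul hq (a * q ^ n) k, mul_assoc a, ← pow_add, hi,
          qPochInf_eq_mul hq 1]
        simp
      rw [this]
      simp only [zero_div, norm_zero]
      positivity
  · obtain ⟨M, hM⟩ := exists_norm_qPoch_div_le (a := c) hq ha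
    refine ⟨‖qPochInf q a / qPochInf q c‖ * M, fun n => ?_⟩
    have n1 := qPoch_ne_zero_of_qPochInf hq ha n
    have n2 := qPoch_ne_zero_of_qPochInf hq hc n
    have n3 := qPochInf_mul_pow_ne_zero hq hc n
    have : qPochInf q (a * q ^ n) / qPochInf q (c * q ^ n) =
        qPochInf q a / qPochInf q c * (qPoch q c n / qPoch q a n) := by
      rw [qPochInf_eq_qPoch_mul hq a n, qPochInf_eq_qPoch_mul hq c n]
      field_simp
    rw [this, norm_mul]
    exact mul_le_mul_of_nonneg_left (hM n) (norm_nonneg _)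

/-! ### The `q`-binomial theorem and Heine's transformation -/

theorem summable_qBinomial {q z : ℂ} (hq : ‖q‖ < 1) (hz : ‖z‖ < 1) (a : ℂ) :
    Summable fun n : ℕ => ‖qPoch q a n / qPoch q q n * z ^ n‖ := by
  obtain ⟨M, hM⟩ := exists_norm_qPoch_div_le (a := a) hq (qPochInf_ne_zero hq hq)
  refine Summable.of_nonneg_of_le (fun _ => norm_nonneg _) (fun n => ?_)
    ((summable_geometric_of_lt_one (norm_nonneg z) hz).mul_left M)
  rw [norm_mul, norm_pow]
  exact mul_le_mul_of_nonneg_right (hM n) (by positivity)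

/-- With F(z) the series, the coefficient recurrence c_{n+1}(1 - q^{n+1}) = c_n(1 - a q^n) reads
F(z) - F(qz) = z F(z) - a z F(qz). -/
theorem qBinomial_step {q z : ℂ} (hq : ‖q‖ < 1) (hz : ‖z‖ < 1) (a : ℂ) :
    (1 - z) * ∑' n : ℕ, qPoch q a n / qPoch q q n * z ^ n =
      (1 - a * z) * ∑' n : ℕ, qPoch q a n / qPoch q q n * (z * q) ^ n := by
  have hzq : ‖z * q‖ < 1 := by
    rw [norm_mul]; exact mul_lt_one_of_nonneg_of_lt_one_left (norm_nonneg _) hz hq.le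
  have s1 := (summable_qBinomial hq hz a).of_norm
  have s2 := (summable_qBinomial hq hzq a).of_norm
  have key : (∑' n : ℕ, qPoch q a n / qPoch q q n * z ^ n) -
      ∑' n : ℕ, qPoch q a n / qPoch q q n * (z * q) ^ n =
      z * (∑' n : ℕ, qPoch q a n / qPoch q q n * z ^ n) -
        a * z * ∑' n : ℕ, qPoch q a n / qPoch q q n * (z * q) ^ n := by
    rw [← s1.tsum_sub s2, ← tsum_mul_left, ← tsum_mul_left,
      ← (s1.mul_left z).tsum_sub (s2.mul_left (a * z)), (s1.sub s2).tsum_eq_zero_add]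
    simp only [pow_zero, sub_self, zero_add]
    congr 1
    funext n
    have hn : qPoch q q (n + 1) ≠ 0 :=
      qPoch_ne_zero_of_qPochInf hq (qPochInf_ne_zero hq hq) _
    have hn' : qPoch q q n ≠ 0 := qPoch_ne_zero_of_qPochInf hq (qPochInf_ne_zero hq hq) _
    have e1 : qPoch q q (n + 1) = qPoch q q n * (1 - q * q ^ n) := Finset.prod_range_succ _ _
    have e2 : qPoch q a (n + 1) = qPoch q a n * (1 - a * q ^ n) := Finset.prod_range_succ _ _
    have hn3 : 1 - q * q ^ n ≠ 0 := fun h => hn (by rw [e1, h, mul_zero])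
    have e : qPoch q a (n + 1) / qPoch q q (n + 1) * (1 - q * q ^ n) =
        qPoch q a n / qPoch q q n * (1 - a * q ^ n) := by
      rw [e1, e2, mul_div_mul_comm, mul_assoc, div_mul_cancel₀ _ hn3]
    linear_combination z ^ (n + 1) * e
  linear_combination key

/-- Iterating `qBinomial_step` N times moves the argument to z q^N, and the series there tends to
its constant term 1 by dominated convergence. -/
theorem qBinomial {q z : ℂ} (hq : ‖q‖ < 1) (hz : ‖z‖ < 1) (a : ℂ) :
    ∑' n : ℕ, qPoch q a n / qPoch q q n * z ^ n = qPochInf q (a * z) / qPochInf q z := by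
  have hpow : ∀ N : ℕ, ‖z * q ^ N‖ < 1 := fun N => by
    rw [norm_mul, norm_pow]
    exact mul_lt_one_of_nonneg_of_lt_one_left (norm_nonneg _) hz (pow_le_one₀ (norm_nonneg _) hq.le)
  have hN : ∀ N : ℕ, qPoch q z N * ∑' n : ℕ, qPoch q a n / qPoch q q n * z ^ n =
      qPoch q (a * z) N * ∑' n : ℕ, qPoch q a n / qPoch q q n * (z * q ^ N) ^ n := by
    intro N
    induction N with
    | zero => simp [qPoch]
    | succ N ih =>
      have h := qBinomial_step hq (hpow N) a
      have e1 : qPoch q z (N + 1) = qPoch q z N * (1 - z * q ^ N) := Finset.prod_range_succ _ _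
      have e2 : qPoch q (a * z) (N + 1) = qPoch q (a * z) N * (1 - a * z * q ^ N) :=
        Finset.prod_range_succ _ _
      rw [e1, e2, pow_succ, ← mul_assoc z]
      linear_combination (1 - z * q ^ N) * ih + qPoch q (a * z) N * h
  have hlim : Tendsto (fun N : ℕ => ∑' n : ℕ, qPoch q a n / qPoch q q n * (z * q ^ N) ^ n) atTop
      (𝓝 (∑' n : ℕ, if n = 0 then 1 else 0)) := by
    refine tendsto_tsum_of_dominated_convergence (summable_qBinomial hq hz a) (fun n => ?_)
      (Eventually.of_forall fun N n => ?_)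
    · rcases n with _ | n
      · simp [qPoch]
      · have h0 : Tendsto (fun N : ℕ => z * q ^ N) atTop (𝓝 (z * 0)) :=
          (tendsto_pow_atTop_nhds_zero_of_norm_lt_one hq).const_mul z
        simpa using (h0.pow (n + 1)).const_mul (qPoch q a (n + 1) / qPoch q q (n + 1))
    · rw [norm_mul, norm_mul, norm_pow, norm_pow]
      refine mul_le_mul_of_nonneg_left (pow_le_pow_left₀ (norm_nonneg _) ?_ n) (norm_nonneg _)
      rw [norm_mul, norm_pow]
      exact mul_le_of_le_one_right (norm_nonneg _) (pow_le_one₀ (norm_nonneg _) hq.le)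
  rw [tsum_ite_eq] at hlim
  have h1 := (tendsto_qPoch hq z).mul_const (∑' n : ℕ, qPoch q a n / qPoch q q n * z ^ n)
  have h2 := (tendsto_qPoch hq (a * z)).mul hlim
  simp only [hN] at h1
  have := tendsto_nhds_unique h1 h2
  rw [eq_div_iff (qPochInf_ne_zero hq hz)]
  linear_combination this

/-- Heine's argument: expand the quotient with b by the `q`-binomial theorem at argument b q^j,
interchange the sums, and sum over j by the same theorem at argument z q^m. -/
theorem tsum_heine {q z a b d : ℂ} (hq : ‖q‖ < 1) (hz : ‖z‖ < 1) (hb : ‖b‖ < 1)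
    (ha : qPochInf q a ≠ 0) (haz : qPochInf q (a * z) ≠ 0) :
    ∑' j : ℕ, z ^ j * (qPochInf q (q * q ^ j) * qPochInf q (d * b * q ^ j) /
        (qPochInf q (a * q ^ j) * qPochInf q (b * q ^ j))) =
      qPochInf q (a * z) * qPochInf q q / (qPochInf q z * qPochInf q a) *
        heinePhi q d z (a * z) b := by
  have hpow : ∀ {w : ℂ} (_ : ‖w‖ < 1) (N : ℕ), ‖w * q ^ N‖ < 1 := fun {w} hw N => by
    rw [norm_mul, norm_pow]
    exact mul_lt_one_of_nonneg_of_lt_one_left (norm_nonneg _) hw (pow_le_one₀ (norm_nonneg _) hq.le)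
  have hqq := qPochInf_ne_zero hq hq
  have hzz := qPochInf_ne_zero hq hz
  let F : ℕ → ℕ → ℂ := fun j m =>
    (qPoch q a j / qPoch q q j * z ^ j) * (qPoch q d m / qPoch q q m * b ^ m) * q ^ (j * m)
  have hF : Summable (Function.uncurry F) := by
    have h1 := (summable_qBinomial hq hz a).mul_of_nonneg (summable_qBinomial hq hb d)
      (fun _ => norm_nonneg _) (fun _ => norm_nonneg _)
    refine Summable.of_norm (Summable.of_nonneg_of_le (fun _ => norm_nonneg _) (fun x => ?_) h1)
    rw [Function.uncurry, norm_mul, norm_mul, norm_pow q]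
    exact mul_le_of_le_one_right (by positivity) (pow_le_one₀ (norm_nonneg _) hq.le)
  have e1 : ∀ j : ℕ, z ^ j * (qPochInf q (q * q ^ j) * qPochInf q (d * b * q ^ j) /
        (qPochInf q (a * q ^ j) * qPochInf q (b * q ^ j))) =
      qPochInf q q / qPochInf q a * ∑' m, F j m := by
    intro j
    have h := qBinomial hq (hpow hb j) d
    have hj : ∑' m, F j m = (qPoch q a j / qPoch q q j * z ^ j) *
        (qPochInf q (d * b * q ^ j) / qPochInf q (b * q ^ j)) := by
      rw [← mul_assoc] at h
      rw [← h, ← tsum_mul_left]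
      congr 1
      funext m
      simp only [F]
      rw [mul_pow, pow_mul]
      ring
    have n1 := qPoch_ne_zero_of_qPochInf hq ha j
    have n2 := qPoch_ne_zero_of_qPochInf hq hqq j
    have n3 := qPochInf_mul_pow_ne_zero hq ha j
    have n4 := qPochInf_ne_zero hq (hpow hb j)
    rw [hj, qPochInf_eq_qPoch_mul hq q j, qPochInf_eq_qPoch_mul hq a j]
    field_simp
  have e2 : ∀ m : ℕ, ∑' j, F j m = qPochInf q (a * z) / qPochInf q z *
      (b ^ m * (qPoch q d m * qPoch q z m) / (qPoch q (a * z) m * qPoch q q m)) := by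
    intro m
    have h := qBinomial hq (hpow hz m) a
    have hm : ∑' j, F j m = (qPoch q d m / qPoch q q m * b ^ m) *
        (qPochInf q (a * z * q ^ m) / qPochInf q (z * q ^ m)) := by
      rw [← mul_assoc] at h
      rw [← h, ← tsum_mul_left]
      congr 1
      funext j
      simp only [F]
      rw [mul_pow, mul_comm j m, pow_mul]
      ring
    have n1 := qPoch_ne_zero_of_qPochInf hq haz m
    have n2 := qPoch_ne_zero_of_qPochInf hq hqq m
    have n3 := qPochInf_mul_pow_ne_zero hq hzz m
    have n4 := qPoch_ne_zero_of_qPochInf hq hzz m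
    rw [hm, qPochInf_eq_qPoch_mul hq (a * z) m, qPochInf_eq_qPoch_mul hq z m]
    field_simp
  simp only [e1]
  rw [tsum_mul_left, ← hF.tsum_comm]
  simp only [e2]
  rw [tsum_mul_left, heinePhi]
  field_simp

/-! ### Theta functions -/

theorem qTheta_shift {q z : ℂ} (hq : ‖q‖ < 1) (hq0 : q ≠ 0) (hz : z ≠ 0) :
    qTheta q z = q * z * qTheta q (q * z) := by
  have e1 : qPochInf q (-(q * z)) = (1 + q * z) * qPochInf q (-(q * (q * z))) := by
    rw [qPochInf_eq_mul hq]
    ring_nf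
  have e2 : qPochInf q (-(1 / (q * z))) = (1 + 1 / (q * z)) * qPochInf q (-(1 / z)) := by
    rw [qPochInf_eq_mul hq]
    congr 1
    · ring
    · congr 1
      field_simp
  rw [qTheta, qTheta, e1, e2]
  field_simp
  ring

theorem qChar_shift {q c x : ℂ} (hq : ‖q‖ < 1) (hq0 : q ≠ 0) (hc : c ≠ 0) (hx : x ≠ 0) :
    qChar q c (q * x) = c * qChar q c x := by
  have h1 := qTheta_shift hq hq0 hx
  have h2 := qTheta_shift hq hq0 (mul_ne_zero hc hx)
  rw [qChar, qChar, h1, h2, show c * (q * x) = q * (c * x) by ring]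
  -- If the denominator vanishes on one side it does on both, and both quotients are 0 by
  -- convention.
  by_cases h : qTheta q (q * (c * x)) = 0
  · simp [h]
  · field_simp

/-- Countability is all that is needed of the zeros: the complement is dense, so good points exist
arbitrarily far out. -/
theorem countable_qTheta_eq_zero {q c : ℂ} (hq : ‖q‖ < 1) (hq0 : q ≠ 0) :
    {x : ℂ | qTheta q (c * x) = 0}.Countable := by
  have h1 := countable_qPochInf_eq_zero hq hq0 (c := -(q * c))
  have h2 : {x : ℂ | qPochInf q (-(1 / (c * x))) = 0}.Countable := by
    have := (countable_qPochInf_eq_zero hq hq0 (c := -(1 / c))).image (fun x => x⁻¹)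
    refine Set.Countable.mono ?_ this
    intro x hx
    refine ⟨x⁻¹, ?_, inv_inv x⟩
    simp only [Set.mem_ofPred_eq] at hx ⊢
    rw [← hx]
    congr 1
    rw [one_div, one_div, mul_inv]
    ring
  refine (h1.union h2).mono fun x hx => ?_
  simp only [Set.mem_ofPred_eq, qTheta, mul_eq_zero, qPochInf_ne_zero hq hq, false_or] at hx
  rcases hx with hx | hx
  · left
    simpa [mul_assoc] using hx
  · right
    exact hx

/-! ### The power x^σ under the `q`-shift -/

namespace LittleQJacobi

variable (P : LittleQJacobi)

theorem powσ_mul {x : ℂ} (hx : x ≠ 0) : P.powσ (P.q * x) = P.qσ * P.powσ x := by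
  rw [powσ, powσ, qσ, P.logBr_mul x hx, ← Complex.exp_add]
  ring_nf

theorem powσ_mul_pow {x : ℂ} (hx : x ≠ 0) (j : ℕ) :
    P.powσ (x * P.q ^ j) = P.qσ ^ j * P.powσ x := by
  induction j with
  | zero => simp
  | succ j ih =>
    rw [show x * P.q ^ (j + 1) = P.q * (x * P.q ^ j) by ring,
      P.powσ_mul (mul_ne_zero hx (pow_ne_zero _ P.q_ne_zero)), ih]
    ring

theorem powσ_ne_zero (x : ℂ) : P.powσ x ≠ 0 := Complex.exp_ne_zero _

theorem qσ_ne_zero : P.qσ ≠ 0 := Complex.exp_ne_zero _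

theorem norm_qσ_mul_pow_lt_one (k : ℕ) : ‖P.qσ * P.q ^ (k + 1)‖ < 1 := by
  have h : P.qσ * P.q = Complex.exp ((P.σ + 1) * P.logq) := by
    rw [add_mul, Complex.exp_add, one_mul, P.exp_logq, qσ]
  rw [pow_succ', ← mul_assoc, h, norm_mul, norm_pow]
  exact mul_lt_one_of_nonneg_of_lt_one_left (norm_nonneg _) P.norm_lt_one
    (pow_le_one₀ (norm_nonneg _) P.norm_q_lt_one.le)

/-! ### The weight under the shifts of `x` and `t` -/

/-- The ratio `b` of the leading coefficients in the Pearson equation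
`(x - a₁t)(x - a₃) w(qx) = b (x - a₂t)(x - a₄) w(x)`. -/
noncomputable def pearsonConst : ℂ := P.qσ * P.a₁ * P.a₃ / (P.a₂ * P.a₄)

theorem weight_qshift {t x : ℂ} (ht : t ≠ 0) (hx : x ≠ 0)
    (h2 : qPochInf P.q (x / (P.a₂ * t)) ≠ 0) (h4 : qPochInf P.q (x / P.a₄) ≠ 0) :
    (x - P.a₁ * t) * (x - P.a₃) * P.weight t (P.q * x) =
      P.pearsonConst * ((x - P.a₂ * t) * (x - P.a₄)) * P.weight t x := by
  have hq := P.norm_q_lt_one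
  have n1 := P.a₁_ne_zero
  have n2 := P.a₂_ne_zero
  have n3 := P.a₃_ne_zero
  have n4 := P.a₄_ne_zero
  rw [weight, weight, P.powσ_mul hx, pearsonConst, qPochInf_eq_mul hq (x / (P.a₁ * t)),
    qPochInf_eq_mul hq (x / P.a₃)]
  rw [qPochInf_eq_mul hq] at h2 h4
  rw [qPochInf_eq_mul hq (x / (P.a₂ * t)), qPochInf_eq_mul hq (x / P.a₄)]
  simp only [mul_div_assoc P.q]
  have m2 := left_ne_zero_of_mul h2
  have m4 := left_ne_zero_of_mul h4
  have r2 := right_ne_zero_of_mul h2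
  have r4 := right_ne_zero_of_mul h4
  rw [one_sub_div (mul_ne_zero n2 ht)] at m2
  rw [one_sub_div n4] at m4
  have k2 : P.a₂ * t - x ≠ 0 := fun h => m2 (by rw [h, zero_div])
  have k4 : P.a₄ - x ≠ 0 := fun h => m4 (by rw [h, zero_div])
  generalize qPochInf P.q _ = u1
  generalize qPochInf P.q _ = u3
  generalize qPochInf P.q (P.q * (x / (P.a₂ * t))) = u2 at *
  generalize qPochInf P.q (P.q * (x / P.a₄)) = u4 at *
  rw [one_sub_div (mul_ne_zero n1 ht), one_sub_div (mul_ne_zero n2 ht), one_sub_div n3,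
    one_sub_div n4]
  have k2' : t * P.a₂ - x ≠ 0 := by rwa [mul_comm]
  field_simp
  ring

theorem weight_tshift {t x : ℂ} (ht : t ≠ 0) (h2 : qPochInf P.q (x / (P.a₂ * t)) ≠ 0) :
    P.a₁ * (x - P.a₂ * t) * P.weight t x =
      P.a₂ * (x - P.a₁ * t) * P.weight (t / P.q) x := by
  have hq := P.norm_q_lt_one
  have n1 := P.a₁_ne_zero
  have n2 := P.a₂_ne_zero
  have nq := P.q_ne_zero
  have e1 : x / (P.a₁ * (t / P.q)) = P.q * (x / (P.a₁ * t)) := by field_simp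
  have e2 : x / (P.a₂ * (t / P.q)) = P.q * (x / (P.a₂ * t)) := by field_simp
  rw [weight, weight, e1, e2, qPochInf_eq_mul hq (x / (P.a₁ * t))]
  rw [qPochInf_eq_mul hq] at h2
  rw [qPochInf_eq_mul hq (x / (P.a₂ * t))]
  have m2 := left_ne_zero_of_mul h2
  have r2 := right_ne_zero_of_mul h2
  rw [one_sub_div (mul_ne_zero n2 ht)] at m2
  have k2 : P.a₂ * t - x ≠ 0 := fun h => m2 (by rw [h, zero_div])
  rw [one_sub_div (mul_ne_zero n1 ht), one_sub_div (mul_ne_zero n2 ht)]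
  -- The weights at t and t/q share this factor of the denominator, so if it vanishes both are 0.
  by_cases h4 : qPochInf P.q (x / P.a₄) = 0
  · simp [h4]
  · field_simp
    ring

theorem weight_qtshift {t x : ℂ} (ht : t ≠ 0) (hx : x ≠ 0)
    (h4 : qPochInf P.q (x / P.a₄) ≠ 0) :
    (x - P.a₃) * P.weight t (P.q * x) =
      P.pearsonConst * P.a₂ / P.a₁ * (x - P.a₄) * P.weight (t / P.q) x := by
  have hq := P.norm_q_lt_one
  have n1 := P.a₁_ne_zero
  have n2 := P.a₂_ne_zero
  have n3 := P.a₃_ne_zero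
  have n4 := P.a₄_ne_zero
  have nq := P.q_ne_zero
  have e1 : x / (P.a₁ * (t / P.q)) = P.q * x / (P.a₁ * t) := by field_simp
  have e2 : x / (P.a₂ * (t / P.q)) = P.q * x / (P.a₂ * t) := by field_simp
  rw [weight, weight, e1, e2, P.powσ_mul hx, pearsonConst, qPochInf_eq_mul hq (x / P.a₃)]
  rw [qPochInf_eq_mul hq] at h4
  rw [qPochInf_eq_mul hq (x / P.a₄)]
  simp only [mul_div_assoc P.q]
  have m4 := left_ne_zero_of_mul h4
  have r4 := right_ne_zero_of_mul h4
  rw [one_sub_div n4] at m4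
  have k4 : P.a₄ - x ≠ 0 := fun h => m4 (by rw [h, zero_div])
  rw [one_sub_div n4, one_sub_div n3]
  by_cases h2 : qPochInf P.q (P.q * (x / (P.a₂ * t))) = 0
  · simp [h2]
  · field_simp
    ring

/-! ### Sums over a lattice -/

/-- The weight has no pole at the points `E q^j`. -/
def RegularOn (t E : ℂ) : Prop :=
  qPochInf P.q (E / (P.a₂ * t)) ≠ 0 ∧ qPochInf P.q (E / P.a₄) ≠ 0

/-- The lattice sum `∑ q^j x^k w(x,t)` over `x = E q^j`. -/
noncomputable def latticeSum (t E : ℂ) (k : ℕ) : ℂ :=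
  ∑' j : ℕ, P.q ^ j * ((E * P.q ^ j) ^ k * P.weight t (E * P.q ^ j))

variable {P}

theorem RegularOn.shift {t E : ℂ} (h : P.RegularOn t E) (j : ℕ) :
    P.RegularOn t (E * P.q ^ j) := by
  have e2 : E * P.q ^ j / (P.a₂ * t) = E / (P.a₂ * t) * P.q ^ j := by ring
  have e4 : E * P.q ^ j / P.a₄ = E / P.a₄ * P.q ^ j := by ring
  rw [RegularOn, e2, e4]
  exact ⟨qPochInf_mul_pow_ne_zero P.norm_q_lt_one h.1 j,
    qPochInf_mul_pow_ne_zero P.norm_q_lt_one h.2 j⟩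

theorem RegularOn.summable_norm {t E : ℂ} (hE : E ≠ 0) (h : P.RegularOn t E) :
    Summable fun j : ℕ => ‖P.q ^ j * P.weight t (E * P.q ^ j)‖ := by
  have hq := P.norm_q_lt_one
  obtain ⟨M₂, h₂⟩ := exists_norm_qPochInf_mul_pow_le hq (E / (P.a₁ * t)) _ h.1
  obtain ⟨M₄, h₄⟩ := exists_norm_qPochInf_mul_pow_le hq (E / P.a₃) _ h.2
  have hM₂ : 0 ≤ M₂ := (norm_nonneg _).trans (h₂ 0)
  have hg : ‖P.qσ * P.q‖ < 1 := by simpa using P.norm_qσ_mul_pow_lt_one 0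
  refine Summable.of_nonneg_of_le (fun _ => norm_nonneg _) (fun j => ?_)
    ((summable_geometric_of_lt_one (norm_nonneg _) hg).mul_left (‖P.powσ E‖ * (M₂ * M₄)))
  have e : P.q ^ j * P.weight t (E * P.q ^ j) = P.powσ E *
      ((qPochInf P.q (E / (P.a₁ * t) * P.q ^ j) / qPochInf P.q (E / (P.a₂ * t) * P.q ^ j)) *
        (qPochInf P.q (E / P.a₃ * P.q ^ j) / qPochInf P.q (E / P.a₄ * P.q ^ j))) *
      (P.qσ * P.q) ^ j := by
    rw [weight, P.powσ_mul_pow hE]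
    simp only [mul_div_right_comm E]
    ring
  rw [e, norm_mul, norm_mul, norm_mul, norm_pow]
  gcongr
  · exact h₂ j
  · exact h₄ j

theorem RegularOn.hasSum {t E : ℂ} (hE : E ≠ 0) (h : P.RegularOn t E) (k : ℕ) :
    HasSum (fun j : ℕ => P.q ^ j * ((E * P.q ^ j) ^ k * P.weight t (E * P.q ^ j)))
      (P.latticeSum t E k) := by
  refine Summable.hasSum (Summable.of_norm (Summable.of_nonneg_of_le (fun _ => norm_nonneg _)
    (fun j => ?_) ((h.summable_norm hE).mul_left (‖E‖ ^ k))))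
  rw [show P.q ^ j * ((E * P.q ^ j) ^ k * P.weight t (E * P.q ^ j)) =
    (E * P.q ^ j) ^ k * (P.q ^ j * P.weight t (E * P.q ^ j)) by ring, norm_mul]
  refine mul_le_mul_of_nonneg_right ?_ (norm_nonneg _)
  rw [norm_pow, norm_mul, norm_pow]
  exact pow_le_pow_left₀ (by positivity) (mul_le_of_le_one_right (norm_nonneg _)
    (pow_le_one₀ (norm_nonneg _) P.norm_q_lt_one.le)) k

theorem RegularOn.exists_norm_le {t E : ℂ} (hE : E ≠ 0) (h : P.RegularOn t E) :
    ∃ M : ℝ, ∀ k, ‖P.latticeSum t E k‖ ≤ M * ‖E‖ ^ k := by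
  refine ⟨∑' j : ℕ, ‖P.q ^ j * P.weight t (E * P.q ^ j)‖, fun k => ?_⟩
  rw [mul_comm, ← tsum_mul_left]
  refine tsum_of_norm_bounded ((h.summable_norm hE).mul_left _).hasSum fun j => ?_
  rw [show P.q ^ j * ((E * P.q ^ j) ^ k * P.weight t (E * P.q ^ j)) =
    (E * P.q ^ j) ^ k * (P.q ^ j * P.weight t (E * P.q ^ j)) by ring, norm_mul]
  refine mul_le_mul_of_nonneg_right ?_ (norm_nonneg _)
  rw [norm_pow, norm_mul, norm_pow]
  exact pow_le_pow_left₀ (by positivity) (mul_le_of_le_one_right (norm_nonneg _)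
    (pow_le_one₀ (norm_nonneg _) P.norm_q_lt_one.le)) k

/-- Summation by shifting the lattice by one step; `h0` is the vanishing of the boundary term. -/
theorem hasSum_shift {u v : ℕ → ℂ} {a b c : ℂ} (hu : HasSum u a) (hv : HasSum v b)
    (h0 : u 0 = 0) (h : ∀ j, u (j + 1) = c * v j) : a = c * b := by
  have h1 := (hasSum_nat_add_iff' 1).2 hu
  simp only [Finset.sum_range_one, h0, sub_zero, h] at h1
  exact h1.unique (hv.mul_left c)

/-- The left side sums q^j x^k A(x/q) w(x) over x = E q^j, with A = (x - a₁t)(x - a₃). By `h0` the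
first term is zero, and the Pearson equation turns term j + 1 into q^(k+1) times term j of the right
side. -/
theorem latticeSum_pearson {t E : ℂ} (ht : t ≠ 0) (hE : E ≠ 0) (h : P.RegularOn t E)
    (h0 : (E / P.q - P.a₁ * t) * (E / P.q - P.a₃) = 0) (k : ℕ) :
    P.latticeSum t E (k + 2) / P.q ^ 2 - (P.a₁ * t + P.a₃) * (P.latticeSum t E (k + 1) / P.q) +
        P.a₁ * t * P.a₃ * P.latticeSum t E k =
      P.q ^ (k + 1) * P.pearsonConst * (P.latticeSum t E (k + 2) -
        (P.a₂ * t + P.a₄) * P.latticeSum t E (k + 1) + P.a₂ * t * P.a₄ * P.latticeSum t E k) := by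
  have nq := P.q_ne_zero
  have s := h.hasSum hE
  refine hasSum_shift ((((s (k + 2)).div_const (P.q ^ 2)).sub
    (((s (k + 1)).div_const P.q).mul_left (P.a₁ * t + P.a₃))).add
    ((s k).mul_left (P.a₁ * t * P.a₃)))
    (((s (k + 2)).sub ((s (k + 1)).mul_left (P.a₂ * t + P.a₄))).add
    ((s k).mul_left (P.a₂ * t * P.a₄))) ?_ fun j => ?_
  · simp only [pow_zero, mul_one, one_mul]
    linear_combination E ^ k * P.weight t E * h0
  · have hw := P.weight_qshift ht (mul_ne_zero hE (pow_ne_zero j nq)) (h.shift j).1 (h.shift j).2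
    rw [show E * P.q ^ (j + 1) = P.q * (E * P.q ^ j) by ring]
    generalize P.weight t (P.q * (E * P.q ^ j)) = w' at *
    generalize E * P.q ^ j = x at *
    have e : P.q ^ (j + 1) * ((P.q * x) ^ (k + 2) * w') / P.q ^ 2 -
        (P.a₁ * t + P.a₃) * (P.q ^ (j + 1) * ((P.q * x) ^ (k + 1) * w') / P.q) =
        P.q ^ (j + 1) * (P.q ^ k * (x ^ (k + 2) * w')) -
        (P.a₁ * t + P.a₃) * (P.q ^ (j + 1) * (P.q ^ k * (x ^ (k + 1) * w'))) := by
      field_simp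
      ring
    rw [e, mul_pow]
    linear_combination P.q ^ (j + 1) * P.q ^ k * x ^ k * hw

theorem latticeSum_tshift {t E : ℂ} (ht : t ≠ 0) (hE : E ≠ 0) (h : P.RegularOn t E)
    (h' : P.RegularOn (t / P.q) E) (k : ℕ) :
    P.a₁ * (P.latticeSum t E (k + 1) - P.a₂ * t * P.latticeSum t E k) =
      P.a₂ * (P.latticeSum (t / P.q) E (k + 1) - P.a₁ * t * P.latticeSum (t / P.q) E k) := by
  have s := h.hasSum hE
  have s' := h'.hasSum hE
  rw [← (((s (k + 1)).sub ((s k).mul_left (P.a₂ * t))).mul_left P.a₁).tsum_eq,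
    ← (((s' (k + 1)).sub ((s' k).mul_left (P.a₁ * t))).mul_left P.a₂).tsum_eq]
  refine tsum_congr fun j => ?_
  linear_combination P.q ^ j * (E * P.q ^ j) ^ k * P.weight_tshift ht (h.shift j).1

/-- Here the end point moves with t: the lattice at t/q has the extra point a₁t, and the factor x -
a₁t removes it. -/
theorem latticeSum_tshift_end {t E : ℂ} (ht : t ≠ 0) (hE : E = P.a₁ * t)
    (h : P.RegularOn t (P.q * E)) (h' : P.RegularOn (t / P.q) E) (k : ℕ) :
    P.a₂ * (P.latticeSum (t / P.q) E (k + 1) - P.a₁ * t * P.latticeSum (t / P.q) E k) =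
      P.q * (P.a₁ * (P.latticeSum t (P.q * E) (k + 1) -
        P.a₂ * t * P.latticeSum t (P.q * E) k)) := by
  have hE0 : E ≠ 0 := hE ▸ mul_ne_zero P.a₁_ne_zero ht
  have s := h.hasSum (mul_ne_zero P.q_ne_zero hE0)
  have s' := h'.hasSum hE0
  refine hasSum_shift (((s' (k + 1)).sub ((s' k).mul_left (P.a₁ * t))).mul_left P.a₂)
    (((s (k + 1)).sub ((s k).mul_left (P.a₂ * t))).mul_left P.a₁) ?_ fun j => ?_
  · rw [hE]
    ring
  · have hw := P.weight_tshift ht (h.shift j).1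
    rw [show E * P.q ^ (j + 1) = P.q * E * P.q ^ j by ring]
    linear_combination -P.q ^ (j + 1) * (P.q * E * P.q ^ j) ^ k * hw

/-- The end point q a₃ is the same at t and t/q while the relation shifts x by q; the unmatched
first term is removed by x/q - a₃. -/
theorem latticeSum_qtshift {t E : ℂ} (ht : t ≠ 0) (hE0 : E ≠ 0) (hE : E / P.q = P.a₃)
    (h : P.RegularOn t E) (h' : P.RegularOn (t / P.q) E) (k : ℕ) :
    P.latticeSum t E (k + 1) / P.q - P.a₃ * P.latticeSum t E k =
      P.q ^ (k + 1) * (P.pearsonConst * P.a₂ / P.a₁) *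
        (P.latticeSum (t / P.q) E (k + 1) - P.a₄ * P.latticeSum (t / P.q) E k) := by
  have nq := P.q_ne_zero
  have s := h.hasSum hE0
  have s' := h'.hasSum hE0
  refine hasSum_shift (((s (k + 1)).div_const P.q).sub ((s k).mul_left P.a₃))
    ((s' (k + 1)).sub ((s' k).mul_left P.a₄)) ?_ fun j => ?_
  · simp only [pow_zero, mul_one, one_mul]
    linear_combination E ^ k * P.weight t E * hE
  · have hw := P.weight_qtshift ht (mul_ne_zero hE0 (pow_ne_zero j nq)) (h'.shift j).2
    rw [show E * P.q ^ (j + 1) = P.q * (E * P.q ^ j) by ring]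
    generalize P.weight t (P.q * (E * P.q ^ j)) = w' at *
    generalize E * P.q ^ j = x at *
    have e : P.q ^ (j + 1) * ((P.q * x) ^ (k + 1) * w') / P.q =
        P.q ^ (j + 1) * (P.q ^ k * (x ^ (k + 1) * w')) := by
      field_simp
      ring
    rw [e, mul_pow]
    linear_combination P.q ^ (j + 1) * P.q ^ k * x ^ k * hw

/-- The end points at t and t/q differ by the factor q, exactly as the arguments of the weights do
in `weight_qtshift`, so the sums agree term by term. -/
theorem latticeSum_qtshift_end {t E : ℂ} (ht : t ≠ 0) (hE0 : E ≠ 0)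
    (h : P.RegularOn t (P.q * E)) (h' : P.RegularOn (t / P.q) E) (k : ℕ) :
    P.latticeSum t (P.q * E) (k + 1) / P.q - P.a₃ * P.latticeSum t (P.q * E) k =
      P.q ^ k * (P.pearsonConst * P.a₂ / P.a₁) *
        (P.latticeSum (t / P.q) E (k + 1) - P.a₄ * P.latticeSum (t / P.q) E k) := by
  have nq := P.q_ne_zero
  have s := h.hasSum (mul_ne_zero nq hE0)
  have s' := h'.hasSum hE0
  rw [← (((s (k + 1)).div_const P.q).sub ((s k).mul_left P.a₃)).tsum_eq,
    ← (((s' (k + 1)).sub ((s' k).mul_left P.a₄)).mul_left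
      (P.q ^ k * (P.pearsonConst * P.a₂ / P.a₁))).tsum_eq]
  refine tsum_congr fun j => ?_
  have hw := P.weight_qtshift ht (mul_ne_zero hE0 (pow_ne_zero j nq)) (h'.shift j).2
  rw [mul_assoc P.q E]
  generalize P.weight t (P.q * (E * P.q ^ j)) = w' at *
  generalize E * P.q ^ j = x at *
  have e : P.q ^ j * ((P.q * x) ^ (k + 1) * w') / P.q =
      P.q ^ j * (P.q ^ k * (x ^ (k + 1) * w')) := by
    field_simp
    ring
  rw [e, mul_pow]
  linear_combination P.q ^ j * P.q ^ k * x ^ k * hw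

/-! ### The moments -/

variable (P) in
/-- The contribution of the end point `e` to the `k`-th moment. -/
noncomputable def endMoment (t : ℂ) (e : SupportEnd) (k : ℕ) : ℂ :=
  jacksonInt₀ P.q (fun x => x ^ k * P.weight t x) (P.endpoint t e)

theorem moment_eq (e₀ e₁ : SupportEnd) (t : ℂ) (k : ℕ) :
    P.moment e₀ e₁ t k = P.endMoment t e₁ k - P.endMoment t e₀ k := rfl

theorem endMoment_eq (t : ℂ) (e : SupportEnd) (k : ℕ) :
    P.endMoment t e k =
      P.endpoint t e * (1 - P.q) * P.latticeSum t (P.endpoint t e) k := rfl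

theorem endMoment_zero (t : ℂ) (k : ℕ) : P.endMoment t .zero k = 0 := by
  simp [endMoment_eq, endpoint]

theorem endpoint_ne_zero {t : ℂ} (ht : t ≠ 0) {e : SupportEnd} (he : e ≠ .zero) :
    P.endpoint t e ≠ 0 := by
  cases e
  · exact absurd rfl he
  · exact mul_ne_zero P.q_ne_zero P.a₃_ne_zero
  · exact mul_ne_zero (mul_ne_zero P.q_ne_zero P.a₁_ne_zero) ht

theorem exists_norm_endMoment_le {t : ℂ} (ht : t ≠ 0) {e : SupportEnd} (h : P.RegularAt t e) :
    ∃ M : ℝ, 0 ≤ M ∧ ∀ k, ‖P.endMoment t e k‖ ≤ M * ‖P.endpoint t e‖ ^ k := by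
  by_cases he : e = .zero
  · subst he
    exact ⟨0, le_rfl, fun k => by simp [endMoment_zero]⟩
  · obtain ⟨M, hM⟩ := RegularOn.exists_norm_le (P := P) (endpoint_ne_zero ht he) h
    have hM0 : 0 ≤ M := by simpa using (norm_nonneg _).trans (hM 0)
    refine ⟨‖P.endpoint t e * (1 - P.q)‖ * M, by positivity, fun k => ?_⟩
    rw [endMoment_eq, norm_mul, mul_assoc]
    exact mul_le_mul_of_nonneg_left (hM k) (norm_nonneg _)

theorem exists_norm_moment_le {t : ℂ} (ht : t ≠ 0) {e₀ e₁ : SupportEnd}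
    (h₀ : P.RegularAt t e₀) (h₁ : P.RegularAt t e₁) :
    ∃ M : ℝ, ∀ k, ‖P.moment e₀ e₁ t k‖ ≤
      M * max ‖P.endpoint t e₀‖ ‖P.endpoint t e₁‖ ^ k := by
  obtain ⟨M₀, hM₀, b₀⟩ := exists_norm_endMoment_le ht h₀
  obtain ⟨M₁, hM₁, b₁⟩ := exists_norm_endMoment_le ht h₁
  refine ⟨M₁ + M₀, fun k => ?_⟩
  rw [moment_eq, add_mul]
  refine (norm_sub_le _ _).trans (add_le_add ((b₁ k).trans ?_) ((b₀ k).trans ?_))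
  · gcongr
    exact le_max_right _ _
  · gcongr
    exact le_max_left _ _

theorem endMoment_pearson {t : ℂ} (ht : t ≠ 0) {e : SupportEnd} (h : P.RegularAt t e) (k : ℕ) :
    P.endMoment t e (k + 2) / P.q ^ 2 - (P.a₁ * t + P.a₃) * (P.endMoment t e (k + 1) / P.q) +
        P.a₁ * t * P.a₃ * P.endMoment t e k =
      P.q ^ (k + 1) * P.pearsonConst * (P.endMoment t e (k + 2) -
        (P.a₂ * t + P.a₄) * P.endMoment t e (k + 1) + P.a₂ * t * P.a₄ * P.endMoment t e k) := by
  have nq := P.q_ne_zero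
  by_cases he : e = .zero
  · subst he
    simp [endMoment_zero]
  · have key := latticeSum_pearson ht (endpoint_ne_zero ht he) h (by
      cases e
      · exact absurd rfl he
      · simp [endpoint, nq]
      · simp [endpoint, nq, mul_assoc]) k
    simp only [endMoment_eq]
    linear_combination P.endpoint t e * (1 - P.q) * key

theorem endMoment_tshift {t : ℂ} (ht : t ≠ 0) {e : SupportEnd} (h : P.RegularAt t e)
    (h' : P.RegularAt (t / P.q) e) (k : ℕ) :
    P.a₁ * (P.endMoment t e (k + 1) - P.a₂ * t * P.endMoment t e k) =
      P.a₂ * (P.endMoment (t / P.q) e (k + 1) - P.a₁ * t * P.endMoment (t / P.q) e k) := by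
  have nq := P.q_ne_zero
  simp only [endMoment_eq]
  cases e
  · simp [endpoint]
  · have key := latticeSum_tshift ht (endpoint_ne_zero (e := .atA₃) ht (by simp)) h h' k
    simp only [endpoint] at key ⊢
    linear_combination P.q * P.a₃ * (1 - P.q) * key
  · have e1 : P.endpoint (t / P.q) .atA₁t = P.a₁ * t := by
      simp only [endpoint]
      field_simp
    have e2 : P.endpoint t .atA₁t = P.q * (P.a₁ * t) := by
      simp only [endpoint]
      ring
    rw [RegularAt, e2] at h
    rw [RegularAt, e1] at h'
    have key := latticeSum_tshift_end ht rfl h h' k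
    rw [e1, e2]
    linear_combination -P.a₁ * t * (1 - P.q) * key

theorem endMoment_qtshift {t : ℂ} (ht : t ≠ 0) {e : SupportEnd} (h : P.RegularAt t e)
    (h' : P.RegularAt (t / P.q) e) (k : ℕ) :
    P.endMoment t e (k + 1) / P.q - P.a₃ * P.endMoment t e k =
      P.q ^ (k + 1) * (P.pearsonConst * P.a₂ / P.a₁) *
        (P.endMoment (t / P.q) e (k + 1) - P.a₄ * P.endMoment (t / P.q) e k) := by
  have nq := P.q_ne_zero
  simp only [endMoment_eq]
  cases e
  · simp [endpoint]
  · have key := latticeSum_qtshift ht (endpoint_ne_zero (e := .atA₃) ht (by simp))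
      (by simp [endpoint, nq]) h h' k
    simp only [endpoint] at key ⊢
    linear_combination P.q * P.a₃ * (1 - P.q) * key
  · have e1 : P.endpoint (t / P.q) .atA₁t = P.a₁ * t := by
      simp only [endpoint]
      field_simp
    have e2 : P.endpoint t .atA₁t = P.q * (P.a₁ * t) := by
      simp only [endpoint]
      ring
    rw [RegularAt, e2] at h
    rw [RegularAt, e1] at h'
    have key := latticeSum_qtshift_end ht (mul_ne_zero P.a₁_ne_zero ht) h h' k
    rw [e1, e2]
    linear_combination P.q * (P.a₁ * t) * (1 - P.q) * key

/-! ### Moments through Heine's function -/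

/-- At the end point q a₃ the factor (x/a₃;q)_∞ becomes (q^(j+1);q)_∞, and `tsum_heine` applies with
z = q^(σ+k+1), b = q a₃/(a₂t), d = a₂/a₁. At q a₁t the pairs (a₁t, a₂t) and (a₃, a₄) exchange roles.
-/
theorem endMoment_eq_heineTerm {t : ℂ} (ht : t ≠ 0) {e : SupportEnd} (h : P.RegularAt t e)
    {k : ℕ} (hc : P.HeineConverges t k e) : P.endMoment t e k = P.heineTerm t k e := by
  have hq := P.norm_q_lt_one
  have n1 := P.a₁_ne_zero
  have n2 := P.a₂_ne_zero
  have n3 := P.a₃_ne_zero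
  have n4 := P.a₄_ne_zero
  have nq := P.q_ne_zero
  have hz := P.norm_qσ_mul_pow_lt_one k
  cases e
  · simp [endMoment_zero, heineTerm]
  · obtain ⟨hb, haz⟩ := hc
    have e0 : P.a₃ * (P.qσ * P.q ^ (k + 2)) / P.a₄ =
        P.q * P.a₃ / P.a₄ * (P.qσ * P.q ^ (k + 1)) := by ring
    rw [e0] at haz
    have ha : qPochInf P.q (P.q * P.a₃ / P.a₄) ≠ 0 := h.2
    have key := tsum_heine (d := P.a₂ / P.a₁) hq hz hb ha haz
    simp only [heineTerm]
    rw [e0, mul_div_assoc, mul_assoc, ← key, endMoment_eq, latticeSum, ← tsum_mul_left, ← tsum_mul_left]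
    congr 1
    funext j
    simp only [endpoint]
    rw [weight, P.powσ_mul_pow (mul_ne_zero nq n3)]
    rw [show P.q * P.a₃ * P.q ^ j / P.a₃ = P.q * P.q ^ j by field_simp,
      show P.q * P.a₃ * P.q ^ j / (P.a₁ * t) =
        P.a₂ / P.a₁ * (P.q * P.a₃ / (P.a₂ * t)) * P.q ^ j by field_simp,
      show P.q * P.a₃ * P.q ^ j / (P.a₂ * t) = P.q * P.a₃ / (P.a₂ * t) * P.q ^ j by ring,
      show P.q * P.a₃ * P.q ^ j / P.a₄ = P.q * P.a₃ / P.a₄ * P.q ^ j by ring]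
    ring
  · obtain ⟨hb, haz⟩ := hc
    have e0 : P.a₁ * (P.qσ * P.q ^ (k + 2)) / P.a₂ =
        P.q * P.a₁ / P.a₂ * (P.qσ * P.q ^ (k + 1)) := by ring
    have e1 : P.q * P.a₁ * t / (P.a₂ * t) = P.q * P.a₁ / P.a₂ := by field_simp
    rw [e0] at haz
    have ha : qPochInf P.q (P.q * P.a₁ / P.a₂) ≠ 0 := e1 ▸ h.1
    have key := tsum_heine (d := P.a₄ / P.a₃) hq hz hb ha haz
    simp only [heineTerm]
    rw [e0, mul_div_assoc, mul_assoc, ← key, endMoment_eq, latticeSum, ← tsum_mul_left,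
      ← tsum_mul_left]
    congr 1
    funext j
    simp only [endpoint]
    rw [weight, P.powσ_mul_pow (mul_ne_zero (mul_ne_zero nq n1) ht)]
    rw [show P.q * P.a₁ * t * P.q ^ j / P.a₃ =
        P.a₄ / P.a₃ * (P.q * P.a₁ * t / P.a₄) * P.q ^ j by field_simp,
      show P.q * P.a₁ * t * P.q ^ j / (P.a₁ * t) = P.q * P.q ^ j by field_simp,
      show P.q * P.a₁ * t * P.q ^ j / (P.a₂ * t) = P.q * P.a₁ / P.a₂ * P.q ^ j by field_simp,
      show P.q * P.a₁ * t * P.q ^ j / P.a₄ = P.q * P.a₁ * t / P.a₄ * P.q ^ j by ring]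
    ring

end LittleQJacobi

/-! ### Two-term expansions at infinity -/

/-- `g(x) = x^k (c + d/x + o(1/x))` as `x → ∞`. -/
def HasExpansion (g : ℂ → ℂ) (k : ℤ) (c d : ℂ) : Prop :=
  Tendsto (fun x => x * (g x * x ^ (-k) - c)) (cobounded ℂ) (𝓝 d)

namespace HasExpansion

variable {f g : ℂ → ℂ} {k l : ℤ} {c d c' d' : ℂ}

theorem tendsto_lead (h : HasExpansion g k c d) :
    Tendsto (fun x => g x * x ^ (-k)) (cobounded ℂ) (𝓝 c) := by
  have h1 := (tendsto_inv₀_cobounded (α := ℂ)).mul h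
  rw [zero_mul] at h1
  have h2 := h1.add_const c
  rw [zero_add] at h2
  refine h2.congr' ?_
  filter_upwards [Bornology.eventually_ne_cobounded (0 : ℂ)] with x hx
  field_simp
  ring

theorem congr' (h : HasExpansion g k c d) (hfg : g =ᶠ[cobounded ℂ] f) :
    HasExpansion f k c d :=
  Tendsto.congr' (hfg.mono fun x hx => by simp only [hx]) h

theorem sub (h : HasExpansion f k c d) (h' : HasExpansion g k c' d') :
    HasExpansion (fun x => f x - g x) k (c - c') (d - d') :=
  (Tendsto.sub h h').congr fun x => by ring

theorem const_mul (a : ℂ) (h : HasExpansion g k c d) :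
    HasExpansion (fun x => a * g x) k (a * c) (a * d) :=
  (Tendsto.const_mul a h).congr fun x => by ring

theorem mul (h : HasExpansion f k c d) (h' : HasExpansion g l c' d') :
    HasExpansion (fun x => f x * g x) (k + l) (c * c') (d * c' + c * d') := by
  have := (Tendsto.mul h h'.tendsto_lead).add (Tendsto.const_mul c h')
  refine this.congr' ?_
  filter_upwards [Bornology.eventually_ne_cobounded (0 : ℂ)] with x hx
  rw [neg_add, zpow_add₀ hx]
  ring

/-- An expansion may be read one order higher, with leading coefficient 0. This brings summands of
different orders to a common one. -/
theorem raise (h : HasExpansion g k c d) : HasExpansion g (k + 1) 0 c := by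
  refine h.tendsto_lead.congr' ?_
  filter_upwards [Bornology.eventually_ne_cobounded (0 : ℂ)] with x hx
  rw [neg_add, zpow_add₀ hx, zpow_neg_one]
  field_simp
  ring

theorem raise_two (h : HasExpansion g k c d) : HasExpansion g (k + 2) 0 0 := by
  have := h.raise.raise
  rwa [add_assoc] at this

theorem scale (h : HasExpansion g k c d) {q : ℂ} (hq : q ≠ 0) :
    HasExpansion (fun x => g (q * x)) k (c * q ^ k) (d * q ^ (k - 1)) := by
  have h1 := (Tendsto.comp h (tendsto_mul_left_cobounded hq)).mul_const (q ^ (k - 1))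
  refine h1.congr' ?_
  filter_upwards [Bornology.eventually_ne_cobounded (0 : ℂ)] with x hx
  simp only [Function.comp]
  rw [mul_zpow, zpow_sub_one₀ hq, zpow_neg q]
  have := zpow_ne_zero k hq
  field_simp

theorem unique (h : HasExpansion g k c d) (h' : HasExpansion g k c' d') : c = c' ∧ d = d' := by
  have h1 := tendsto_nhds_unique h.tendsto_lead h'.tendsto_lead
  subst h1
  exact ⟨rfl, tendsto_nhds_unique h h'⟩

theorem monomial (n j : ℕ) (hj : j ≤ n) (a : ℂ) :
    HasExpansion (fun x => a * x ^ j) n (if j = n then a else 0) (if j + 1 = n then a else 0) := by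
  have h0 : HasExpansion (fun x => a * x ^ j) j a 0 := by
    refine tendsto_const_nhds.congr' ?_
    filter_upwards [Bornology.eventually_ne_cobounded (0 : ℂ)] with x hx
    rw [zpow_neg, zpow_natCast]
    field_simp
    simp
  obtain ⟨i, rfl⟩ := Nat.exists_eq_add_of_le hj
  clear hj
  rcases i with _ | i
  · simpa using h0
  · have h1 : ∀ i : ℕ, HasExpansion (fun x => a * x ^ j) ((j + (i + 1) : ℕ) : ℤ) 0
        (if i = 0 then a else 0) := by
      intro i
      induction i with
      | zero => simpa using h0.raise
      | succ i ih =>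
        have := ih.raise
        simpa [add_assoc] using this
    have h2 := h1 i
    convert! h2 using 1
    · simp
    · congr 1
      simp

theorem add (h : HasExpansion f k c d) (h' : HasExpansion g k c' d') :
    HasExpansion (fun x => f x + g x) k (c + c') (d + d') :=
  (Tendsto.add h h').congr fun x => by ring

/-- Writing the second coefficient as `(X * p).coeff n` rather than `p.coeff (n - 1)` gives the
right value 0 at n = 0. -/
theorem polynomial (p : ℂ[X]) (n : ℕ) (hp : p.natDegree ≤ n) :
    HasExpansion (fun x => p.eval x) n (p.coeff n) ((X * p).coeff n) := by
  have key : ∀ s : Finset ℕ, (∀ j ∈ s, j ≤ n) →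
      HasExpansion (fun x => ∑ j ∈ s, p.coeff j * x ^ j) n
        (∑ j ∈ s, if j = n then p.coeff j else 0) (∑ j ∈ s, if j + 1 = n then p.coeff j else 0) := by
    intro s
    induction s using Finset.induction_on with
    | empty =>
      intro _
      refine tendsto_const_nhds.congr fun x => ?_
      simp
    | insert a s ha ih =>
      intro hs
      simp only [Finset.sum_insert ha]
      exact (monomial n a (hs a (by simp)) _).add (ih fun j hj => hs j (by simp [hj]))
  have h := key (Finset.range (n + 1)) fun j hj => Nat.lt_succ_iff.1 (Finset.mem_range.1 hj)
  have e : (fun x => p.eval x) = fun x => ∑ j ∈ Finset.range (n + 1), p.coeff j * x ^ j := by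
    funext x
    rw [eval_eq_sum_range' (Nat.lt_succ_of_le hp)]
  rw [e]
  convert! h using 1
  · rw [Finset.sum_ite_eq' (Finset.range (n + 1))]
    simp
  · rcases n with _ | m
    · simp
    · simp [Finset.sum_ite_eq']

/-- Were the degree larger than n, raising the given expansion to the order of the degree would make
the leading coefficient 0. -/
theorem polynomial_coeff {p : ℂ[X]} {n : ℕ} (h : HasExpansion (fun x => p.eval x) n c d) :
    p.natDegree ≤ n ∧ p.coeff n = c ∧ (X * p).coeff n = d := by
  have hd : p.natDegree ≤ n := by
    by_contra! hlt
    have h1 := polynomial p p.natDegree le_rfl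
    obtain ⟨i, hi⟩ := Nat.exists_eq_add_of_lt hlt
    have h2 : ∀ i : ℕ, ∃ e, HasExpansion (fun x => p.eval x) ((n + i + 1 : ℕ) : ℤ) 0 e := by
      intro i
      induction i with
      | zero => exact ⟨c, by simpa using h.raise⟩
      | succ i ih =>
        obtain ⟨e, he⟩ := ih
        exact ⟨0, by simpa [add_assoc] using he.raise⟩
    obtain ⟨e, he⟩ := h2 i
    rw [← hi] at he
    have h3 := (h1.unique he).1
    rw [coeff_natDegree, leadingCoeff_eq_zero] at h3
    simp [h3] at hlt
  obtain ⟨h1, h2⟩ := (polynomial p n hd).unique h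
  exact ⟨hd, h1, h2⟩

theorem polynomial_eq_C {p : ℂ[X]} (h : HasExpansion (fun x => p.eval x) 0 c d) : p = C c := by
  obtain ⟨h1, h2, -⟩ := polynomial_coeff (n := 0) h
  rw [eq_C_of_natDegree_le_zero h1, h2]

theorem polynomial_eq_linear {p : ℂ[X]} (h : HasExpansion (fun x => p.eval x) 1 c d) :
    p = C c * X + C d := by
  obtain ⟨h1, h2, h3⟩ := polynomial_coeff (n := 1) h
  rw [eq_X_add_C_of_natDegree_le_one h1, h2]
  congr 2
  simpa using h3

end HasExpansion

/-- A finite set is bounded, so the set of agreement must be infinite. -/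
theorem Polynomial.eq_of_frequently_cobounded {p q : ℂ[X]}
    (h : ∃ᶠ x in cobounded ℂ, p.eval x = q.eval x) : p = q := by
  refine Polynomial.eq_of_infinite_eval_eq p q fun hfin => h ?_
  exact hfin.isBounded

theorem Polynomial.eq_of_eventually_cobounded {p q : ℂ[X]}
    (h : ∀ᶠ x in cobounded ℂ, p.eval x = q.eval x) : p = q :=
  Polynomial.eq_of_frequently_cobounded h.frequently

/-! ### The Stieltjes function -/

/-- The sequence `μ` grows at most like `ρ^k`. -/
def GeomBounded (μ : ℕ → ℂ) (ρ : ℝ) : Prop := ∃ M : ℝ, ∀ k, ‖μ k‖ ≤ M * ρ ^ k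

namespace GeomBounded

variable {μ ν : ℕ → ℂ} {ρ : ℝ}

theorem add (h : GeomBounded μ ρ) (h' : GeomBounded ν ρ) :
    GeomBounded (fun k => μ k + ν k) ρ := by
  obtain ⟨M, hM⟩ := h
  obtain ⟨N, hN⟩ := h'
  exact ⟨M + N, fun k => by
    rw [add_mul]
    exact (norm_add_le _ _).trans (add_le_add (hM k) (hN k))⟩

theorem const_mul (a : ℂ) (h : GeomBounded μ ρ) : GeomBounded (fun k => a * μ k) ρ := by
  obtain ⟨M, hM⟩ := h
  exact ⟨‖a‖ * M, fun k => by
    rw [norm_mul, mul_assoc]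
    exact mul_le_mul_of_nonneg_left (hM k) (norm_nonneg _)⟩

theorem shift (h : GeomBounded μ ρ) (n : ℕ) : GeomBounded (fun k => μ (n + k)) ρ := by
  obtain ⟨M, hM⟩ := h
  exact ⟨M * ρ ^ n, fun k => by
    rw [mul_assoc, ← pow_add]
    exact hM _⟩

theorem norm_term_le {M : ℝ} (hM : ∀ k, ‖μ k‖ ≤ M * ρ ^ k) (x : ℂ) (k : ℕ) :
    ‖μ k / x ^ (k + 1)‖ ≤ M / ‖x‖ * (ρ / ‖x‖) ^ k := by
  rw [norm_div, norm_pow, div_pow, div_mul_div_comm, ← pow_succ']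
  exact div_le_div_of_nonneg_right (hM k) (by positivity)

theorem hasSum (hρ : 0 ≤ ρ) (h : GeomBounded μ ρ) {x : ℂ} (hx : ρ < ‖x‖) :
    HasSum (fun k => μ k / x ^ (k + 1)) (stieltjes μ x) := by
  obtain ⟨M, hM⟩ := h
  have hx0 : 0 < ‖x‖ := hρ.trans_lt hx
  exact (Summable.of_norm (Summable.of_nonneg_of_le (fun _ => norm_nonneg _)
    (norm_term_le hM x) ((summable_geometric_of_lt_one (by positivity)
      ((div_lt_one hx0).2 hx)).mul_left _))).hasSum

theorem tendsto_stieltjes (hρ : 0 ≤ ρ) (h : GeomBounded μ ρ) :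
    Tendsto (stieltjes μ) (cobounded ℂ) (𝓝 0) := by
  obtain ⟨M, hM⟩ := h
  have hlim : Tendsto (fun x : ℂ => M * (‖x‖ - ρ)⁻¹) (cobounded ℂ) (𝓝 0) := by
    have h1 : Tendsto (fun x : ℂ => ‖x‖ - ρ) (cobounded ℂ) atTop :=
      tendsto_atTop_add_const_right _ _ tendsto_norm_cobounded_atTop
    simpa using (tendsto_inv_atTop_zero.comp h1).const_mul M
  refine squeeze_zero_norm' ?_ hlim
  filter_upwards [tendsto_norm_cobounded_atTop.eventually_gt_atTop ρ] with x hx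
  have hx0 : 0 < ‖x‖ := hρ.trans_lt hx
  have hr : ρ / ‖x‖ < 1 := (div_lt_one hx0).2 hx
  have hs := (hasSum_geometric_of_lt_one (by positivity) hr).mul_left (M / ‖x‖)
  refine (tsum_of_norm_bounded hs (norm_term_le hM x)).trans_eq ?_
  have : ‖x‖ - ρ ≠ 0 := (sub_pos.2 hx).ne'
  rw [one_sub_div hx0.ne']
  field_simp

/-- Multiplication of the series by x^n shifts the moments and splits off a polynomial in the first
n of them. -/
theorem stieltjes_shift (hρ : 0 ≤ ρ) (h : GeomBounded μ ρ) (n : ℕ) {x : ℂ} (hx : ρ < ‖x‖) :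
    stieltjes (fun k => μ (n + k)) x =
      x ^ n * stieltjes μ x - ∑ i ∈ Finset.range n, μ i * x ^ (n - 1 - i) := by
  have hx0 : x ≠ 0 := norm_pos_iff.1 (hρ.trans_lt hx)
  have h1 := ((hasSum_nat_add_iff' n).2 (h.hasSum hρ hx)).mul_left (x ^ n)
  rw [mul_sub, Finset.mul_sum] at h1
  have h2 := (h.shift n).hasSum hρ hx
  have e : (fun k => μ (n + k) / x ^ (k + 1)) = fun k => x ^ n * (μ (k + n) / x ^ (k + n + 1)) := by
    funext k
    rw [add_comm n k]
    field_simp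
    ring
  rw [e] at h2
  rw [h2.unique h1]
  congr 1
  refine Finset.sum_congr rfl fun i hi => ?_
  have hi' := Finset.mem_range.1 hi
  have : x ^ n = x ^ (n - 1 - i) * x ^ (i + 1) := by
    rw [← pow_add]
    congr 1
    omega
  rw [this]
  field_simp

theorem hasExpansion (hρ : 0 ≤ ρ) (h : GeomBounded μ ρ) (n : ℕ) (h0 : ∀ k < n, μ k = 0) :
    HasExpansion (stieltjes μ) (-(n : ℤ) - 1) (μ n) (μ (n + 1)) := by
  have h1 := (tendsto_stieltjes hρ (h.shift (n + 2))).add_const (μ (n + 1))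
  rw [zero_add] at h1
  refine h1.congr' ?_
  filter_upwards [tendsto_norm_cobounded_atTop.eventually_gt_atTop ρ,
    Bornology.eventually_ne_cobounded (0 : ℂ)] with x hx hx0
  rw [h.stieltjes_shift hρ _ hx, Finset.sum_range_succ, Finset.sum_range_succ,
    Finset.sum_eq_zero fun i hi => by rw [h0 i (Finset.mem_range.1 hi), zero_mul]]
  have e1 : n + 2 - 1 - n = 1 := by omega
  have e2 : n + 2 - 1 - (n + 1) = 0 := by omega
  have e3 : (-(-(n : ℤ) - 1)) = ((n + 1 : ℕ) : ℤ) := by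
    push_cast
    ring
  rw [e1, e2, e3, zpow_natCast]
  ring

end GeomBounded

theorem stieltjes_scale (μ : ℕ → ℂ) {q : ℂ} (x : ℂ) :
    stieltjes μ (q * x) = stieltjes (fun k => μ k / q ^ (k + 1)) x := by
  refine tsum_congr fun k => ?_
  rw [mul_pow, div_div]

/-! ### Moment functionals -/

theorem momentFunctional_add (μ : ℕ → ℂ) (p r : ℂ[X]) :
    momentFunctional μ (p + r) = momentFunctional μ p + momentFunctional μ r :=
  sum_add_index p r _ (by simp) (by intros; ring)

theorem momentFunctional_monomial (μ : ℕ → ℂ) (n : ℕ) (a : ℂ) :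
    momentFunctional μ (monomial n a) = a * μ n :=
  sum_monomial_index a _ (by simp)

theorem momentFunctional_C_mul (μ : ℕ → ℂ) (a : ℂ) (p : ℂ[X]) :
    momentFunctional μ (C a * p) = a * momentFunctional μ p := by
  rw [← smul_eq_C_mul, momentFunctional, sum_smul_index _ _ _ (by simp), momentFunctional,
    Polynomial.sum, Polynomial.sum, Finset.mul_sum]
  exact Finset.sum_congr rfl fun i _ => by ring

theorem assocPoly_add (μ : ℕ → ℂ) (p r : ℂ[X]) :
    assocPoly μ (p + r) = assocPoly μ p + assocPoly μ r :=
  sum_add_index p r _ (by simp) (by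
    intros
    rw [← Finset.sum_add_distrib]
    exact Finset.sum_congr rfl fun i _ => by rw [add_mul, C_add, add_mul])

theorem assocPoly_C_mul (μ : ℕ → ℂ) (a : ℂ) (p : ℂ[X]) :
    assocPoly μ (C a * p) = C a * assocPoly μ p := by
  rw [← smul_eq_C_mul, assocPoly, sum_smul_index _ _ _ (by simp), assocPoly,
    Polynomial.sum, Polynomial.sum, Finset.mul_sum]
  refine Finset.sum_congr rfl fun i _ => ?_
  rw [Finset.mul_sum]
  exact Finset.sum_congr rfl fun j _ => by rw [← mul_assoc, ← C_mul, mul_assoc a]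

theorem assocPoly_monomial (μ : ℕ → ℂ) (n : ℕ) (a : ℂ) :
    assocPoly μ (monomial n a) = ∑ i ∈ Finset.range n, C (a * μ i) * X ^ (n - 1 - i) :=
  sum_monomial_index a _ (by simp)

/-- The remainder f p - φ has the coefficients L(p x^k), so orthogonality of p to low powers becomes
decay at infinity. Both sides are linear in p, and for a monomial this is `stieltjes_shift`. -/
theorem assocFun_eq_stieltjes {μ : ℕ → ℂ} {ρ : ℝ} (hρ : 0 ≤ ρ) (h : GeomBounded μ ρ) (p : ℂ[X]) :
    GeomBounded (fun k => momentFunctional μ (p * X ^ k)) ρ ∧ ∀ x : ℂ, ρ < ‖x‖ →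
      assocFun μ p x = stieltjes (fun k => momentFunctional μ (p * X ^ k)) x := by
  induction p using Polynomial.induction_on' with
  | add p r hp hr =>
    have e : (fun k => momentFunctional μ ((p + r) * X ^ k)) =
        fun k => momentFunctional μ (p * X ^ k) + momentFunctional μ (r * X ^ k) := by
      funext k
      rw [add_mul, momentFunctional_add]
    rw [e]
    refine ⟨hp.1.add hr.1, fun x hx => ?_⟩
    have h1 := (hp.1.hasSum hρ hx).add (hr.1.hasSum hρ hx)
    simp only [← add_div] at h1
    rw [stieltjes, h1.tsum_eq, ← hp.2 x hx, ← hr.2 x hx, assocFun, assocFun, assocFun,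
      assocPoly_add, eval_add, eval_add]
    ring
  | monomial n a =>
    have e : (fun k => momentFunctional μ (monomial n a * X ^ k)) = fun k => a * μ (n + k) := by
      funext k
      rw [monomial_mul_X_pow, momentFunctional_monomial]
    rw [e]
    refine ⟨(h.shift n).const_mul a, fun x hx => ?_⟩
    have h1 : stieltjes (fun k => a * μ (n + k)) x = a * stieltjes (fun k => μ (n + k)) x := by
      rw [stieltjes, stieltjes, ← tsum_mul_left]
      exact tsum_congr fun k => by ring
    rw [h1, h.stieltjes_shift hρ n hx, assocFun, assocPoly_monomial, eval_monomial,
      eval_finsetSum, mul_sub, Finset.mul_sum]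
    congr 1
    · ring
    · exact Finset.sum_congr rfl fun i _ => by simp [mul_assoc]

/-! ### Hankel determinants -/

/-- Replacing the last row by the combination leaves the determinant unchanged and only the last
entry of that row nonzero; then expand along it. -/
theorem Matrix.det_eq_of_row_combination {n : ℕ} (A : Matrix (Fin (n + 1)) (Fin (n + 1)) ℂ)
    (c : Fin (n + 1) → ℂ) (hc : c (Fin.last n) = 1)
    (h : ∀ j : Fin n, ∑ i, c i * A i j.castSucc = 0) :
    A.det = (∑ i, c i * A i (Fin.last n)) * (A.submatrix Fin.castSucc Fin.castSucc).det := by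
  have h1 := A.det_updateRow_sum (Fin.last n) c
  rw [hc, one_smul] at h1
  rw [← h1, Matrix.det_succ_row _ (Fin.last n), Fin.sum_univ_castSucc,
    Finset.sum_eq_zero fun j _ => by simp [Finset.sum_apply, h]]
  simp only [zero_add, Fin.val_last, ← two_mul, Fin.succAbove_last, pow_mul,
    neg_one_sq, one_pow, one_mul, Matrix.updateRow_self, Finset.sum_apply, Pi.smul_apply, smul_eq_mul]
  congr 2
  ext i j
  simp [Matrix.updateRow_apply, (Fin.castSucc_lt_last i).ne]

section Hankel

variable {μ : ℕ → ℂ} {p : ℂ[X]} {n : ℕ}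

theorem momentFunctional_mul_X_pow (hp : p.natDegree ≤ n) (k : ℕ) :
    momentFunctional μ (p * X ^ k) = ∑ i : Fin (n + 1), p.coeff i * μ (i + k) := by
  conv_lhs => rw [p.as_sum_range' (n + 1) (Nat.lt_succ_of_le hp)]
  rw [Finset.sum_mul]
  have : ∀ s : Finset ℕ, momentFunctional μ (∑ i ∈ s, monomial i (p.coeff i) * X ^ k) =
      ∑ i ∈ s, p.coeff i * μ (i + k) := by
    intro s
    induction s using Finset.induction_on with
    | empty => simp [momentFunctional]
    | insert a s ha ih =>
      rw [Finset.sum_insert ha, Finset.sum_insert ha, momentFunctional_add, ih,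
        monomial_mul_X_pow, momentFunctional_monomial]
  rw [this, Finset.sum_range]

/-- Combining the rows with the coefficients of p turns the last row into the numbers L(p x^j), all
but the last of which vanish by orthogonality. -/
theorem hankelDelta_succ (hp : p.natDegree ≤ n) (h1 : p.coeff n = 1)
    (h0 : ∀ k < n, momentFunctional μ (p * X ^ k) = 0) :
    hankelDelta μ (n + 1) = momentFunctional μ (p * X ^ n) * hankelDelta μ n := by
  rw [hankelDelta, Matrix.det_eq_of_row_combination _ (fun i => p.coeff i) (by simpa using h1),
    momentFunctional_mul_X_pow hp]
  · rfl
  · intro j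
    rw [← h0 j j.2, momentFunctional_mul_X_pow hp]
    rfl

theorem hankelSigma_succ (hp : p.natDegree ≤ n) (h1 : p.coeff n = 1)
    (h0 : ∀ k < n, momentFunctional μ (p * X ^ k) = 0) :
    hankelSigma μ (n + 1) = momentFunctional μ (p * X ^ (n + 1)) * hankelDelta μ n := by
  rw [hankelSigma, Matrix.det_eq_of_row_combination _ (fun i => p.coeff i) (by simpa using h1),
    momentFunctional_mul_X_pow hp, hankelDelta]
  · congr 1
    · simp
    · congr 1
      ext i j
      simp [j.2.ne]
  · intro j
    rw [← h0 j j.2, momentFunctional_mul_X_pow hp]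
    simp [j.2.ne]

/-- Orthogonality writes the column with entries μ_{i+n} as the combination of the columns of the
Hankel matrix with coefficients -p_j. Only the column it replaces contributes, with the factor
-p_{n-1}. -/
theorem hankelSigma_eq (hp : p.natDegree ≤ n) (h1 : p.coeff n = 1)
    (h0 : ∀ k < n, momentFunctional μ (p * X ^ k) = 0) :
    hankelSigma μ n = -(X * p).coeff n * hankelDelta μ n := by
  rcases n with _ | m
  · simp [hankelSigma]
  · rw [coeff_X_mul, hankelSigma, hankelDelta]
    have h2 := (Matrix.of fun i j : Fin (m + 1) => μ (i.val + j.val)).det_updateCol_sum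
      (Fin.last m) (fun i => -p.coeff i)
    rw [smul_eq_mul, Fin.val_last] at h2
    rw [← h2]
    congr 1
    ext i j
    rcases Fin.eq_castSucc_or_eq_last j with ⟨j, rfl⟩ | rfl
    · simp [j.2.ne, (Fin.castSucc_lt_last j).ne]
    · have h3 := h0 i i.2
      rw [momentFunctional_mul_X_pow hp, Fin.sum_univ_castSucc] at h3
      simp only [Fin.val_last, h1, one_mul, Fin.val_castSucc] at h3
      simp only [Matrix.of_apply, Fin.val_last, if_true, Matrix.updateCol_self, smul_eq_mul,
        neg_mul, Finset.sum_neg_distrib]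
      rw [add_comm (i : ℕ) (m + 1)]
      simp only [add_comm (i : ℕ)]
      linear_combination h3

end Hankel

/-! ### Orthonormal systems -/

namespace IsOrthonormalSystem

variable {μ : ℕ → ℂ} {p : ℕ → ℂ[X]} (hp : IsOrthonormalSystem μ p)
include hp

theorem natDegree_eq (n : ℕ) : (p n).natDegree = n := natDegree_eq_of_degree_eq_some (hp.1 n)

theorem leadingCoeff_ne_zero (n : ℕ) : (p n).leadingCoeff ≠ 0 := by
  refine Polynomial.leadingCoeff_ne_zero.2 fun h => ?_
  have := hp.1 n
  simp [h] at this

/-- Induction on the degree bound: a multiple of `p d` removes the top coefficient of r. -/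
theorem momentFunctional_mul_eq_zero (n : ℕ) {d : ℕ} (hd : d ≤ n) (r : ℂ[X]) (hr : r.degree < d) :
    momentFunctional μ (p n * r) = 0 := by
  induction d generalizing r with
  | zero =>
    have : r = 0 := by simpa using hr
    simp [this, momentFunctional]
  | succ d ih =>
    have hlc := hp.leadingCoeff_ne_zero d
    have hc : (p d).leadingCoeff = (p d).coeff d := by rw [leadingCoeff, hp.natDegree_eq]
    rw [hc] at hlc
    set c := r.coeff d / (p d).coeff d with hcdef
    have h1 : (r - C c * p d).degree < d := by
      rw [degree_lt_iff_coeff_zero]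
      intro m hm
      rw [coeff_sub, coeff_C_mul]
      rcases hm.eq_or_lt with rfl | hm
      · rw [hcdef, div_mul_cancel₀ _ hlc, sub_self]
      · rw [coeff_eq_zero_of_degree_lt (hr.trans_le (by exact_mod_cast hm)),
          coeff_eq_zero_of_natDegree_lt (by rwa [hp.natDegree_eq]), mul_zero, sub_zero]
    have h2 := ih (by omega) _ h1
    have h3 : p n * r = p n * (r - C c * p d) + C c * (p n * p d) := by ring
    rw [h3, momentFunctional_add, h2, momentFunctional_C_mul, hp.2, if_neg (by omega)]
    simp

theorem momentFunctional_mul_X_pow_eq_zero {n k : ℕ} (hk : k < n) :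
    momentFunctional μ (p n * X ^ k) = 0 :=
  hp.momentFunctional_mul_eq_zero n le_rfl _ (by
    rw [degree_X_pow]
    exact_mod_cast hk)

theorem momentFunctional_mul_X_pow_self (n : ℕ) :
    momentFunctional μ (p n * X ^ n) = 1 / (p n).leadingCoeff := by
  have hlc := hp.leadingCoeff_ne_zero n
  have h1 : momentFunctional μ (p n * (X ^ n - C (1 / (p n).leadingCoeff) * p n)) = 0 := by
    refine hp.momentFunctional_mul_eq_zero n le_rfl _ ?_
    rw [degree_lt_iff_coeff_zero]
    intro m hm
    rw [coeff_sub, coeff_C_mul, coeff_X_pow]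
    rcases hm.eq_or_lt with rfl | hm
    · have : (p n).coeff n = (p n).leadingCoeff := by rw [leadingCoeff, hp.natDegree_eq]
      rw [this, if_pos rfl, one_div, inv_mul_cancel₀ hlc, sub_self]
    · rw [if_neg hm.ne', coeff_eq_zero_of_natDegree_lt (by rwa [hp.natDegree_eq])]
      simp
  have h3 : p n * X ^ n = p n * (X ^ n - C (1 / (p n).leadingCoeff) * p n) +
      C (1 / (p n).leadingCoeff) * (p n * p n) := by ring
  rw [h3, momentFunctional_add, h1, momentFunctional_C_mul, hp.2, if_pos rfl]
  simp

end IsOrthonormalSystem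

/-! ### Frames: the two rows of the fundamental matrix -/

/-- A monic polynomial `p` of degree `n`, a polynomial `q`, and the polynomial parts `φ`, `ψ` of
`f p`, `f q`, such that `f p - φ = h x^{-n-1} + ⋯`, `q = O(x^{n-1})` and `f q - ψ = x^{-n} + ⋯`. -/
structure Frame (f : ℂ → ℂ) (n : ℕ) where
  p : ℂ[X]
  q : ℂ[X]
  φ : ℂ[X]
  ψ : ℂ[X]
  s : ℂ
  h : ℂ
  hr : ℂ
  p_expansion : HasExpansion (fun x => p.eval x) n 1 s
  φ_expansion : HasExpansion (fun x => f x * p.eval x - φ.eval x) (-n - 1) h hr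
  q_expansion : ∃ c d, HasExpansion (fun x => q.eval x) (n - 1) c d
  ψ_expansion : ∃ d, HasExpansion (fun x => f x * q.eval x - ψ.eval x) (-n) 1 d

/-- The polynomial equals p(fq - ψ) - q(fp - φ), where f cancels. The first product tends to 1 and
the second is of order x^(-2), so it is the constant 1. -/
theorem Frame.wronskian {f : ℂ → ℂ} {n : ℕ} (F : Frame f n) : F.q * F.φ - F.p * F.ψ = 1 := by
  obtain ⟨c, d, hq⟩ := F.q_expansion
  obtain ⟨d', hψ⟩ := F.ψ_expansion
  have h1 := F.p_expansion.mul hψ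
  have h2 := (hq.mul F.φ_expansion).raise_two
  rw [add_neg_cancel] at h1
  rw [show (n : ℤ) - 1 + (-n - 1) + 2 = 0 by ring] at h2
  have h3 : HasExpansion (fun x => (F.q * F.φ - F.p * F.ψ).eval x) 0 _ _ :=
    (h1.sub h2).congr' (Eventually.of_forall fun x => by
      simp only [eval_sub, eval_mul]
      ring)
  rw [h3.polynomial_eq_C]
  simp

/-- The polynomial `γ_{n-1} p_{n-1}`, zero for `n = 0`. -/
noncomputable def lowerPoly (p : ℕ → ℂ[X]) : ℕ → ℂ[X]
  | 0 => 0
  | m + 1 => C (p m).leadingCoeff * p m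

/-- The polynomial part of `γ_{n-1} f p_{n-1}`, by convention `-1` for `n = 0`. -/
noncomputable def lowerAssocPoly (μ : ℕ → ℂ) (p : ℕ → ℂ[X]) : ℕ → ℂ[X]
  | 0 => -1
  | m + 1 => C (p m).leadingCoeff * assocPoly μ (p m)

theorem IsOrthonormalSystem.monic_eval_expansion {μ : ℕ → ℂ} {p : ℕ → ℂ[X]}
    (hp : IsOrthonormalSystem μ p) (n : ℕ) :
    HasExpansion (fun x => (C (1 / (p n).leadingCoeff) * p n).eval x) n 1
      ((X * (C (1 / (p n).leadingCoeff) * p n)).coeff n) := by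
  have h := HasExpansion.polynomial (C (1 / (p n).leadingCoeff) * p n) n
    ((natDegree_C_mul_le _ _).trans_eq (hp.natDegree_eq n))
  have e : (C (1 / (p n).leadingCoeff) * p n).coeff n = 1 := by
    have : (p n).coeff n = (p n).leadingCoeff := by rw [leadingCoeff, hp.natDegree_eq]
    rw [coeff_C_mul, this, one_div, inv_mul_cancel₀ (hp.leadingCoeff_ne_zero n)]
  rwa [e] at h

theorem assocFun_expansion {μ : ℕ → ℂ} {ρ : ℝ} (hρ : 0 ≤ ρ) (hμ : GeomBounded μ ρ) (p : ℂ[X])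
    (n : ℕ) (h0 : ∀ k < n, momentFunctional μ (p * X ^ k) = 0) :
    HasExpansion (fun x => stieltjes μ x * p.eval x - (assocPoly μ p).eval x) (-n - 1)
      (momentFunctional μ (p * X ^ n)) (momentFunctional μ (p * X ^ (n + 1))) := by
  obtain ⟨h1, h2⟩ := assocFun_eq_stieltjes hρ hμ p
  refine (h1.hasExpansion hρ n h0).congr' ?_
  filter_upwards [tendsto_norm_cobounded_atTop.eventually_gt_atTop ρ] with x hx
  rw [← h2 x hx, assocFun]

/-- The frame of an orthonormal system. -/
noncomputable def IsOrthonormalSystem.frame {μ : ℕ → ℂ} {p : ℕ → ℂ[X]} {ρ : ℝ}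
    (hp : IsOrthonormalSystem μ p) (hρ : 0 ≤ ρ) (hμ : GeomBounded μ ρ) (n : ℕ) :
    Frame (stieltjes μ) n where
  p := C (1 / (p n).leadingCoeff) * p n
  q := lowerPoly p n
  φ := C (1 / (p n).leadingCoeff) * assocPoly μ (p n)
  ψ := lowerAssocPoly μ p n
  s := (X * (C (1 / (p n).leadingCoeff) * p n)).coeff n
  h := momentFunctional μ (C (1 / (p n).leadingCoeff) * p n * X ^ n)
  hr := momentFunctional μ (C (1 / (p n).leadingCoeff) * p n * X ^ (n + 1))
  p_expansion := hp.monic_eval_expansion n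
  φ_expansion := by
    rw [← assocPoly_C_mul]
    refine assocFun_expansion hρ hμ _ n fun k hk => ?_
    rw [mul_assoc, momentFunctional_C_mul, hp.momentFunctional_mul_X_pow_eq_zero hk, mul_zero]
  q_expansion := by
    rcases n with _ | m
    · refine ⟨0, 0, tendsto_const_nhds.congr fun x => ?_⟩
      simp [lowerPoly]
    · have h := HasExpansion.polynomial (C (p m).leadingCoeff * p m) m
        ((natDegree_C_mul_le _ _).trans_eq (hp.natDegree_eq m))
      exact ⟨_, _, by simpa [lowerPoly] using h⟩
  ψ_expansion := by
    -- For n = 0 the convention ψ = -1 makes f q - ψ identically 1.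
    rcases n with _ | m
    · refine ⟨0, tendsto_const_nhds.congr fun x => ?_⟩
      simp [lowerPoly, lowerAssocPoly]
    · have h := assocFun_expansion hρ hμ (C (p m).leadingCoeff * p m) m fun k hk => by
        rw [mul_assoc, momentFunctional_C_mul, hp.momentFunctional_mul_X_pow_eq_zero hk, mul_zero]
      rw [mul_assoc, momentFunctional_C_mul, hp.momentFunctional_mul_X_pow_self,
        mul_one_div_cancel (hp.leadingCoeff_ne_zero m), assocPoly_C_mul] at h
      refine ⟨momentFunctional μ (C (p m).leadingCoeff * p m * X ^ (m + 1)), ?_⟩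
      convert! h using 1
      push_cast
      ring

section

variable {μ : ℕ → ℂ} {p : ℕ → ℂ[X]} {ρ : ℝ} (hp : IsOrthonormalSystem μ p) (hρ : 0 ≤ ρ)
  (hμ : GeomBounded μ ρ) (n : ℕ)

theorem IsOrthonormalSystem.frame_hankel :
    hankelDelta μ (n + 1) = (hp.frame hρ hμ n).h * hankelDelta μ n ∧
    hankelSigma μ n = -(hp.frame hρ hμ n).s * hankelDelta μ n ∧
    hankelSigma μ (n + 1) = (hp.frame hρ hμ n).hr * hankelDelta μ n := by
  have h1 := (hp.monic_eval_expansion n).polynomial_coeff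
  have h0 : ∀ k < n, momentFunctional μ (C (1 / (p n).leadingCoeff) * p n * X ^ k) = 0 :=
    fun k hk => by
      rw [mul_assoc, momentFunctional_C_mul, hp.momentFunctional_mul_X_pow_eq_zero hk, mul_zero]
  exact ⟨hankelDelta_succ h1.1 h1.2.1 h0, hankelSigma_eq h1.1 h1.2.1 h0,
    hankelSigma_succ h1.1 h1.2.1 h0⟩

/-- The value is 1/γ_n²: one factor from making p monic, one from L(p_n x^n) = 1/γ_n. -/
theorem IsOrthonormalSystem.frame_h_ne_zero : (hp.frame hρ hμ n).h ≠ 0 := by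
  have h1 := hp.leadingCoeff_ne_zero n
  change momentFunctional μ (C (1 / (p n).leadingCoeff) * p n * X ^ n) ≠ 0
  rw [mul_assoc, momentFunctional_C_mul, hp.momentFunctional_mul_X_pow_self]
  exact mul_ne_zero (one_div_ne_zero h1) (one_div_ne_zero h1)

include hp hρ hμ in
theorem IsOrthonormalSystem.hankelDelta_ne_zero : hankelDelta μ n ≠ 0 := by
  induction n with
  | zero => simp [hankelDelta]
  | succ n ih =>
    rw [(hp.frame_hankel hρ hμ n).1]
    exact mul_ne_zero (hp.frame_h_ne_zero hρ hμ n) ih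

end

/-! ### Connection matrices between two frames -/

/-- An entry of the connection matrix: if `a(x) f'(lx) = b(x) f(x) + c(x)`, its value at `x` is
`a v (f' u - υ)(lx) - b u(lx) (f v - ω)`. -/
noncomputable def connEntry (l : ℂ) (a b c u υ v ω : ℂ[X]) : ℂ[X] :=
  b * u.comp (C l * X) * ω + c * u.comp (C l * X) * v - a * υ.comp (C l * X) * v

/-- In the difference on the right the terms containing f and f' combine to u v (a f' - b f) = c u
v. This cancellation is why the connection matrix is polynomial. -/
theorem connEntry_eval {f f' : ℂ → ℂ} {l x : ℂ} {a b c : ℂ[X]} (u υ v ω : ℂ[X])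
    (h : a.eval x * f' (l * x) = b.eval x * f x + c.eval x) :
    (connEntry l a b c u υ v ω).eval x =
      a.eval x * v.eval x * (f' (l * x) * u.eval (l * x) - υ.eval (l * x)) -
        b.eval x * u.eval (l * x) * (f x * v.eval x - ω.eval x) := by
  simp only [connEntry, eval_add, eval_sub, eval_mul, eval_comp, eval_C, eval_X]
  linear_combination -u.eval (l * x) * v.eval x * h

/-- The connection matrix `U'(lx) diag(b, a) U(x)⁻¹`, where `U = ((p, f p - φ), (q, f q - ψ))`. -/
noncomputable def connMatrix {f f' : ℂ → ℂ} {n : ℕ} (F' : Frame f' n) (F : Frame f n) (l : ℂ)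
    (a b c : ℂ[X]) : Matrix (Fin 2) (Fin 2) ℂ[X] :=
  !![-connEntry l a b c F'.p F'.φ F.q F.ψ, connEntry l a b c F'.p F'.φ F.p F.φ;
     -connEntry l a b c F'.q F'.ψ F.q F.ψ, connEntry l a b c F'.q F'.ψ F.p F.φ]

section

variable {f f' : ℂ → ℂ} {n : ℕ} (F' : Frame f' n) (F : Frame f n) (l : ℂ) (a b c : ℂ[X])

theorem Frame.wronskian_eval (x : ℂ) :
    F.q.eval x * F.φ.eval x - F.p.eval x * F.ψ.eval x = 1 := by
  have := congrArg (Polynomial.eval x) F.wronskian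
  simpa using this

/-- Both frames have determinant 1, so only det diag(b, a) remains. Expressed through the
polynomials alone, the identity holds at every x, also where the Stieltjes series diverges. -/
theorem connMatrix_det_eval (x : ℂ) :
    (connMatrix F' F l a b c 0 0).eval x * (connMatrix F' F l a b c 1 1).eval x -
      (connMatrix F' F l a b c 0 1).eval x * (connMatrix F' F l a b c 1 0).eval x =
      a.eval x * b.eval x := by
  have h1 := F'.wronskian_eval (l * x)
  have h2 := F.wronskian_eval x
  simp only [connMatrix, Matrix.of_apply, Matrix.cons_val', Matrix.cons_val_zero,
    Matrix.cons_val_one, connEntry, eval_add, eval_sub, eval_mul,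
    eval_comp, eval_C, eval_X, eval_neg]
  linear_combination (F.q.eval x * F.φ.eval x - F.p.eval x * F.ψ.eval x) * a.eval x * b.eval x * h1
    + a.eval x * b.eval x * h2

/-- At x = 0 the arguments lx and x coincide, so the matrix is formally conjugate to diag(b(0),
a(0)); c drops out of the trace. -/
theorem connMatrix_trace_eval_zero :
    (connMatrix F F l a b c 0 0).eval 0 + (connMatrix F F l a b c 1 1).eval 0 =
      a.eval 0 + b.eval 0 := by
  have h := F.wronskian_eval 0
  simp only [connMatrix, Matrix.of_apply, Matrix.cons_val', Matrix.cons_val_zero,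
    Matrix.cons_val_one, connEntry, eval_add, eval_sub, eval_mul,
    eval_comp, eval_C, eval_X, eval_neg, mul_zero]
  linear_combination (a.eval 0 + b.eval 0) * h

variable {F' F l a b c}

/-- The two summands of `connEntry_eval` are expanded separately, since their orders differ for the
diagonal entries and each caller must raise them to a common order itself. -/
theorem connEntry_expansion (hl : l ≠ 0)
    (h : ∀ᶠ x in cobounded ℂ, a.eval x * f' (l * x) = b.eval x * f x + c.eval x)
    {da db i j i' j' : ℤ} {α α' β β' γ γ' δ δ' ε ε' ζ ζ' : ℂ} {u υ v ω : ℂ[X]}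
    (ha : HasExpansion (fun x => a.eval x) da α α')
    (hb : HasExpansion (fun x => b.eval x) db β β')
    (hu : HasExpansion (fun x => u.eval x) i γ γ')
    (hυ : HasExpansion (fun x => f' x * u.eval x - υ.eval x) i' δ δ')
    (hv : HasExpansion (fun x => v.eval x) j ε ε')
    (hω : HasExpansion (fun x => f x * v.eval x - ω.eval x) j' ζ ζ') :
    ∃ g₁ g₂ : ℂ → ℂ,
      HasExpansion g₁ (da + j + i') (α * ε * (δ * l ^ i'))
        ((α' * ε + α * ε') * (δ * l ^ i') + α * ε * (δ' * l ^ (i' - 1))) ∧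
      HasExpansion g₂ (db + i + j') (β * (γ * l ^ i) * ζ)
        ((β' * (γ * l ^ i) + β * (γ' * l ^ (i - 1))) * ζ + β * (γ * l ^ i) * ζ') ∧
      (fun x => g₁ x - g₂ x) =ᶠ[cobounded ℂ] fun x => (connEntry l a b c u υ v ω).eval x :=
  ⟨_, _, (ha.mul hv).mul (hυ.scale hl), (hb.mul (hu.scale hl)).mul hω,
    h.mono fun _ hx => (connEntry_eval u υ v ω hx).symm⟩

end

/-- If `K₁ = U₂(lx) diag(b₁, a₁) U₁⁻¹`, `R = U₀ diag(b₂, a₂) U₁⁻¹`, then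
`K₁ adj R = U₂(lx) diag(b₁ a₂, a₁ b₂) U₀⁻¹`. -/
theorem connMatrix_mul_adjugate {f₀ f₁ f₂ : ℂ → ℂ} {n : ℕ} (F₂ : Frame f₂ n) (F₁ : Frame f₁ n)
    (F₀ : Frame f₀ n) {l : ℂ} {a₁ b₁ c₁ a₂ b₂ c₂ a₃ b₃ c₃ : ℂ[X]} {m : ℂ}
    (h₁ : ∀ᶠ x in cobounded ℂ, a₁.eval x * f₂ (l * x) = b₁.eval x * f₁ x + c₁.eval x)
    (h₂ : ∀ᶠ x in cobounded ℂ, a₂.eval x * f₀ (1 * x) = b₂.eval x * f₁ x + c₂.eval x)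
    (h₃ : ∀ᶠ x in cobounded ℂ, a₃.eval x * f₂ (l * x) = b₃.eval x * f₀ x + c₃.eval x)
    (ha : a₁ * b₂ = C m * a₃) (hb : b₁ * a₂ = C m * b₃) :
    connMatrix F₂ F₁ l a₁ b₁ c₁ * (connMatrix F₀ F₁ 1 a₂ b₂ c₂).adjugate =
      C m • connMatrix F₂ F₀ l a₃ b₃ c₃ := by
  have key : ∀ i j, (connMatrix F₂ F₁ l a₁ b₁ c₁ *
      (connMatrix F₀ F₁ 1 a₂ b₂ c₂).adjugate) i j =
      (C m • connMatrix F₂ F₀ l a₃ b₃ c₃) i j := by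
    intro i j
    refine Polynomial.eq_of_eventually_cobounded ?_
    filter_upwards [h₁, h₂, h₃] with x e₁ e₂ e₃
    have ea := congrArg (Polynomial.eval x) ha
    have eb := congrArg (Polynomial.eval x) hb
    have w := F₁.wronskian_eval x
    simp only [eval_mul, eval_C] at ea eb
    rw [Matrix.adjugate_fin_two]
    have k₁ := fun u υ v ω => connEntry_eval u υ v ω e₁
    have k₂ := fun u υ v ω => connEntry_eval u υ v ω e₂
    have k₃ := fun u υ v ω => connEntry_eval u υ v ω e₃
    simp only [one_mul] at k₂
    fin_cases i <;> fin_cases j <;>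
      simp only [connMatrix, Matrix.mul_apply, Fin.sum_univ_two, Matrix.smul_apply, smul_eq_mul,
        Matrix.of_apply, Matrix.cons_val', Matrix.cons_val_zero, Matrix.cons_val_one,
        Fin.zero_eta, Fin.mk_one, Fin.isValue, Matrix.cons_val_fin_one,
        eval_add, eval_mul, eval_neg, eval_C, k₁, k₂, k₃] <;>
      generalize f₂ (l * x) = y₂ <;> generalize f₁ x = y₁ <;> generalize f₀ x = y₀
    · linear_combination (b₁.eval x * a₂.eval x * F₂.p.eval (l * x) *
          (y₀ * F₀.q.eval x - F₀.ψ.eval x) - a₁.eval x * b₂.eval x *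
          (y₂ * F₂.p.eval (l * x) - F₂.φ.eval (l * x)) * F₀.q.eval x) * w -
        F₀.q.eval x * (y₂ * F₂.p.eval (l * x) - F₂.φ.eval (l * x)) * ea +
        F₂.p.eval (l * x) * (y₀ * F₀.q.eval x - F₀.ψ.eval x) * eb
    · linear_combination (a₁.eval x * b₂.eval x *
          (y₂ * F₂.p.eval (l * x) - F₂.φ.eval (l * x)) * F₀.p.eval x -
          b₁.eval x * a₂.eval x * F₂.p.eval (l * x) * (y₀ * F₀.p.eval x - F₀.φ.eval x)) * w +
        F₀.p.eval x * (y₂ * F₂.p.eval (l * x) - F₂.φ.eval (l * x)) * ea -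
        F₂.p.eval (l * x) * (y₀ * F₀.p.eval x - F₀.φ.eval x) * eb
    · linear_combination (b₁.eval x * a₂.eval x * F₂.q.eval (l * x) *
          (y₀ * F₀.q.eval x - F₀.ψ.eval x) - a₁.eval x * b₂.eval x *
          (y₂ * F₂.q.eval (l * x) - F₂.ψ.eval (l * x)) * F₀.q.eval x) * w -
        F₀.q.eval x * (y₂ * F₂.q.eval (l * x) - F₂.ψ.eval (l * x)) * ea +
        F₂.q.eval (l * x) * (y₀ * F₀.q.eval x - F₀.ψ.eval x) * eb
    · linear_combination (a₁.eval x * b₂.eval x *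
          (y₂ * F₂.q.eval (l * x) - F₂.ψ.eval (l * x)) * F₀.p.eval x -
          b₁.eval x * a₂.eval x * F₂.q.eval (l * x) * (y₀ * F₀.p.eval x - F₀.φ.eval x)) * w +
        F₀.p.eval x * (y₂ * F₂.q.eval (l * x) - F₂.ψ.eval (l * x)) * ea -
        F₂.q.eval (l * x) * (y₀ * F₀.p.eval x - F₀.φ.eval x) * eb
  ext1 i j
  exact key i j

/-- If `K₁ = U₂(lx) diag(b₁, a₁) U₁⁻¹`, `R = U₂ diag(b₂, a₂) U₀⁻¹`, then
`adj R(lx) K₁ = U₀(lx) diag(a₂(lx) b₁, b₂(lx) a₁) U₁⁻¹`. -/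
theorem adjugate_mul_connMatrix {f₀ f₁ f₂ : ℂ → ℂ} {n : ℕ} (F₂ : Frame f₂ n) (F₁ : Frame f₁ n)
    (F₀ : Frame f₀ n) {l : ℂ} (hl : l ≠ 0) {a₁ b₁ c₁ a₂ b₂ c₂ a₃ b₃ c₃ : ℂ[X]} {m : ℂ}
    (h₁ : ∀ᶠ x in cobounded ℂ, a₁.eval x * f₂ (l * x) = b₁.eval x * f₁ x + c₁.eval x)
    (h₂ : ∀ᶠ x in cobounded ℂ, a₂.eval x * f₂ (1 * x) = b₂.eval x * f₀ x + c₂.eval x)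
    (h₃ : ∀ᶠ x in cobounded ℂ, a₃.eval x * f₀ (l * x) = b₃.eval x * f₁ x + c₃.eval x)
    (ha : a₁ * b₂.comp (C l * X) = C m * a₃) (hb : b₁ * a₂.comp (C l * X) = C m * b₃) :
    ((connMatrix F₂ F₀ 1 a₂ b₂ c₂).adjugate.map fun r => r.comp (C l * X)) *
        connMatrix F₂ F₁ l a₁ b₁ c₁ =
      C m • connMatrix F₀ F₁ l a₃ b₃ c₃ := by
  have key : ∀ i j, (((connMatrix F₂ F₀ 1 a₂ b₂ c₂).adjugate.map fun r => r.comp (C l * X)) *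
        connMatrix F₂ F₁ l a₁ b₁ c₁) i j =
      (C m • connMatrix F₀ F₁ l a₃ b₃ c₃) i j := by
    intro i j
    refine Polynomial.eq_of_eventually_cobounded ?_
    filter_upwards [h₁, (tendsto_mul_left_cobounded hl).eventually h₂, h₃] with x e₁ e₂ e₃
    have ea := congrArg (Polynomial.eval x) ha
    have eb := congrArg (Polynomial.eval x) hb
    have w := F₂.wronskian_eval (l * x)
    simp only [eval_mul, eval_C, eval_comp, eval_X] at ea eb
    rw [Matrix.adjugate_fin_two]
    have k₁ := fun u υ v ω => connEntry_eval u υ v ω e₁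
    have k₂ := fun u υ v ω => connEntry_eval u υ v ω e₂
    have k₃ := fun u υ v ω => connEntry_eval u υ v ω e₃
    simp only [one_mul] at k₂
    fin_cases i <;> fin_cases j <;>
      simp only [connMatrix, Matrix.mul_apply, Fin.sum_univ_two, Matrix.smul_apply, smul_eq_mul,
        Matrix.of_apply, Matrix.cons_val', Matrix.cons_val_zero, Matrix.cons_val_one,
        Fin.zero_eta, Fin.mk_one, Fin.isValue, Matrix.cons_val_fin_one, Matrix.map_apply,
        eval_add, eval_mul, eval_neg, eval_C, eval_comp, eval_X, neg_comp, k₁, k₂, k₃] <;>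
      generalize f₂ (l * x) = y₂ <;> generalize f₁ x = y₁ <;> generalize f₀ (l * x) = y₀
    · linear_combination (b₁.eval x * a₂.eval (l * x) * F₀.p.eval (l * x) *
          (y₁ * F₁.q.eval x - F₁.ψ.eval x) - a₁.eval x * b₂.eval (l * x) *
          (y₀ * F₀.p.eval (l * x) - F₀.φ.eval (l * x)) * F₁.q.eval x) * w -
        F₁.q.eval x * (y₀ * F₀.p.eval (l * x) - F₀.φ.eval (l * x)) * ea +
        F₀.p.eval (l * x) * (y₁ * F₁.q.eval x - F₁.ψ.eval x) * eb
    · linear_combination (a₁.eval x * b₂.eval (l * x) *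
          (y₀ * F₀.p.eval (l * x) - F₀.φ.eval (l * x)) * F₁.p.eval x -
          b₁.eval x * a₂.eval (l * x) * F₀.p.eval (l * x) * (y₁ * F₁.p.eval x - F₁.φ.eval x)) * w +
        F₁.p.eval x * (y₀ * F₀.p.eval (l * x) - F₀.φ.eval (l * x)) * ea -
        F₀.p.eval (l * x) * (y₁ * F₁.p.eval x - F₁.φ.eval x) * eb
    · linear_combination (b₁.eval x * a₂.eval (l * x) * F₀.q.eval (l * x) *
          (y₁ * F₁.q.eval x - F₁.ψ.eval x) - a₁.eval x * b₂.eval (l * x) *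
          (y₀ * F₀.q.eval (l * x) - F₀.ψ.eval (l * x)) * F₁.q.eval x) * w -
        F₁.q.eval x * (y₀ * F₀.q.eval (l * x) - F₀.ψ.eval (l * x)) * ea +
        F₀.q.eval (l * x) * (y₁ * F₁.q.eval x - F₁.ψ.eval x) * eb
    · linear_combination (a₁.eval x * b₂.eval (l * x) *
          (y₀ * F₀.q.eval (l * x) - F₀.ψ.eval (l * x)) * F₁.p.eval x -
          b₁.eval x * a₂.eval (l * x) * F₀.q.eval (l * x) * (y₁ * F₁.p.eval x - F₁.φ.eval x)) * w +
        F₁.p.eval x * (y₀ * F₀.q.eval (l * x) - F₀.ψ.eval (l * x)) * ea -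
        F₀.q.eval (l * x) * (y₁ * F₁.p.eval x - F₁.φ.eval x) * eb
  ext1 i j
  exact key i j

/-! ### From recurrences of the moments to relations of the Stieltjes functions -/

theorem stieltjes_relation {μ ν : ℕ → ℂ} {ρ : ℝ} (hρ : 0 ≤ ρ) (hμ : GeomBounded μ ρ)
    (hν : GeomBounded ν ρ) {α₀ α₁ α₂ β₀ β₁ β₂ : ℂ}
    (h : ∀ k, α₂ * ν (k + 2) + α₁ * ν (k + 1) + α₀ * ν k =
      β₂ * μ (k + 2) + β₁ * μ (k + 1) + β₀ * μ k) :
    ∃ c : ℂ[X], ∀ x : ℂ, ρ < ‖x‖ → (α₂ * x ^ 2 + α₁ * x + α₀) * stieltjes ν x =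
      (β₂ * x ^ 2 + β₁ * x + β₀) * stieltjes μ x + c.eval x := by
  -- The polynomial collects the initial moments split off when the series are shifted by one and
  -- two places.
  refine ⟨C (α₂ * ν 0 - β₂ * μ 0) * X + C (α₂ * ν 1 + α₁ * ν 0 - β₂ * μ 1 - β₁ * μ 0),
    fun x hx => ?_⟩
  have key : ∀ {κ : ℕ → ℂ} (_ : GeomBounded κ ρ) (η₀ η₁ η₂ : ℂ),
      HasSum (fun k => (η₂ * κ (k + 2) + η₁ * κ (k + 1) + η₀ * κ k) / x ^ (k + 1))
        ((η₂ * x ^ 2 + η₁ * x + η₀) * stieltjes κ x -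
          (η₂ * κ 0 * x + (η₂ * κ 1 + η₁ * κ 0))) := by
    intro κ hκ η₀ η₁ η₂
    have h1 := (((((hκ.shift 2).hasSum hρ hx).mul_left η₂).add
      (((hκ.shift 1).hasSum hρ hx).mul_left η₁)).add ((hκ.hasSum hρ hx).mul_left η₀))
    rw [hκ.stieltjes_shift hρ 2 hx, hκ.stieltjes_shift hρ 1 hx] at h1
    convert! h1 using 1
    · funext k
      rw [add_comm 2 k, add_comm 1 k]
      ring
    · simp [Finset.sum_range_succ]
      ring
  have h1 := key hν α₀ α₁ α₂
  simp only [h] at h1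
  simp only [eval_add, eval_mul, eval_C, eval_X]
  linear_combination h1.unique (key hμ β₀ β₁ β₂)

theorem GeomBounded.mono {μ : ℕ → ℂ} {ρ ρ' : ℝ} (hρ : 0 ≤ ρ) (h : GeomBounded μ ρ)
    (hle : ρ ≤ ρ') : GeomBounded μ ρ' := by
  obtain ⟨M, hM⟩ := h
  have hM0 : 0 ≤ M := by simpa using (norm_nonneg _).trans (hM 0)
  exact ⟨M, fun k => (hM k).trans (by gcongr)⟩

theorem GeomBounded.scale {μ : ℕ → ℂ} {ρ : ℝ} (h : GeomBounded μ ρ) (q : ℂ) :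
    GeomBounded (fun k => μ k / q ^ (k + 1)) (ρ / ‖q‖) := by
  obtain ⟨M, hM⟩ := h
  refine ⟨M / ‖q‖, fun k => ?_⟩
  rw [norm_div, norm_pow, div_pow, div_mul_div_comm, ← pow_succ']
  exact div_le_div_of_nonneg_right (hM k) (by positivity)

/-! ### Relations of the Stieltjes function under the shifts of x and t -/

namespace LittleQJacobi

variable (P : LittleQJacobi)

/-- The polynomial `(x - a₁t)(x - a₃)` of the Pearson equation. -/
noncomputable def pearsonA (t : ℂ) : ℂ[X] := (X - C (P.a₁ * t)) * (X - C P.a₃)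

/-- The polynomial `b (x - a₂t)(x - a₄)` of the Pearson equation. -/
noncomputable def pearsonB (t : ℂ) : ℂ[X] :=
  C P.pearsonConst * ((X - C (P.a₂ * t)) * (X - C P.a₄))

/-- The constant `b' = b a₂ / a₁` of the mixed shift. -/
noncomputable def mixedConst : ℂ := P.pearsonConst * P.a₂ / P.a₁

variable {P} {e₀ e₁ : SupportEnd} {p p' : ℕ → ℂ[X]} {t : ℂ}

theorem pearsonConst_ne_zero : P.pearsonConst ≠ 0 :=
  div_ne_zero (mul_ne_zero (mul_ne_zero P.qσ_ne_zero P.a₁_ne_zero) P.a₃_ne_zero)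
    (mul_ne_zero P.a₂_ne_zero P.a₄_ne_zero)

namespace Admissible

variable (h : P.Admissible e₀ e₁ p t) (h' : P.Admissible e₀ e₁ p' (t / P.q))
include h

theorem geomBounded :
    GeomBounded (P.moment e₀ e₁ t) (max ‖P.endpoint t e₀‖ ‖P.endpoint t e₁‖) :=
  exists_norm_moment_le h.1 h.2.1 h.2.2.1

theorem moment_pearson (k : ℕ) :
    P.moment e₀ e₁ t (k + 2) / P.q ^ 2 -
        (P.a₁ * t + P.a₃) * (P.moment e₀ e₁ t (k + 1) / P.q) +
        P.a₁ * t * P.a₃ * P.moment e₀ e₁ t k =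
      P.q ^ (k + 1) * P.pearsonConst * (P.moment e₀ e₁ t (k + 2) -
        (P.a₂ * t + P.a₄) * P.moment e₀ e₁ t (k + 1) +
        P.a₂ * t * P.a₄ * P.moment e₀ e₁ t k) := by
  simp only [moment_eq]
  linear_combination endMoment_pearson h.1 h.2.2.1 k - endMoment_pearson h.1 h.2.1 k

/-- The function f(qx) has the moments μ_k/q^(k+1). Dividing the Pearson recurrence by q^(k+1)
therefore gives one with coefficients independent of k, to which `stieltjes_relation` applies. -/
theorem exists_stieltjes_pearson : ∃ c : ℂ[X], ∀ x : ℂ,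
    ‖P.endpoint t e₀‖ < ‖P.q * x‖ → ‖P.endpoint t e₁‖ < ‖P.q * x‖ →
      (P.pearsonA t).eval x * stieltjes (P.moment e₀ e₁ t) (P.q * x) =
        (P.pearsonB t).eval x * stieltjes (P.moment e₀ e₁ t) x + c.eval x := by
  have nq := P.q_ne_zero
  have nq' : 0 < ‖P.q‖ := norm_pos_iff.2 nq
  have hρ : 0 ≤ max ‖P.endpoint t e₀‖ ‖P.endpoint t e₁‖ := le_max_of_le_left (norm_nonneg _)
  have hle : max ‖P.endpoint t e₀‖ ‖P.endpoint t e₁‖ ≤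
      max ‖P.endpoint t e₀‖ ‖P.endpoint t e₁‖ / ‖P.q‖ :=
    le_div_self hρ nq' P.norm_q_lt_one.le
  have hrec : ∀ k, 1 * (P.moment e₀ e₁ t (k + 2) / P.q ^ (k + 2 + 1)) +
      -(P.a₁ * t + P.a₃) * (P.moment e₀ e₁ t (k + 1) / P.q ^ (k + 1 + 1)) +
      P.a₁ * t * P.a₃ * (P.moment e₀ e₁ t k / P.q ^ (k + 1)) =
      P.pearsonConst * P.moment e₀ e₁ t (k + 2) +
      -P.pearsonConst * (P.a₂ * t + P.a₄) * P.moment e₀ e₁ t (k + 1) +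
      P.pearsonConst * (P.a₂ * t * P.a₄) * P.moment e₀ e₁ t k := by
    intro k
    have h1 := h.moment_pearson k
    have e : P.moment e₀ e₁ t (k + 2) / P.q ^ (k + 2 + 1) =
        P.moment e₀ e₁ t (k + 2) / P.q ^ 2 / P.q ^ (k + 1) := by
      rw [div_div, ← pow_add]
      ring_nf
    have e' : P.moment e₀ e₁ t (k + 1) / P.q ^ (k + 1 + 1) =
        P.moment e₀ e₁ t (k + 1) / P.q / P.q ^ (k + 1) := by
      rw [div_div, ← pow_succ']
    have nk := pow_ne_zero (k + 1) nq
    rw [e, e']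
    generalize P.moment e₀ e₁ t (k + 2) / P.q ^ 2 = m₂ at *
    generalize P.moment e₀ e₁ t (k + 1) / P.q = m₁ at *
    generalize P.q ^ (k + 1) = Q at *
    field_simp
    linear_combination h1
  obtain ⟨c, hc⟩ := stieltjes_relation (by positivity) (h.geomBounded.mono hρ hle)
    (h.geomBounded.scale P.q) hrec
  refine ⟨c, fun x hx₀ hx₁ => ?_⟩
  have hx : max ‖P.endpoint t e₀‖ ‖P.endpoint t e₁‖ / ‖P.q‖ < ‖x‖ := by
    rw [div_lt_iff₀ nq', mul_comm, ← norm_mul]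
    exact max_lt hx₀ hx₁
  rw [stieltjes_scale]
  simp only [pearsonA, pearsonB, eval_mul, eval_sub, eval_X, eval_C]
  linear_combination hc x hx

/-- The polynomial `c` with `(x - a₁t)(x - a₃) f(qx) = b (x - a₂t)(x - a₄) f(x) + c(x)`. -/
noncomputable def pearsonC : ℂ[X] := h.exists_stieltjes_pearson.choose

theorem stieltjes_pearson {x : ℂ} (h₀ : ‖P.endpoint t e₀‖ < ‖P.q * x‖)
    (h₁ : ‖P.endpoint t e₁‖ < ‖P.q * x‖) :
      (P.pearsonA t).eval x * stieltjes (P.moment e₀ e₁ t) (P.q * x) =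
        (P.pearsonB t).eval x * stieltjes (P.moment e₀ e₁ t) x + h.pearsonC.eval x :=
  h.exists_stieltjes_pearson.choose_spec x h₀ h₁

theorem eventually_stieltjes_pearson : ∀ᶠ x in cobounded ℂ,
      (P.pearsonA t).eval x * stieltjes (P.moment e₀ e₁ t) (P.q * x) =
        (P.pearsonB t).eval x * stieltjes (P.moment e₀ e₁ t) x + h.pearsonC.eval x := by
  have hl := tendsto_norm_cobounded_atTop.comp (tendsto_mul_left_cobounded P.q_ne_zero)
  filter_upwards [hl.eventually_gt_atTop ‖P.endpoint t e₀‖,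
    hl.eventually_gt_atTop ‖P.endpoint t e₁‖] with x h₀ h₁
  exact h.stieltjes_pearson h₀ h₁

include h'

theorem exists_stieltjes_tshift : ∃ c : ℂ[X], ∀ᶠ x in cobounded ℂ,
    (C P.a₁ * (X - C (P.a₂ * t))).eval x * stieltjes (P.moment e₀ e₁ t) (1 * x) =
      (C P.a₂ * (X - C (P.a₁ * t))).eval x * stieltjes (P.moment e₀ e₁ (t / P.q)) x +
        c.eval x := by
  have hρ : 0 ≤ max ‖P.endpoint t e₀‖ ‖P.endpoint t e₁‖ := le_max_of_le_left (norm_nonneg _)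
  have hρ' : 0 ≤ max ‖P.endpoint (t / P.q) e₀‖ ‖P.endpoint (t / P.q) e₁‖ :=
    le_max_of_le_left (norm_nonneg _)
  have hrec : ∀ k, 0 * P.moment e₀ e₁ t (k + 2) + P.a₁ * P.moment e₀ e₁ t (k + 1) +
      -P.a₁ * (P.a₂ * t) * P.moment e₀ e₁ t k =
      0 * P.moment e₀ e₁ (t / P.q) (k + 2) + P.a₂ * P.moment e₀ e₁ (t / P.q) (k + 1) +
      -P.a₂ * (P.a₁ * t) * P.moment e₀ e₁ (t / P.q) k := by
    intro k
    simp only [moment_eq]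
    linear_combination endMoment_tshift h.1 h.2.2.1 h'.2.2.1 k -
      endMoment_tshift h.1 h.2.1 h'.2.1 k
  obtain ⟨c, hc⟩ := stieltjes_relation (le_max_of_le_left hρ)
    (h'.geomBounded.mono hρ' (le_max_right _ _)) (h.geomBounded.mono hρ (le_max_left _ _)) hrec
  refine ⟨c, ?_⟩
  filter_upwards [tendsto_norm_cobounded_atTop.eventually_gt_atTop _] with x hx
  simp only [eval_mul, eval_sub, eval_X, eval_C, one_mul]
  linear_combination hc x hx

theorem exists_stieltjes_qtshift : ∃ c : ℂ[X], ∀ᶠ x in cobounded ℂ,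
    (X - C P.a₃).eval x * stieltjes (P.moment e₀ e₁ t) (P.q * x) =
      (C P.mixedConst * (X - C P.a₄)).eval x * stieltjes (P.moment e₀ e₁ (t / P.q)) x +
        c.eval x := by
  have nq := P.q_ne_zero
  have hρ : 0 ≤ max ‖P.endpoint t e₀‖ ‖P.endpoint t e₁‖ / ‖P.q‖ :=
    div_nonneg (le_max_of_le_left (norm_nonneg _)) (norm_nonneg _)
  have hρ' : 0 ≤ max ‖P.endpoint (t / P.q) e₀‖ ‖P.endpoint (t / P.q) e₁‖ :=
    le_max_of_le_left (norm_nonneg _)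
  have hrec : ∀ k, 0 * (P.moment e₀ e₁ t (k + 2) / P.q ^ (k + 2 + 1)) +
      1 * (P.moment e₀ e₁ t (k + 1) / P.q ^ (k + 1 + 1)) +
      -P.a₃ * (P.moment e₀ e₁ t k / P.q ^ (k + 1)) =
      0 * P.moment e₀ e₁ (t / P.q) (k + 2) + P.mixedConst * P.moment e₀ e₁ (t / P.q) (k + 1) +
      -P.mixedConst * P.a₄ * P.moment e₀ e₁ (t / P.q) k := by
    intro k
    have h1 : P.moment e₀ e₁ t (k + 1) / P.q - P.a₃ * P.moment e₀ e₁ t k =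
        P.q ^ (k + 1) * P.mixedConst *
          (P.moment e₀ e₁ (t / P.q) (k + 1) - P.a₄ * P.moment e₀ e₁ (t / P.q) k) := by
      simp only [moment_eq, mixedConst]
      linear_combination endMoment_qtshift h.1 h.2.2.1 h'.2.2.1 k -
        endMoment_qtshift h.1 h.2.1 h'.2.1 k
    have e' : P.moment e₀ e₁ t (k + 1) / P.q ^ (k + 1 + 1) =
        P.moment e₀ e₁ t (k + 1) / P.q / P.q ^ (k + 1) := by
      rw [div_div, ← pow_succ']
    have nk := pow_ne_zero (k + 1) nq
    rw [e']
    simp only [zero_mul, zero_add]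
    generalize P.moment e₀ e₁ t (k + 1) / P.q = m₁ at *
    generalize P.q ^ (k + 1) = Q at *
    field_simp
    linear_combination h1
  obtain ⟨c, hc⟩ := stieltjes_relation (le_max_of_le_left hρ)
    (h'.geomBounded.mono hρ' (le_max_right _ _))
    ((h.geomBounded.scale P.q).mono hρ (le_max_left _ _)) hrec
  refine ⟨c, ?_⟩
  filter_upwards [tendsto_norm_cobounded_atTop.eventually_gt_atTop _] with x hx
  rw [stieltjes_scale]
  simp only [eval_mul, eval_sub, eval_X, eval_C]
  linear_combination hc x hx

end Admissible

/-! ### The coefficient matrix -/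

/-- The excluded points are the zeros of finitely many infinite products, a countable set; its dense
complement meets every neighbourhood of infinity. -/
theorem frequently_regular (hθ : qTheta P.q (P.gaugeConst t) ≠ 0)
    (e₀ e₁ : SupportEnd) : ∃ᶠ x in cobounded ℂ,
      ‖P.endpoint t e₀‖ < ‖P.q * x‖ ∧ ‖P.endpoint t e₁‖ < ‖P.q * x‖ ∧
        P.weight t x ≠ 0 ∧ qChar P.q (P.gaugeConst t) x ≠ 0 := by
  intro hev
  have hq := P.norm_q_lt_one
  have hq0 := P.q_ne_zero
  have hl := tendsto_norm_cobounded_atTop.comp (tendsto_mul_left_cobounded P.q_ne_zero)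
  have hev' := (hev.and (hl.eventually_gt_atTop ‖P.endpoint t e₀‖)).and
    (hl.eventually_gt_atTop ‖P.endpoint t e₁‖)
  obtain ⟨M, -, hM⟩ := hasBasis_cobounded_norm.eventually_iff.1 hev'
  have c1 : ∀ c : ℂ, {x : ℂ | qPochInf P.q (x / c) = 0}.Countable := fun c => by
    simpa [div_eq_inv_mul] using countable_qPochInf_eq_zero hq hq0 (c := c⁻¹)
  have c2 := countable_qTheta_eq_zero hq hq0 (c := 1)
  have c3 := countable_qTheta_eq_zero hq hq0 (c := P.gaugeConst t)
  have hd := Set.Countable.dense_compl ℝ (((((c1 (P.a₁ * t)).union (c1 P.a₃)).union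
    ((c1 (P.a₂ * t)).union (c1 P.a₄))).union c2).union c3)
  have hopen : IsOpen {x : ℂ | M < ‖x‖} := isOpen_lt continuous_const continuous_norm
  obtain ⟨y, hy⟩ := (NormedSpace.exists_lt_norm ℝ ℂ M)
  obtain ⟨x, hx, hxM⟩ := hd.exists_mem_open hopen ⟨y, hy⟩
  simp only [Set.mem_compl_iff, Set.mem_union, Set.mem_ofPred_eq, not_or, one_mul] at hx
  obtain ⟨⟨⟨⟨h1, h3⟩, h2, h4⟩, k1⟩, k2⟩ := hx
  obtain ⟨⟨hn, hx0⟩, hx1⟩ := hM (show M ≤ ‖x‖ from hxM.le)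
  exact hn ⟨hx0, hx1, div_ne_zero (mul_ne_zero (P.powσ_ne_zero x) (mul_ne_zero h1 h3))
    (mul_ne_zero h2 h4), div_ne_zero (mul_ne_zero k1 hθ) k2⟩

/-- The `q`-character contributes its constant a₁a₂a₃a₄tq^σ and the two products contribute (1 -
x/(a₂t))(1 - x/a₄). The gauge is chosen so that a multiple of B(x) results. -/
theorem gauge_qshift (ht : t ≠ 0) {x : ℂ} (hx : x ≠ 0)
    (h2 : qPochInf P.q (x / (P.a₂ * t)) ≠ 0) (h4 : qPochInf P.q (x / P.a₄) ≠ 0) :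
    P.gauge t (P.q * x) = P.a₂ * P.a₄ * (P.pearsonB t).eval x * P.gauge t x := by
  have hq := P.norm_q_lt_one
  have n1 := P.a₁_ne_zero
  have n2 := P.a₂_ne_zero
  have n3 := P.a₃_ne_zero
  have n4 := P.a₄_ne_zero
  have hc : P.gaugeConst t ≠ 0 :=
    mul_ne_zero (mul_ne_zero (mul_ne_zero (mul_ne_zero (mul_ne_zero n1 n2) n3) n4) ht)
      P.qσ_ne_zero
  rw [gauge, gauge, qChar_shift hq P.q_ne_zero hc hx, gaugeConst]
  rw [qPochInf_eq_mul hq] at h2 h4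
  rw [qPochInf_eq_mul hq (x / (P.a₂ * t)), qPochInf_eq_mul hq (x / P.a₄)]
  simp only [mul_div_assoc P.q]
  have m2 := left_ne_zero_of_mul h2
  have m4 := left_ne_zero_of_mul h4
  have r2 := right_ne_zero_of_mul h2
  have r4 := right_ne_zero_of_mul h4
  rw [one_sub_div (mul_ne_zero n2 ht)] at m2 ⊢
  rw [one_sub_div n4] at m4 ⊢
  have k2 : P.a₂ * t - x ≠ 0 := fun h => m2 (by rw [h, zero_div])
  have k4 : P.a₄ - x ≠ 0 := fun h => m4 (by rw [h, zero_div])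
  have k2' : t * P.a₂ - x ≠ 0 := by rwa [mul_comm]
  simp only [pearsonB, pearsonConst, eval_mul, eval_sub, eval_X, eval_C]
  generalize qChar P.q _ x = u
  generalize qPochInf P.q (P.q * (x / (P.a₂ * t))) = u2 at *
  generalize qPochInf P.q (P.q * (x / P.a₄)) = u4 at *
  clear h2 h4
  field_simp
  ring

namespace Admissible

variable (h : P.Admissible e₀ e₁ p t)

/-- The frame of the orthonormal system at `t`. -/
noncomputable def frame (n : ℕ) : Frame (stieltjes (P.moment e₀ e₁ t)) n :=
  h.2.2.2.2.2.2.frame (le_max_of_le_left (norm_nonneg _)) h.geomBounded n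

/-- The connection matrix of `x ↦ qx` before the gauge transformation. -/
noncomputable def shiftMatrix (n : ℕ) : Matrix (Fin 2) (Fin 2) ℂ[X] :=
  connMatrix (h.frame n) (h.frame n) P.q (P.pearsonA t) (P.pearsonB t) h.pearsonC

/-- The coefficient matrix `A_n^*`. -/
noncomputable def coeffMatrix (n : ℕ) : Matrix (Fin 2) (Fin 2) ℂ[X] :=
  !![C (P.a₂ * P.a₄) * h.shiftMatrix n 0 0,
      C (P.a₂ * P.a₄ * (P.κ₂ n * qChar P.q (P.q * P.a₁) t / qChar P.q (P.q * P.a₂) t)) *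
        h.shiftMatrix n 0 1;
     C (P.a₂ * P.a₄ * (qChar P.q (P.q * P.a₂) t / (P.κ₂ n * qChar P.q (P.q * P.a₁) t))) *
        h.shiftMatrix n 1 0,
      C (P.a₂ * P.a₄) * h.shiftMatrix n 1 1]

theorem Ystar_eq (n : ℕ) (x : ℂ) :
    P.Ystar (P.moment e₀ e₁ t) p n t x = P.gauge t x • Matrix.of
      ![(P.κ₂ n / qChar P.q (P.q * P.a₂) t) • ![(h.frame n).p.eval x,
          (stieltjes (P.moment e₀ e₁ t) x * (h.frame n).p.eval x - (h.frame n).φ.eval x) /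
            P.weight t x],
        (1 / qChar P.q (P.q * P.a₁) t) • ![(h.frame n).q.eval x,
          (stieltjes (P.moment e₀ e₁ t) x * (h.frame n).q.eval x - (h.frame n).ψ.eval x) /
            P.weight t x]] := by
  have hlc := h.2.2.2.2.2.2.leadingCoeff_ne_zero n
  have hrow : P.lowerRow (P.moment e₀ e₁ t) p t x n = ![(h.frame n).q.eval x,
      (stieltjes (P.moment e₀ e₁ t) x * (h.frame n).q.eval x - (h.frame n).ψ.eval x) /
        P.weight t x] := by
    rcases n with _ | m
    · simp [lowerRow, frame, IsOrthonormalSystem.frame, lowerPoly, lowerAssocPoly]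
    · simp only [lowerRow, frame, IsOrthonormalSystem.frame, lowerPoly, lowerAssocPoly, assocFun,
        eval_mul, eval_C]
      congr 2
      ring
  rw [Ystar, hrow]
  congr 2
  simp only [frame, IsOrthonormalSystem.frame, assocFun, eval_mul, eval_C, κ₂]
  congr 1
  ext i
  fin_cases i
  · simp
    field_simp
  · simp
    field_simp

/-- The gauge multiplies both columns by a₂a₄B, and 1/w(qx) = A/(B w(x)) changes B into A in the
second column. Thus diag(B, A) appears, as in `connMatrix`. -/
theorem isCoeffMatrix (n : ℕ) : P.IsCoeffMatrix e₀ e₁ p n t (h.coeffMatrix n) := by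
  intro x hx₀ hx₁ hw hg
  have hrel := h.stieltjes_pearson hx₀ hx₁
  have nq := P.q_ne_zero
  have hx : x ≠ 0 := by
    rintro rfl
    rw [mul_zero, norm_zero] at hx₀
    exact absurd hx₀ (norm_nonneg _).not_gt
  have hden : qPochInf P.q (x / (P.a₂ * t)) * qPochInf P.q (x / P.a₄) ≠ 0 := fun h0 =>
    hw (by rw [weight, h0, div_zero])
  have h2 := left_ne_zero_of_mul hden
  have h4 := right_ne_zero_of_mul hden
  have hgauge := gauge_qshift h.1 hx h2 h4
  have hpw := P.weight_qshift h.1 hx h2 h4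
  have hA : (P.pearsonA t).eval x = (x - P.a₁ * t) * (x - P.a₃) := by simp [pearsonA]
  have hB : (P.pearsonB t).eval x = P.pearsonConst * ((x - P.a₂ * t) * (x - P.a₄)) := by
    simp [pearsonB]
  rw [← hA, ← hB] at hpw
  have hwq : P.weight t (P.q * x) ≠ 0 := by
    have hnum : qPochInf P.q (x / (P.a₁ * t)) * qPochInf P.q (x / P.a₃) ≠ 0 := fun h0 =>
      hw (by rw [weight, h0, mul_zero, zero_div])
    have hs : ∀ c, qPochInf P.q (x / c) ≠ 0 → qPochInf P.q (P.q * x / c) ≠ 0 := by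
      intro c hc h0
      refine hc ?_
      rw [qPochInf_eq_mul P.norm_q_lt_one, ← mul_div_assoc, h0, mul_zero]
    exact div_ne_zero (mul_ne_zero (P.powσ_ne_zero _)
      (mul_ne_zero (hs _ (left_ne_zero_of_mul hnum)) (hs _ (right_ne_zero_of_mul hnum))))
      (mul_ne_zero (hs _ h2) (hs _ h4))
  have w := (h.frame n).wronskian_eval x
  have k := fun u υ v ω => connEntry_eval u υ v ω hrel
  have e1 := h.2.2.2.1
  have e2 := h.2.2.2.2.1
  have nκ : P.κ₂ n ≠ 0 := div_ne_zero (mul_ne_zero P.a₂_ne_zero P.a₄_ne_zero) (pow_ne_zero _ nq)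
  rw [h.Ystar_eq, h.Ystar_eq, hgauge]
  simp only [coeffMatrix, shiftMatrix, connMatrix, Matrix.of_apply, Matrix.cons_val',
    Matrix.cons_val_zero, Matrix.cons_val_one, Matrix.cons_val_fin_one]
  generalize stieltjes (P.moment e₀ e₁ t) x = y at *
  generalize stieltjes (P.moment e₀ e₁ t) (P.q * x) = y' at *
  generalize P.weight t x = ω at *
  generalize P.weight t (P.q * x) = ω' at *
  generalize P.gauge t x = g
  generalize qChar P.q (P.q * P.a₁) t = η₁ at *
  generalize qChar P.q (P.q * P.a₂) t = η₂ at *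
  generalize P.κ₂ n = κ at *
  generalize h.frame n = F at *
  clear hgauge hrel hA hB
  ext i j
  fin_cases i <;> fin_cases j <;>
    simp [Matrix.mul_apply, Fin.sum_univ_two, k] <;> field_simp
  · linear_combination (-(P.a₂ * P.a₄ * g * (P.pearsonB t).eval x * F.p.eval (P.q * x))) * w
  · linear_combination (-(P.a₂ * P.a₄ * g * (y' * F.p.eval (P.q * x) - F.φ.eval (P.q * x)))) *
      (hpw + (P.pearsonA t).eval x * ω' * w)
  · linear_combination (-(P.a₂ * P.a₄ * g * (P.pearsonB t).eval x * F.q.eval (P.q * x))) * w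
  · linear_combination (-(P.a₂ * P.a₄ * g * (y' * F.q.eval (P.q * x) - F.ψ.eval (P.q * x)))) *
      (hpw + (P.pearsonA t).eval x * ω' * w)

include h in
theorem det_Ystar_ne_zero (n : ℕ) {x : ℂ} (hw : P.weight t x ≠ 0)
    (hg : qChar P.q (P.gaugeConst t) x ≠ 0) :
    (P.Ystar (P.moment e₀ e₁ t) p n t x).det ≠ 0 := by
  have hden : qPochInf P.q (x / (P.a₂ * t)) * qPochInf P.q (x / P.a₄) ≠ 0 := fun h0 =>
    hw (by rw [weight, h0, div_zero])
  have hgauge : P.gauge t x ≠ 0 := div_ne_zero hg hden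
  have nκ : P.κ₂ n ≠ 0 :=
    div_ne_zero (mul_ne_zero P.a₂_ne_zero P.a₄_ne_zero) (pow_ne_zero _ P.q_ne_zero)
  have w := (h.frame n).wronskian_eval x
  have e : (P.Ystar (P.moment e₀ e₁ t) p n t x).det =
      P.gauge t x ^ 2 * (P.κ₂ n / qChar P.q (P.q * P.a₂) t) *
        (1 / qChar P.q (P.q * P.a₁) t) * (1 / P.weight t x) := by
    rw [h.Ystar_eq, Matrix.det_smul, Matrix.det_fin_two]
    simp
    linear_combination P.gauge t x ^ 2 * (P.κ₂ n / qChar P.q (P.q * P.a₂) t) *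
        (1 / qChar P.q (P.q * P.a₁) t) * (1 / P.weight t x) * w
  rw [e]
  exact mul_ne_zero (mul_ne_zero (mul_ne_zero (pow_ne_zero _ hgauge)
    (div_ne_zero nκ h.2.2.2.2.1)) (one_div_ne_zero h.2.2.2.1)) (one_div_ne_zero hw)

/-- `Ystar` is invertible at regular points, which exist arbitrarily far out, and polynomials
agreeing there are equal. -/
theorem isCoeffMatrix_iff (n : ℕ) (B : Matrix (Fin 2) (Fin 2) ℂ[X]) :
    P.IsCoeffMatrix e₀ e₁ p n t B ↔ B = h.coeffMatrix n := by
  refine ⟨fun hB => ?_, fun hB => hB ▸ h.isCoeffMatrix n⟩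
  have key : ∀ i j, B i j = h.coeffMatrix n i j := by
    intro i j
    refine Polynomial.eq_of_frequently_cobounded
      ((frequently_regular h.2.2.2.2.2.1 e₀ e₁).mono fun x hx => ?_)
    obtain ⟨h₀, h₁, hw, hg⟩ := hx
    have e := (hB x h₀ h₁ hw hg).symm.trans (h.isCoeffMatrix n x h₀ h₁ hw hg)
    have hu : IsUnit (P.Ystar (P.moment e₀ e₁ t) p n t x) :=
      (Matrix.isUnit_iff_isUnit_det _).2 (h.det_Ystar_ne_zero n hw hg).isUnit
    exact congrFun (congrFun (hu.mul_right_cancel e) i) j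
  ext1 i j
  exact key i j

/-- The diagonal gauge affects neither trace nor determinant, so the eigenvalues at 0 are a₂a₄B(0) =
θ₁t and a₂a₄A(0) = θ₂t. -/
theorem charpoly_coeffMatrix (n : ℕ) : ((h.coeffMatrix n).map (Polynomial.eval 0)).charpoly =
    (X - C (P.θ₁ * t)) * (X - C (P.θ₂ * t)) := by
  have htr := connMatrix_trace_eval_zero (h.frame n) P.q (P.pearsonA t) (P.pearsonB t) h.pearsonC
  have hdet := connMatrix_det_eval (h.frame n) (h.frame n) P.q (P.pearsonA t) (P.pearsonB t)
    h.pearsonC 0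
  change (h.shiftMatrix n 0 0).eval 0 + (h.shiftMatrix n 1 1).eval 0 = _ at htr
  change (h.shiftMatrix n 0 0).eval 0 * (h.shiftMatrix n 1 1).eval 0 -
    (h.shiftMatrix n 0 1).eval 0 * (h.shiftMatrix n 1 0).eval 0 = _ at hdet
  have e1 := h.2.2.2.1
  have e2 := h.2.2.2.2.1
  have n2 := P.a₂_ne_zero
  have n4 := P.a₄_ne_zero
  have nκ : P.κ₂ n ≠ 0 := div_ne_zero (mul_ne_zero n2 n4) (pow_ne_zero _ P.q_ne_zero)
  have hb : P.pearsonConst * (P.a₂ * P.a₄) = P.qσ * P.a₁ * P.a₃ := by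
    rw [pearsonConst]
    field_simp
  have htr' : ((h.coeffMatrix n).map (Polynomial.eval 0)).trace = P.θ₁ * t + P.θ₂ * t := by
    rw [Matrix.trace_fin_two]
    simp [coeffMatrix, pearsonA, pearsonB, θ₁, θ₂] at htr ⊢
    linear_combination P.a₂ * P.a₄ * htr + t * P.a₂ * P.a₄ * hb
  have hdet' : ((h.coeffMatrix n).map (Polynomial.eval 0)).det = P.θ₁ * t * (P.θ₂ * t) := by
    rw [Matrix.det_fin_two]
    simp [coeffMatrix, pearsonA, pearsonB, θ₁, θ₂] at hdet ⊢
    generalize qChar P.q (P.q * P.a₁) t = η₁ at *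
    generalize qChar P.q (P.q * P.a₂) t = η₂ at *
    generalize P.κ₂ n = κ at *
    have e : P.a₂ * P.a₄ * (κ * η₁ / η₂) * eval 0 (h.shiftMatrix n 0 1) *
        (P.a₂ * P.a₄ * (η₂ / (κ * η₁)) * eval 0 (h.shiftMatrix n 1 0)) =
        (P.a₂ * P.a₄) ^ 2 * (eval 0 (h.shiftMatrix n 0 1) * eval 0 (h.shiftMatrix n 1 0)) := by
      field_simp
    rw [e]
    linear_combination (P.a₂ * P.a₄) ^ 2 * hdet + P.a₁ * P.a₂ ^ 2 * P.a₃ * P.a₄ ^ 2 * t ^ 2 * hb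
  rw [Matrix.charpoly_fin_two, htr', hdet']
  simp only [C_add, C_mul]
  ring

end Admissible

end LittleQJacobi

/-! ### Degrees and leading coefficients of the coefficient matrix -/

theorem HasExpansion.X_sub_C (c : ℂ) :
    HasExpansion (fun x => (X - C c : ℂ[X]).eval x) 1 1 (-c) := by
  have h := HasExpansion.polynomial (X - C c) 1 (natDegree_X_sub_C_le c)
  simpa [coeff_X_zero] using h

theorem Polynomial.exists_eq_of_natDegree_le_two {r : ℂ[X]} (hr : r.natDegree ≤ 2)
    (h2 : r.coeff 2 ≠ 0) (y : ℂ) : ∃ α : ℂ,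
      r = C (r.coeff 2) * ((X - C y) * (X - C α) + C (r.eval y / r.coeff 2)) := by
  have e : ∀ x, r.eval x = r.coeff 0 + r.coeff 1 * x + r.coeff 2 * x ^ 2 := fun x => by
    rw [eval_eq_sum_range' (Nat.lt_succ_of_le hr)]
    simp [Finset.sum_range_succ]
  refine ⟨-r.coeff 1 / r.coeff 2 - y, Polynomial.funext fun x => ?_⟩
  simp only [eval_mul, eval_add, eval_sub, eval_C, eval_X, e]
  field_simp
  ring

namespace LittleQJacobi

variable {P : LittleQJacobi} {e₀ e₁ : SupportEnd} {p p' : ℕ → ℂ[X]} {t t' : ℂ}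

theorem κ₁_eq (P : LittleQJacobi) (n : ℕ) :
    P.κ₁ n = P.a₂ * P.a₄ * (P.pearsonConst * P.q ^ n) := by
  have n2 := P.a₂_ne_zero
  have n4 := P.a₄_ne_zero
  rw [κ₁, pearsonConst]
  field_simp

theorem κ₁_ne_zero (P : LittleQJacobi) (n : ℕ) : P.κ₁ n ≠ 0 :=
  mul_ne_zero (mul_ne_zero (mul_ne_zero (pow_ne_zero _ P.q_ne_zero) P.qσ_ne_zero) P.a₁_ne_zero)
    P.a₃_ne_zero

theorem κ₂_ne_zero (P : LittleQJacobi) (n : ℕ) : P.κ₂ n ≠ 0 :=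
  div_ne_zero (mul_ne_zero P.a₂_ne_zero P.a₄_ne_zero) (pow_ne_zero _ P.q_ne_zero)

theorem pearsonA_expansion :
    HasExpansion (fun x => (P.pearsonA t).eval x) 2 1 (-(P.a₁ * t + P.a₃)) := by
  have h := (HasExpansion.X_sub_C (P.a₁ * t)).mul (HasExpansion.X_sub_C P.a₃)
  convert! h using 1
  · funext x
    simp [pearsonA]
  · ring
  · ring

theorem pearsonB_expansion :
    HasExpansion (fun x => (P.pearsonB t).eval x) 2 P.pearsonConst
      (-P.pearsonConst * (P.a₂ * t + P.a₄)) := by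
  have h := ((HasExpansion.X_sub_C (P.a₂ * t)).mul (HasExpansion.X_sub_C P.a₄)).const_mul
    P.pearsonConst
  convert! h using 1
  · funext x
    simp [pearsonB]
  · ring
  · ring

namespace Admissible

variable (h : P.Admissible e₀ e₁ p t) (h' : P.Admissible e₀ e₁ p' t')

theorem coeffMatrix_zero_zero (n : ℕ) :
    h.coeffMatrix n 0 0 = C (P.a₂ * P.a₄) * h.shiftMatrix n 0 0 := rfl

theorem coeffMatrix_one_one (n : ℕ) :
    h.coeffMatrix n 1 1 = C (P.a₂ * P.a₄) * h.shiftMatrix n 1 1 := rfl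

/-- The summand with A has order 0 only; the one with B has order 2 and supplies the leading
coefficient. In `shiftMatrix_one_one` it is the other way round. -/
theorem shiftMatrix_zero_zero (n : ℕ) :
    (h.shiftMatrix n 0 0).natDegree ≤ 2 ∧
      (h.shiftMatrix n 0 0).coeff 2 = P.pearsonConst * P.q ^ n := by
  obtain ⟨_, _, hq⟩ := (h.frame n).q_expansion
  obtain ⟨_, hψ⟩ := (h.frame n).ψ_expansion
  obtain ⟨g₁, g₂, h₁, h₂, he⟩ := connEntry_expansion P.q_ne_zero h.eventually_stieltjes_pearson
    pearsonA_expansion pearsonB_expansion (h.frame n).p_expansion (h.frame n).φ_expansion hq hψ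
  have h₁' := h₁.raise_two
  rw [show (2 : ℤ) + (n - 1) + (-n - 1) + 2 = 2 by ring] at h₁'
  rw [show (2 : ℤ) + n + -n = 2 by ring] at h₂
  have h₃ := (((h₁'.sub h₂).congr' he).polynomial_coeff (n := 2))
  have e : h.shiftMatrix n 0 0 = -connEntry P.q (P.pearsonA t) (P.pearsonB t) h.pearsonC
    (h.frame n).p (h.frame n).φ (h.frame n).q (h.frame n).ψ := rfl
  rw [e, natDegree_neg, coeff_neg, h₃.2.1]
  refine ⟨h₃.1, ?_⟩
  rw [zpow_natCast]
  ring

theorem shiftMatrix_one_one (n : ℕ) :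
    (h.shiftMatrix n 1 1).natDegree ≤ 2 ∧
      (h.shiftMatrix n 1 1).coeff 2 = 1 / P.q ^ n := by
  obtain ⟨_, _, hq⟩ := (h.frame n).q_expansion
  obtain ⟨_, hψ⟩ := (h.frame n).ψ_expansion
  obtain ⟨g₁, g₂, h₁, h₂, he⟩ := connEntry_expansion P.q_ne_zero h.eventually_stieltjes_pearson
    pearsonA_expansion pearsonB_expansion hq hψ (h.frame n).p_expansion (h.frame n).φ_expansion
  have h₂' := h₂.raise_two
  rw [show (2 : ℤ) + (n - 1) + (-n - 1) + 2 = 2 by ring] at h₂'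
  rw [show (2 : ℤ) + n + -n = 2 by ring] at h₁
  have h₃ := (((h₁.sub h₂').congr' he).polynomial_coeff (n := 2))
  refine ⟨h₃.1, h₃.2.1.trans ?_⟩
  rw [zpow_neg, zpow_natCast]
  ring

theorem shiftMatrix_one_zero (n : ℕ) : (h.shiftMatrix n 1 0).natDegree ≤ 1 := by
  obtain ⟨_, _, hq⟩ := (h.frame n).q_expansion
  obtain ⟨_, hψ⟩ := (h.frame n).ψ_expansion
  obtain ⟨g₁, g₂, h₁, h₂, he⟩ := connEntry_expansion P.q_ne_zero h.eventually_stieltjes_pearson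
    pearsonA_expansion pearsonB_expansion hq hψ hq hψ
  rw [show (2 : ℤ) + (n - 1) + -n = 1 by ring] at h₁ h₂
  have h₃ := (((h₁.sub h₂).congr' he).polynomial_coeff (n := 1))
  have e : h.shiftMatrix n 1 0 = -connEntry P.q (P.pearsonA t) (P.pearsonB t) h.pearsonC
    (h.frame n).q (h.frame n).ψ (h.frame n).q (h.frame n).ψ := rfl
  rw [e, natDegree_neg]
  exact h₃.1

/-- Both summands have order 1, so the constant term involves the second coefficients `s` and `hr`.
This entry is why expansions are carried to two terms. -/
theorem shiftMatrix_zero_one (n : ℕ) : h.shiftMatrix n 0 1 =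
    C ((h.frame n).h * (1 / P.q ^ (n + 1) - P.pearsonConst * P.q ^ n)) * X +
      C (-(P.a₁ * t + P.a₃) * (h.frame n).h / P.q ^ (n + 1) + (h.frame n).s * (h.frame n).h /
        P.q ^ (n + 1) + (h.frame n).hr / P.q ^ (n + 2) -
        P.pearsonConst * (-(P.a₂ * t + P.a₄) * P.q ^ n * (h.frame n).h +
          (h.frame n).s * P.q ^ n / P.q * (h.frame n).h + P.q ^ n * (h.frame n).hr)) := by
  have nq := P.q_ne_zero
  obtain ⟨g₁, g₂, h₁, h₂, he⟩ := connEntry_expansion nq h.eventually_stieltjes_pearson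
    pearsonA_expansion pearsonB_expansion (h.frame n).p_expansion (h.frame n).φ_expansion
    (h.frame n).p_expansion (h.frame n).φ_expansion
  rw [show (2 : ℤ) + n + (-n - 1) = 1 by ring] at h₁ h₂
  have h₃ := ((h₁.sub h₂).congr' he).polynomial_eq_linear
  refine Eq.trans h₃ ?_
  have z1 : P.q ^ (-(n : ℤ) - 1) = 1 / P.q ^ (n + 1) := by
    rw [← neg_add', zpow_neg, one_div]
    norm_cast
  have z2 : P.q ^ (-(n : ℤ) - 1 - 1) = 1 / P.q ^ (n + 2) := by
    rw [show -(n : ℤ) - 1 - 1 = -((n + 2 : ℕ) : ℤ) by push_cast; ring, zpow_neg, one_div,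
      zpow_natCast]
  have z3 : P.q ^ ((n : ℤ) - 1) = P.q ^ n / P.q := by
    rw [zpow_sub_one₀ nq, zpow_natCast, div_eq_mul_inv]
  rw [z1, z2, z3, zpow_natCast]
  congr 2
  · congr 1
    ring
  · ring

/-- In terms of the frame, Δ_{n+1}/Δ_n = h, Σ_n/Δ_n = -s and Σ_{n+1}/Δ_{n+1} = hr/h. -/
theorem coeffMatrix_zero_one (n : ℕ) (hne : P.q * P.κ₁ n ≠ P.κ₂ n) :
    hankelDelta (P.moment e₀ e₁ t) n ≠ 0 ∧ hankelDelta (P.moment e₀ e₁ t) (n + 1) ≠ 0 ∧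
      h.coeffMatrix n 0 1 =
        C (P.κ₂ n * P.wDet e₀ e₁ n t) * (X - C (P.yDet e₀ e₁ n t)) := by
  have hρ : 0 ≤ max ‖P.endpoint t e₀‖ ‖P.endpoint t e₁‖ := le_max_of_le_left (norm_nonneg _)
  have hp := h.2.2.2.2.2.2
  have d0 := hp.hankelDelta_ne_zero hρ h.geomBounded n
  have d1 := hp.hankelDelta_ne_zero hρ h.geomBounded (n + 1)
  refine ⟨d0, d1, ?_⟩
  obtain ⟨f1, f2, f3⟩ := hp.frame_hankel hρ h.geomBounded n
  have hh := hp.frame_h_ne_zero hρ h.geomBounded n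
  change _ = (h.frame n).h * _ at f1
  change _ = -(h.frame n).s * _ at f2
  change _ = (h.frame n).hr * _ at f3
  change (h.frame n).h ≠ 0 at hh
  have n2 := P.a₂_ne_zero
  have n4 := P.a₄_ne_zero
  have nq := P.q_ne_zero
  have nQ := pow_ne_zero n nq
  have e1 := h.2.2.2.1
  have e2 := h.2.2.2.2.1
  have hne' : P.q * P.κ₁ n - P.κ₂ n ≠ 0 := sub_ne_zero.2 hne
  have hy : P.yDet e₀ e₁ n t = (P.q * P.κ₁ n * (P.a₂ * t + P.a₄) - P.κ₂ n * (P.a₁ * t + P.a₃)) /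
      (P.q * P.κ₁ n - P.κ₂ n) - (P.κ₁ n - P.κ₂ n) / (P.q * P.κ₁ n - P.κ₂ n) * (h.frame n).s -
      (P.q * P.κ₁ n - P.κ₂ n / P.q) / (P.q * P.κ₁ n - P.κ₂ n) *
        ((h.frame n).hr / (h.frame n).h) := by
    rw [yDet, f1, f2, f3, mul_div_cancel_right₀ _ d0, mul_div_mul_right _ _ d0]
    ring
  have hw : P.wDet e₀ e₁ n t = qChar P.q (P.q * P.a₁) t * (P.κ₂ n - P.q * P.κ₁ n) *
      (h.frame n).h / (P.q * qChar P.q (P.q * P.a₂) t) := by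
    rw [wDet, f1, ← mul_assoc, mul_div_mul_right _ _ d0]
  have e : h.coeffMatrix n 0 1 = C (P.a₂ * P.a₄ *
    (P.κ₂ n * qChar P.q (P.q * P.a₁) t / qChar P.q (P.q * P.a₂) t)) * h.shiftMatrix n 0 1 := rfl
  rw [e, h.shiftMatrix_zero_one, hw, hy]
  have k1 := P.κ₁_eq n
  have k2 : P.κ₂ n = P.a₂ * P.a₄ / P.q ^ n := rfl
  refine Polynomial.funext fun x => ?_
  simp only [eval_mul, eval_add, eval_sub, eval_C, eval_X]
  rw [k1, k2] at hne' ⊢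
  rw [pow_succ _ (n + 1), pow_succ]
  generalize P.q ^ n = Q at *
  generalize P.pearsonConst = b at *
  have hne2 : P.q * (P.a₂ * P.a₄ * (b * Q)) - P.a₂ * P.a₄ / Q =
      P.a₂ * P.a₄ / Q * (P.q * b * Q ^ 2 - 1) := by
    field_simp
  rw [hne2] at hne' ⊢
  have hne3 := right_ne_zero_of_mul hne'
  clear hne2 hne'
  -- The hypothesis qκ₁ ≠ κ₂ has become D ≠ 0; solving for b in terms of D makes every denominator a
  -- product of known nonzero factors.
  generalize hD : P.q * b * Q ^ 2 - 1 = D at *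
  have hb : b = (D + 1) / (P.q * Q ^ 2) := by
    field_simp
    linear_combination hD
  rw [hb]
  field_simp
  ring

end Admissible

/-! ### Natural variables -/

namespace Admissible

variable (h : P.Admissible e₀ e₁ p t) (h' : P.Admissible e₀ e₁ p' t')
include h

theorem wDet_ne_zero (n : ℕ) (hne : P.q * P.κ₁ n ≠ P.κ₂ n) : P.wDet e₀ e₁ n t ≠ 0 := by
  obtain ⟨d0, d1, -⟩ := h.coeffMatrix_zero_one n hne
  exact div_ne_zero (mul_ne_zero (mul_ne_zero h.2.2.2.1 (sub_ne_zero.2 hne.symm)) d1)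
    (mul_ne_zero (mul_ne_zero P.q_ne_zero h.2.2.2.2.1) d0)

/-- The known degrees and leading coefficients always allow α, β, γ, δ to be solved for. What
remains is the upper right entry and the diagonal values κ₁z₁ and κ₂z₂ at y. -/
theorem isNatural_iff (n : ℕ) (hne : P.q * P.κ₁ n ≠ P.κ₂ n) (w y z : ℂ) :
    P.IsNatural n t (h.coeffMatrix n) w y z ↔
      w = P.wDet e₀ e₁ n t ∧ y = P.yDet e₀ e₁ n t ∧
      (h.coeffMatrix n 0 0).eval y * (P.q * z) = (y - P.a₁ * t) * (y - P.a₂ * t) ∧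
      (h.coeffMatrix n 1 1).eval y =
        P.κ₂ n * (P.q * P.κ₁ n * z * ((y - P.a₃) * (y - P.a₄))) := by
  obtain ⟨d0, d1, h01⟩ := h.coeffMatrix_zero_one n hne
  have k1 := P.κ₁_ne_zero n
  have k2 := P.κ₂_ne_zero n
  constructor
  · rintro ⟨hw, z₁, z₂, α, β, γ, δ, hA, hz₁, hz₂⟩
    have e00 := congrFun (congrFun hA 0) 0
    have e01 := congrFun (congrFun hA 0) 1
    have e11 := congrFun (congrFun hA 1) 1
    simp only [Matrix.of_apply, Matrix.cons_val', Matrix.cons_val_zero, Matrix.cons_val_one,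
      Matrix.cons_val_fin_one] at e00 e01 e11
    rw [h01] at e01
    -- The difference of the values at 1 and 0 is the slope of the linear entry.
    have c1 := congrArg (fun r => Polynomial.eval 1 r - Polynomial.eval 0 r) e01
    simp only [eval_mul, eval_sub, eval_C, eval_X] at c1
    have hw' : w = P.wDet e₀ e₁ n t := mul_left_cancel₀ k2 (by linear_combination -c1)
    have c0 := congrArg (Polynomial.eval 0) e01
    simp only [eval_mul, eval_sub, eval_C, eval_X] at c0
    rw [← hw'] at c0
    refine ⟨hw', mul_left_cancel₀ (mul_ne_zero k2 hw) (by linear_combination c0), ?_, ?_⟩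
    · rw [e00]
      simp only [eval_mul, eval_add, eval_sub, eval_C, eval_X]
      linear_combination hz₁
    · rw [e11, hz₂]
      simp only [eval_mul, eval_add, eval_sub, eval_C, eval_X]
      ring
  · rintro ⟨rfl, rfl, e00, e11⟩
    have hw := h.wDet_ne_zero n hne
    refine ⟨hw, ?_⟩
    generalize P.yDet e₀ e₁ n t = y at *
    generalize P.wDet e₀ e₁ n t = w at *
    obtain ⟨m00, c00⟩ := h.shiftMatrix_zero_zero n
    obtain ⟨m11, c11⟩ := h.shiftMatrix_one_one n
    have m10 := h.shiftMatrix_one_zero n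
    have c00' : (h.coeffMatrix n 0 0).coeff 2 = P.κ₁ n := by
      rw [h.coeffMatrix_zero_zero, coeff_C_mul, c00, P.κ₁_eq]
    have c11' : (h.coeffMatrix n 1 1).coeff 2 = P.κ₂ n := by
      rw [h.coeffMatrix_one_one, coeff_C_mul, c11, κ₂, mul_one_div]
    have m00' : (h.coeffMatrix n 0 0).natDegree ≤ 2 := (natDegree_C_mul_le _ _).trans m00
    have m11' : (h.coeffMatrix n 1 1).natDegree ≤ 2 := (natDegree_C_mul_le _ _).trans m11
    have m10' : (h.coeffMatrix n 1 0).natDegree ≤ 1 := (natDegree_C_mul_le _ _).trans m10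
    obtain ⟨α, hα⟩ := exists_eq_of_natDegree_le_two m00' (c00' ▸ k1) y
    obtain ⟨β, hβ⟩ := exists_eq_of_natDegree_le_two m11' (c11' ▸ k2) y
    rw [c00'] at hα
    rw [c11'] at hβ
    have hγ := eq_X_add_C_of_natDegree_le_one m10'
    refine ⟨(h.coeffMatrix n 0 0).eval y / P.κ₁ n, (h.coeffMatrix n 1 1).eval y / P.κ₂ n, α, β,
      w * (h.coeffMatrix n 1 0).coeff 1 / P.κ₁ n, w * (h.coeffMatrix n 1 0).coeff 0 / P.κ₁ n,
      ?_, ?_, ?_⟩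
    · have key : C (P.κ₁ n / w) * (C (w * (h.coeffMatrix n 1 0).coeff 1 / P.κ₁ n) * X +
          C (w * (h.coeffMatrix n 1 0).coeff 0 / P.κ₁ n)) = h.coeffMatrix n 1 0 := by
        refine Eq.trans ?_ hγ.symm
        rw [mul_add, ← mul_assoc, ← C_mul, ← C_mul]
        congr 3 <;> field_simp
      rw [key, ← hα, ← hβ, ← h01]
      exact Matrix.eta_fin_two _
    · rw [← e00]
      field_simp
    · rw [e11]
      field_simp

/-! ### Factorization of the shift matrices at t and t/q -/

include h'

/-- The factorizations of the shift matrices at `t` and `t' = t/q` through two linear matrices. -/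
theorem exists_factorization (htt : t' = t / P.q) (n : ℕ) :
    ∃ R S : Matrix (Fin 2) (Fin 2) ℂ[X],
      S * R.adjugate = C P.a₂ • h.shiftMatrix n ∧
      (R.adjugate.map fun r => r.comp (C P.q * X)) * S = C (P.q * P.a₂) • h'.shiftMatrix n ∧
      R 0 1 = C (P.a₁ * (h.frame n).h - P.a₂ * (h'.frame n).h) ∧
      S 0 1 = C ((h.frame n).h / P.q ^ (n + 1) - P.mixedConst * P.q ^ n * (h'.frame n).h) ∧
      (∀ x, (R 0 0).eval x * (R 1 1).eval x - (R 0 1).eval x * (R 1 0).eval x =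
        P.a₁ * P.a₂ * ((x - P.a₁ * t) * (x - P.a₂ * t))) ∧
      ∀ x, (S 0 0).eval x * (S 1 1).eval x - (S 0 1).eval x * (S 1 0).eval x =
        P.mixedConst * ((x - P.a₃) * (x - P.a₄)) := by
  subst htt
  have nq := P.q_ne_zero
  have n1 := P.a₁_ne_zero
  have n2 := P.a₂_ne_zero
  obtain ⟨cR, hR⟩ := h.exists_stieltjes_tshift h'
  obtain ⟨cS, hS⟩ := h.exists_stieltjes_qtshift h'
  have hm : P.mixedConst * P.a₁ = P.a₂ * P.pearsonConst := by
    rw [mixedConst]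
    field_simp
  have hqt : P.q * (t / P.q) = t := by field_simp
  refine ⟨_, _, connMatrix_mul_adjugate (h.frame n) (h'.frame n) (h.frame n) hS hR
    h.eventually_stieltjes_pearson ?_ ?_, adjugate_mul_connMatrix (h.frame n) (h'.frame n)
    (h'.frame n) nq hS hR h'.eventually_stieltjes_pearson ?_ ?_, ?_, ?_, fun x => ?_, fun x => ?_⟩
  · rw [pearsonA]
    ring
  · rw [pearsonB]
    have := congrArg C hm
    simp only [C_mul] at this
    linear_combination (X - C P.a₄) * (X - C (P.a₂ * t)) * this
  · refine Polynomial.funext fun x => ?_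
    simp only [pearsonA, eval_mul, eval_sub, eval_comp, eval_C, eval_X]
    linear_combination P.a₁ * P.a₂ * (x - P.a₃) * hqt
  · refine Polynomial.funext fun x => ?_
    simp only [pearsonB, eval_mul, eval_sub, eval_comp, eval_C, eval_X]
    linear_combination P.q * (x - P.a₂ * (t / P.q)) * (x - P.a₄) * hm +
      P.mixedConst * P.a₁ * P.a₂ * (x - P.a₄) * hqt
  · obtain ⟨g₁, g₂, h₁, h₂, he⟩ := connEntry_expansion one_ne_zero hR
      (((HasExpansion.X_sub_C (P.a₂ * t)).const_mul P.a₁).congr'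
        (Eventually.of_forall fun x => by simp))
      (((HasExpansion.X_sub_C (P.a₁ * t)).const_mul P.a₂).congr'
        (Eventually.of_forall fun x => by simp))
      (h.frame n).p_expansion (h.frame n).φ_expansion
      (h'.frame n).p_expansion (h'.frame n).φ_expansion
    -- Coefficients of degree one instead of two lower the order of the upper right entry to 0, so
    -- it is constant.
    rw [show (1 : ℤ) + n + (-n - 1) = 0 by ring] at h₁ h₂
    refine Eq.trans ((h₁.sub h₂).congr' he).polynomial_eq_C ?_
    simp
  · obtain ⟨g₁, g₂, h₁, h₂, he⟩ := connEntry_expansion nq hS (HasExpansion.X_sub_C P.a₃)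
      (((HasExpansion.X_sub_C P.a₄).const_mul P.mixedConst).congr'
        (Eventually.of_forall fun x => by simp))
      (h.frame n).p_expansion (h.frame n).φ_expansion
      (h'.frame n).p_expansion (h'.frame n).φ_expansion
    rw [show (1 : ℤ) + n + (-n - 1) = 0 by ring] at h₁ h₂
    refine Eq.trans ((h₁.sub h₂).congr' he).polynomial_eq_C ?_
    have z1 : P.q ^ (-(n : ℤ) - 1) = 1 / P.q ^ (n + 1) := by
      rw [← neg_add', zpow_neg, one_div]
      norm_cast
    rw [z1, zpow_natCast]
    congr 1
    ring
  · rw [connMatrix_det_eval]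
    simp only [eval_mul, eval_sub, eval_C, eval_X]
    ring
  · rw [connMatrix_det_eval]
    simp only [eval_mul, eval_sub, eval_C, eval_X]
    ring

end Admissible

namespace Admissible

variable (h : P.Admissible e₀ e₁ p t) (h' : P.Admissible e₀ e₁ p' t')

/-- The numerator of `z_n` divided by `Δ_n(t) Δ_n(t')`. -/
noncomputable def zNum (n : ℕ) : ℂ := P.a₁ * (h.frame n).h - P.a₂ * (h'.frame n).h

/-- The denominator of `z_n` divided by `q a₁ a₂ a₄ Δ_n(t) Δ_n(t')`. -/
noncomputable def zDen (n : ℕ) : ℂ :=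
  (h.frame n).h / P.q ^ (n + 1) - P.mixedConst * P.q ^ n * (h'.frame n).h

/-- Put r = R₀₁ and s = S₀₁. At a zero of (S adj R)₀₁ = s R₀₀ - r S₀₀ one gets r (S adj R)₀₀ = s det
R and, likewise, s (S adj R)₁₁ = r det S; the product in the other order is treated in the same way.
The last relation multiplies s R₀₀ - r S₀₀ by s R₁₁ - r S₁₁ at 0, which gives s² det R + r² det S -
r s tr(S adj R). -/
theorem pair_relations (htt : t' = t / P.q) (n : ℕ) :
    (∀ y, (h.shiftMatrix n 0 1).eval y = 0 → (h.shiftMatrix n 0 0).eval y * h.zNum h' n =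
      P.a₁ * h.zDen h' n * ((y - P.a₁ * t) * (y - P.a₂ * t))) ∧
    (∀ y, (h.shiftMatrix n 0 1).eval y = 0 → P.a₂ * (h.shiftMatrix n 1 1).eval y * h.zDen h' n =
      h.zNum h' n * P.mixedConst * ((y - P.a₃) * (y - P.a₄))) ∧
    (h.zNum h' n = 0 → h.zDen h' n = 0 → h.shiftMatrix n 0 1 = 0) ∧
    (∀ y, (h'.shiftMatrix n 0 1).eval y = 0 →
      P.q * (h'.shiftMatrix n 1 1).eval y * h.zNum h' n =
        P.a₁ * h.zDen h' n * ((P.q * y - P.a₁ * t) * (P.q * y - P.a₂ * t))) ∧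
    P.a₂ * (h.shiftMatrix n 0 1).eval 0 * (P.q * P.a₂ * (h'.shiftMatrix n 0 1).eval 0) =
      h.zDen h' n ^ 2 * (P.a₁ ^ 2 * P.a₂ ^ 2 * t ^ 2) +
        h.zNum h' n ^ 2 * (P.mixedConst * P.a₃ * P.a₄) -
        h.zNum h' n * h.zDen h' n * (P.a₂ * (P.a₁ * t * P.a₃ +
          P.pearsonConst * (P.a₂ * t * P.a₄))) := by
  have n2 := P.a₂_ne_zero
  have nq := P.q_ne_zero
  obtain ⟨R, S, hl, hr, hR, hS, dR, dS⟩ := h.exists_factorization h' htt n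
  change R 0 1 = C (h.zNum h' n) at hR
  change S 0 1 = C (h.zDen h' n) at hS
  have htr := connMatrix_trace_eval_zero (h.frame n) P.q (P.pearsonA t) (P.pearsonB t) h.pearsonC
  change (h.shiftMatrix n 0 0).eval 0 + (h.shiftMatrix n 1 1).eval 0 = _ at htr
  simp only [pearsonA, pearsonB, eval_mul, eval_sub, eval_C, eval_X] at htr
  generalize h.zNum h' n = r at *
  generalize h.zDen h' n = s at *
  rw [Matrix.adjugate_fin_two] at hl hr
  have l : ∀ i j x, _ := fun i j x => congrArg (Polynomial.eval x) (congrFun (congrFun hl i) j)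
  have l' : ∀ i j x, _ := fun i j x => congrArg (Polynomial.eval x) (congrFun (congrFun hr i) j)
  have l00 := l 0 0
  have l01 := l 0 1
  have l11 := l 1 1
  have l01' := l' 0 1
  have l11' := l' 1 1
  simp only [Matrix.mul_apply, Fin.sum_univ_two, Matrix.smul_apply, smul_eq_mul,
    Matrix.of_apply, Matrix.cons_val', Matrix.cons_val_zero, Matrix.cons_val_one,
    Matrix.cons_val_fin_one, Matrix.map_apply, eval_add, eval_mul, eval_neg, eval_C, eval_comp,
    eval_X, neg_comp, hR, hS, C_comp] at l00 l01 l11 l01' l11' dR dS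
  refine ⟨fun y hy => ?_, fun y hy => ?_, fun hr0 hs0 => ?_, fun y hy => ?_, ?_⟩
  · have e := l01 y
    rw [hy] at e
    refine mul_left_cancel₀ n2 ?_
    linear_combination -r * l00 y - (R 1 1).eval y * e + s * dR y
  · have e := l01 y
    rw [hy] at e
    linear_combination -s * l11 y + (S 1 1).eval y * e + r * dS y
  · refine Polynomial.funext fun x => mul_left_cancel₀ n2 ?_
    rw [← l01 x, hr0, hs0]
    simp
  · have e := l01' y
    rw [hy] at e
    refine mul_left_cancel₀ n2 ?_
    linear_combination -r * l11' y - (R 0 0).eval (P.q * y) * e + s * dR (P.q * y)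
  · have e := l01' 0
    have d := dR 0
    rw [mul_zero] at e
    rw [← l01 0, ← e]
    linear_combination s ^ 2 * d + r ^ 2 * dS 0 - r * s * (l00 0 + l11 0 + P.a₂ * htr)

end Admissible

/-! ### The determinantal `z` and the evolution in t -/

theorem κ₁_mul_κ₂ (P : LittleQJacobi) (n : ℕ) :
    P.κ₁ n * P.κ₂ n = (P.a₂ * P.a₄) ^ 2 * P.pearsonConst := by
  have nQ := pow_ne_zero n P.q_ne_zero
  rw [κ₁_eq, κ₂]
  field_simp

theorem mixedConst_mul_a₁ (P : LittleQJacobi) : P.mixedConst * P.a₁ = P.pearsonConst * P.a₂ :=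
  div_mul_cancel₀ _ P.a₁_ne_zero

namespace Admissible

variable (h : P.Admissible e₀ e₁ p t) (h' : P.Admissible e₀ e₁ p' t')

include h

theorem hankelDelta_ne_zero (n : ℕ) : hankelDelta (P.moment e₀ e₁ t) n ≠ 0 :=
  h.2.2.2.2.2.2.hankelDelta_ne_zero (le_max_of_le_left (norm_nonneg (P.endpoint t e₀)))
    h.geomBounded n

theorem frame_h_ne_zero (n : ℕ) : (h.frame n).h ≠ 0 :=
  h.2.2.2.2.2.2.frame_h_ne_zero _ h.geomBounded n

theorem hankelDelta_succ (n : ℕ) : hankelDelta (P.moment e₀ e₁ t) (n + 1) =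
    (h.frame n).h * hankelDelta (P.moment e₀ e₁ t) n :=
  (h.2.2.2.2.2.2.frame_hankel _ h.geomBounded n).1

theorem wDet_eq (n : ℕ) : P.wDet e₀ e₁ n t = qChar P.q (P.q * P.a₁) t *
    (P.κ₂ n - P.q * P.κ₁ n) * (h.frame n).h / (P.q * qChar P.q (P.q * P.a₂) t) := by
  rw [wDet, h.hankelDelta_succ, ← mul_assoc, mul_div_mul_right _ _ (h.hankelDelta_ne_zero n)]

theorem shiftMatrix_zero_one_eval (n : ℕ) (hne : P.q * P.κ₁ n ≠ P.κ₂ n) (x : ℂ) :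
    P.q * P.a₂ * P.a₄ * (h.shiftMatrix n 0 1).eval x =
      (P.κ₂ n - P.q * P.κ₁ n) * (h.frame n).h * (x - P.yDet e₀ e₁ n t) := by
  obtain ⟨-, -, h01⟩ := h.coeffMatrix_zero_one n hne
  have e : h.coeffMatrix n 0 1 = C (P.a₂ * P.a₄ *
    (P.κ₂ n * qChar P.q (P.q * P.a₁) t / qChar P.q (P.q * P.a₂) t)) * h.shiftMatrix n 0 1 := rfl
  rw [e, h.wDet_eq] at h01
  have h01x := congrArg (Polynomial.eval x) h01
  simp only [eval_mul, eval_sub, eval_C, eval_X] at h01x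
  have n1 := h.2.2.2.1
  have n2 := h.2.2.2.2.1
  have nk := P.κ₂_ne_zero n
  have nq := P.q_ne_zero
  generalize qChar P.q (P.q * P.a₁) t = E₁ at *
  generalize qChar P.q (P.q * P.a₂) t = E₂ at *
  field_simp at h01x
  linear_combination h01x

include h'

theorem q_mul_zDen (n : ℕ) : P.q * P.a₁ * P.a₂ * P.a₄ * h.zDen h' n =
    P.a₁ * P.κ₂ n * (h.frame n).h - P.q * P.a₂ * P.κ₁ n * (h'.frame n).h := by
  have nq := P.q_ne_zero
  have nQ := pow_ne_zero n nq
  have e1 : (h.frame n).h / P.q ^ (n + 1) * (P.q * P.a₂ * P.a₄) = P.κ₂ n * (h.frame n).h := by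
    rw [pow_succ, κ₂]
    field_simp
  rw [zDen, κ₁_eq]
  linear_combination P.a₁ * e1 -
    P.q * P.a₂ * P.a₄ * P.q ^ n * (h'.frame n).h * P.mixedConst_mul_a₁

theorem zDenom_eq (htt : t' = t / P.q) (n : ℕ) : P.zDenom e₀ e₁ n t =
    hankelDelta (P.moment e₀ e₁ t) n * hankelDelta (P.moment e₀ e₁ t') n *
      (P.q * P.a₁ * P.a₂ * P.a₄ * h.zDen h' n) := by
  rw [zDenom, ← htt, h.hankelDelta_succ, h'.hankelDelta_succ, h.q_mul_zDen h']
  ring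

theorem zDenom_ne_zero_iff (htt : t' = t / P.q) (n : ℕ) :
    P.zDenom e₀ e₁ n t ≠ 0 ↔ h.zDen h' n ≠ 0 := by
  rw [h.zDenom_eq h' htt, mul_ne_zero_iff, mul_ne_zero_iff, mul_ne_zero_iff]
  simp [h.hankelDelta_ne_zero, h'.hankelDelta_ne_zero, P.q_ne_zero, P.a₁_ne_zero, P.a₂_ne_zero,
    P.a₄_ne_zero]

theorem zDet_eq (htt : t' = t / P.q) (n : ℕ) : P.zDet e₀ e₁ n t =
    h.zNum h' n / (P.q * P.a₁ * P.a₂ * P.a₄ * h.zDen h' n) := by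
  rw [zDet, h.zDenom_eq h' htt, ← mul_div_mul_left _ (P.q * P.a₁ * P.a₂ * P.a₄ * h.zDen h' n)
    (mul_ne_zero (h.hankelDelta_ne_zero n) (h'.hankelDelta_ne_zero n)), ← htt,
    h.hankelDelta_succ, h'.hankelDelta_succ, zNum]
  congr 1
  ring

/-- With z = r/(q a₁a₂a₄ s), the two conditions of `isNatural_iff` are the first two relations of
`pair_relations`. -/
theorem isNatural_zDet (htt : t' = t / P.q) (n : ℕ) (hne : P.q * P.κ₁ n ≠ P.κ₂ n)
    (hz : P.zDenom e₀ e₁ n t ≠ 0) :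
    P.IsNatural n t (h.coeffMatrix n) (P.wDet e₀ e₁ n t) (P.yDet e₀ e₁ n t)
      (P.zDet e₀ e₁ n t) := by
  rw [h.zDenom_ne_zero_iff h' htt] at hz
  obtain ⟨c1, c2, -, -, -⟩ := h.pair_relations h' htt n
  have hy : (h.shiftMatrix n 0 1).eval (P.yDet e₀ e₁ n t) = 0 := by
    have := h.shiftMatrix_zero_one_eval n hne (P.yDet e₀ e₁ n t)
    rw [sub_self, mul_zero] at this
    exact (mul_eq_zero.1 this).resolve_left
      (mul_ne_zero (mul_ne_zero P.q_ne_zero P.a₂_ne_zero) P.a₄_ne_zero)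
  have c1 := c1 _ hy
  have c2 := c2 _ hy
  have nq := P.q_ne_zero
  have n1 := P.a₁_ne_zero
  have n2 := P.a₂_ne_zero
  have n4 := P.a₄_ne_zero
  rw [h.isNatural_iff n hne, h.zDet_eq h' htt]
  refine ⟨rfl, rfl, ?_, ?_⟩
  · rw [h.coeffMatrix_zero_zero, eval_mul, eval_C]
    field_simp
    linear_combination c1
  · rw [h.coeffMatrix_one_one, eval_mul, eval_C]
    field_simp
    refine mul_left_cancel₀ (mul_ne_zero n2 n1) ?_
    linear_combination P.a₁ ^ 2 * P.a₂ ^ 2 * P.a₄ ^ 2 * c2 - h.zNum h' n * P.a₁ * P.a₂ *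
        (P.yDet e₀ e₁ n t - P.a₃) * (P.yDet e₀ e₁ n t - P.a₄) * P.κ₁_mul_κ₂ n +
      h.zNum h' n * P.a₁ * P.a₂ ^ 2 * P.a₄ ^ 2 *
        (P.yDet e₀ e₁ n t - P.a₃) * (P.yDet e₀ e₁ n t - P.a₄) * P.mixedConst_mul_a₁

theorem zDet_unique (htt : t' = t / P.q) (n : ℕ) (hne : P.q * P.κ₁ n ≠ P.κ₂ n) {w y z : ℂ}
    (hA : P.IsNatural n t (h.coeffMatrix n) w y z)
    (hy : (y - P.a₁ * t) * (y - P.a₂ * t) ≠ 0 ∨ (y - P.a₃) * (y - P.a₄) ≠ 0) :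
    P.zDenom e₀ e₁ n t ≠ 0 ∧ z = P.zDet e₀ e₁ n t := by
  have nq := P.q_ne_zero
  have n1 := P.a₁_ne_zero
  have n2 := P.a₂_ne_zero
  have n4 := P.a₄_ne_zero
  have nb : P.pearsonConst ≠ 0 := pearsonConst_ne_zero
  have nm : P.mixedConst ≠ 0 := div_ne_zero (mul_ne_zero nb n2) n1
  have nk1 := P.κ₁_ne_zero n
  have nk2 := P.κ₂_ne_zero n
  obtain ⟨-, rfl, e00, e11⟩ := (h.isNatural_iff n hne _ _ _).1 hA
  obtain ⟨c1, c2, c3, -, -⟩ := h.pair_relations h' htt n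
  have hν := h.shiftMatrix_zero_one_eval n hne
  have hy0 : (h.shiftMatrix n 0 1).eval (P.yDet e₀ e₁ n t) = 0 := by
    have := hν (P.yDet e₀ e₁ n t)
    rw [sub_self, mul_zero] at this
    exact (mul_eq_zero.1 this).resolve_left (mul_ne_zero (mul_ne_zero nq n2) n4)
  have c1 := c1 _ hy0
  have c2 := c2 _ hy0
  rw [h.coeffMatrix_zero_zero, eval_mul, eval_C] at e00
  rw [h.coeffMatrix_one_one, eval_mul, eval_C] at e11
  have hs : P.zDenom e₀ e₁ n t ≠ 0 := by
    rw [h.zDenom_ne_zero_iff h' htt]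
    intro hs
    -- If r and s both vanished, so would the upper right entry, whose slope is nonzero. With r ≠ 0
    -- and s = 0 the relations at y make both products in `hy` vanish.
    have hr : h.zNum h' n ≠ 0 := by
      intro hr
      have := hν (P.yDet e₀ e₁ n t + 1)
      rw [c3 hr hs, eval_zero, mul_zero, add_sub_cancel_left, mul_one] at this
      exact mul_ne_zero (sub_ne_zero.2 hne.symm) (h.frame_h_ne_zero n) this.symm
    rw [hs] at c1 c2
    rcases hy with hy | hy
    · rw [mul_zero, zero_mul, mul_eq_zero] at c1
      rw [c1.resolve_right hr, mul_zero, zero_mul] at e00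
      exact hy e00.symm
    · rw [mul_zero, eq_comm, mul_eq_zero] at c2
      exact c2.elim (mul_ne_zero hr nm) hy
  refine ⟨hs, ?_⟩
  obtain ⟨-, -, f00, f11⟩ := (h.isNatural_iff n hne _ _ _).1 (h.isNatural_zDet h' htt n hne hs)
  rw [h.coeffMatrix_zero_zero, eval_mul, eval_C] at f00
  rw [h.coeffMatrix_one_one, eval_mul, eval_C] at f11
  rcases hy with hy | hy
  · rw [← e00] at f00 hy
    exact (mul_left_cancel₀ nq (mul_left_cancel₀ (left_ne_zero_of_mul hy) f00)).symm
  · rw [f11] at e11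
    exact (mul_left_cancel₀ (mul_ne_zero nq nk1)
      (mul_right_cancel₀ hy (mul_left_cancel₀ nk2 e11))).symm

/-- The evolution of the determinantal expressions from `t'` to `t = q t'`, given that they are
natural variables at `t'`. -/
theorem qpvi_step (htt : t = P.q * t') (n : ℕ) (hne : P.q * P.κ₁ n ≠ P.κ₂ n)
    (hz : P.zDenom e₀ e₁ n t ≠ 0) {z : ℂ}
    (hA : P.IsNatural n t' (h'.coeffMatrix n) (P.wDet e₀ e₁ n t') (P.yDet e₀ e₁ n t') z) :
    P.κ₂ n * P.zDet e₀ e₁ n t - 1 ≠ 0 ∧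
      P.wDet e₀ e₁ n t = P.wDet e₀ e₁ n t' *
        ((P.q * P.κ₁ n * P.zDet e₀ e₁ n t - 1) / (P.κ₂ n * P.zDet e₀ e₁ n t - 1)) ∧
      IsQPVIStep (P.qpviParams n) t' (P.yDet e₀ e₁ n t') z (P.yDet e₀ e₁ n t)
        (P.zDet e₀ e₁ n t) := by
  have nq := P.q_ne_zero
  have n1 := P.a₁_ne_zero
  have n2 := P.a₂_ne_zero
  have n3 := P.a₃_ne_zero
  have n4 := P.a₄_ne_zero
  have nσ := P.qσ_ne_zero
  have nk1 := P.κ₁_ne_zero n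
  have nk2 := P.κ₂_ne_zero n
  have ht' : t' ≠ 0 := h'.1
  have htt' : t' = t / P.q := by rw [htt, mul_div_cancel_left₀ _ nq]
  have hs := (h.zDenom_ne_zero_iff h' htt' n).1 hz
  have hS := h.q_mul_zDen h' n
  have nS : P.q * P.a₁ * P.a₂ * P.a₄ * h.zDen h' n ≠ 0 := by simp [nq, n1, n2, n4, hs]
  obtain ⟨-, -, -, c4, c5⟩ := h.pair_relations h' htt' n
  have hz1 := h.zDet_eq h' htt' n
  have hν := h.shiftMatrix_zero_one_eval n hne 0
  have hν' := h'.shiftMatrix_zero_one_eval n hne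
  have hy0 : (h'.shiftMatrix n 0 1).eval (P.yDet e₀ e₁ n t') = 0 := by
    have := hν' (P.yDet e₀ e₁ n t')
    rw [sub_self, mul_zero] at this
    exact (mul_eq_zero.1 this).resolve_left (mul_ne_zero (mul_ne_zero nq n2) n4)
  have c4 := c4 _ hy0
  have hν' := hν' 0
  obtain ⟨-, -, -, e11⟩ := (h'.isNatural_iff n hne _ _ _).1 hA
  rw [h'.coeffMatrix_one_one, eval_mul, eval_C] at e11
  have hh := h.frame_h_ne_zero n
  have hh' := h'.frame_h_ne_zero n
  have hne' : P.q * P.κ₁ n - P.κ₂ n ≠ 0 := sub_ne_zero.2 hne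
  have hw := h.wDet_eq n
  have hw' := h'.wDet_eq n
  -- The normalizing characters contribute the factor a₁/a₂ to the quotient of consecutive w, which
  -- matches `k1` and `k2` below.
  have hE : ∀ c ≠ 0, qChar P.q c t = c * qChar P.q c t' := fun c hc => by
    rw [htt, qChar_shift P.norm_q_lt_one nq hc ht']
  rw [hE _ (mul_ne_zero nq n1), hE _ (mul_ne_zero nq n2)] at hw
  have ne1 := h'.2.2.2.1
  have ne2 := h'.2.2.2.2.1
  have hκ := P.κ₁_mul_κ₂ n
  have hr : h.zNum h' n = P.a₁ * (h.frame n).h - P.a₂ * (h'.frame n).h := rfl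
  rw [eq_div_iff nS] at hz1
  -- In κ₂ẑ - 1 and qκ₁ẑ - 1 one of the two norms h(t), h(t') cancels, leaving a multiple of the
  -- other. Both are thus nonzero, and their quotient is the factor from w to ŵ.
  have k2 : (P.κ₂ n * P.zDet e₀ e₁ n t - 1) * (P.q * P.a₁ * P.a₂ * P.a₄ * h.zDen h' n) =
      P.a₂ * (h'.frame n).h * (P.q * P.κ₁ n - P.κ₂ n) := by
    linear_combination P.κ₂ n * hz1 + P.κ₂ n * hr - hS
  have k1 : (P.q * P.κ₁ n * P.zDet e₀ e₁ n t - 1) *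
      (P.q * P.a₁ * P.a₂ * P.a₄ * h.zDen h' n) =
      P.a₁ * (h.frame n).h * (P.q * P.κ₁ n - P.κ₂ n) := by
    linear_combination P.q * P.κ₁ n * hz1 + P.q * P.κ₁ n * hr - hS
  generalize P.zDet e₀ e₁ n t = Z at *
  have g2 : P.κ₂ n * Z - 1 ≠ 0 := fun h0 => by
    rw [h0, zero_mul] at k2
    exact mul_ne_zero (mul_ne_zero n2 hh') hne' k2.symm
  have g1 : P.q * P.κ₁ n * Z - 1 ≠ 0 := fun h0 => by
    rw [h0, zero_mul] at k1
    exact mul_ne_zero (mul_ne_zero n1 hh) hne' k1.symm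
  have f1 : Z - 1 / (P.q * P.κ₁ n) = (P.q * P.κ₁ n * Z - 1) / (P.q * P.κ₁ n) := by field_simp
  have f2 : Z - 1 / P.κ₂ n = (P.κ₂ n * Z - 1) / P.κ₂ n := by field_simp
  refine ⟨g2, ?_, ?_, ?_, ?_, ?_⟩
  · rw [← mul_div_mul_right _ _ nS, k1, k2, hw, hw']
    field_simp
  · change Z * z * ((_ - P.a₃) * (_ - P.a₄)) =
      1 / (P.q * P.κ₁ n) * (1 / P.κ₂ n) * ((_ - P.a₁ * t') * (_ - P.a₂ * t'))
    generalize P.yDet e₀ e₁ n t' = y at *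
    -- The lower right entry at t' is evaluated at y twice: through z by `e11`, and through r/s,
    -- hence ẑ, by `c4`. In `c4` the zeros a₁t, a₂t at qy become a₁t', a₂t' at y.
    have key : Z * z * ((y - P.a₃) * (y - P.a₄)) * (P.q * P.κ₁ n * P.κ₂ n) =
        (y - P.a₁ * t') * (y - P.a₂ * t') := by
      refine mul_right_cancel₀ (mul_ne_zero nS nq) ?_
      generalize h.zDen h' n = s at *
      linear_combination P.q * z * ((y - P.a₃) * (y - P.a₄)) * (P.q * P.κ₁ n * P.κ₂ n) * hz1 -
        P.q * h.zNum h' n * e11 + P.a₂ * P.a₄ * c4 + P.a₁ * P.a₂ * P.a₄ * s *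
          (P.a₁ * P.a₂ * (t + P.q * t') - P.q * y * (P.a₁ + P.a₂)) * htt
    rw [← key]
    field_simp
  · change Z ≠ 1 / (P.q * P.κ₁ n)
    rw [← sub_ne_zero, f1]
    exact div_ne_zero g1 (mul_ne_zero nq nk1)
  · change Z ≠ 1 / P.κ₂ n
    rw [← sub_ne_zero, f2]
    exact div_ne_zero g2 nk2
  · change _ = P.a₃ * P.a₄ * ((Z - P.a₁ * P.a₂ / P.θ₁ * t') * (Z - P.a₁ * P.a₂ / P.θ₂ * t')) /
      ((Z - 1 / (P.q * P.κ₁ n)) * (Z - 1 / P.κ₂ n))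
    rw [f1, f2]
    -- The product of the upper right entries at x = 0 is proportional to ŷy, as each is linear with
    -- that zero. It is also the quadratic form `c5`, which splits into two linear factors in r and
    -- s, giving the zeros a₅t' and a₆t' in ẑ.
    have key : P.yDet e₀ e₁ n t * P.yDet e₀ e₁ n t' *
        ((P.q * P.κ₁ n * Z - 1) * (P.κ₂ n * Z - 1)) * (P.qσ * P.a₃ * P.a₄) =
        P.q * P.κ₁ n * P.κ₂ n * ((P.qσ * P.a₃ * P.a₄ * Z - t') * (P.a₃ * P.a₄ * Z - t')) := by
      generalize P.yDet e₀ e₁ n t = y at *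
      generalize P.yDet e₀ e₁ n t' = y' at *
      refine mul_right_cancel₀ (pow_ne_zero 2 nS) ?_
      calc
        _ = y * y' * (((P.q * P.κ₁ n * Z - 1) * (P.q * P.a₁ * P.a₂ * P.a₄ * h.zDen h' n)) *
            ((P.κ₂ n * Z - 1) * (P.q * P.a₁ * P.a₂ * P.a₄ * h.zDen h' n))) *
            (P.qσ * P.a₃ * P.a₄) := by ring
        _ = ((P.κ₂ n - P.q * P.κ₁ n) * (h.frame n).h * (0 - y)) *
            ((P.κ₂ n - P.q * P.κ₁ n) * (h'.frame n).h * (0 - y')) *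
            (P.a₁ * P.a₂ * P.qσ * P.a₃ * P.a₄) := by
          rw [k1, k2]
          ring
        _ = P.a₂ * (h.shiftMatrix n 0 1).eval 0 * (P.q * P.a₂ * (h'.shiftMatrix n 0 1).eval 0) *
            (P.q * P.a₄ ^ 2) * (P.a₁ * P.a₂ * P.qσ * P.a₃ * P.a₄) := by
          rw [← hν, ← hν']
          ring
        _ = P.q * (P.κ₁ n * P.κ₂ n) * ((P.qσ * P.a₃ * P.a₄ * h.zNum h' n -
            t' * (P.q * P.a₁ * P.a₂ * P.a₄ * h.zDen h' n)) *
            (P.a₃ * P.a₄ * h.zNum h' n - t' * (P.q * P.a₁ * P.a₂ * P.a₄ * h.zDen h' n))) := by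
          rw [c5, hκ, mixedConst, pearsonConst]
          generalize h.zNum h' n = r
          generalize h.zDen h' n = s
          rw [htt]
          field_simp
          ring
        _ = _ := by
          rw [← hz1]
          ring
    rw [θ₁, θ₂, eq_div_iff (mul_ne_zero (div_ne_zero g1 (mul_ne_zero nq nk1))
      (div_ne_zero g2 nk2))]
    field_simp
    linear_combination key

end Admissible

end LittleQJacobi

/-! ### The main theorem -/

theorem mainTheorem5 (P : LittleQJacobi) (e₀ e₁ : SupportEnd) (T : Set ℂ)
    (p : ℂ → ℕ → Polynomial ℂ) (hT : ∀ t ∈ T, P.Admissible e₀ e₁ (p t) t) :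
    -- the moments through Heine's functions
    (∀ t ∈ T, ∀ k : ℕ, P.HeineConverges t k e₀ → P.HeineConverges t k e₁ →
      P.moment e₀ e₁ t k = P.heineTerm t k e₁ - P.heineTerm t k e₀) ∧
    ∀ n : ℕ, P.q * P.κ₁ n ≠ P.κ₂ n →
      (∃ A : ℂ → Matrix (Fin 2) (Fin 2) (Polynomial ℂ),
        -- the coefficient matrix exists and is unique; `θ₁ t`, `θ₂ t` are its eigenvalues at `0`
        (∀ t ∈ T, ∀ B : Matrix (Fin 2) (Fin 2) (Polynomial ℂ),
          P.IsCoeffMatrix e₀ e₁ (p t) n t B ↔ B = A t) ∧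
        (∀ t ∈ T, ((A t).map (Polynomial.eval 0)).charpoly =
          (Polynomial.X - Polynomial.C (P.θ₁ * t)) *
            (Polynomial.X - Polynomial.C (P.θ₂ * t))) ∧
        -- the upper right entry of the coefficient matrix, giving `w_n` and `y_n`
        (∀ t ∈ T, hankelDelta (P.moment e₀ e₁ t) n ≠ 0 ∧
          hankelDelta (P.moment e₀ e₁ t) (n + 1) ≠ 0 ∧
          A t 0 1 = Polynomial.C (P.κ₂ n * P.wDet e₀ e₁ n t) *
            (Polynomial.X - Polynomial.C (P.yDet e₀ e₁ n t))) ∧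
        -- the determinantal expressions are natural variables
        (∀ t ∈ T, t / P.q ∈ T → P.zDenom e₀ e₁ n t ≠ 0 →
          P.IsNatural n t (A t) (P.wDet e₀ e₁ n t) (P.yDet e₀ e₁ n t) (P.zDet e₀ e₁ n t)) ∧
        -- the natural variables are given by the determinantal expressions
        (∀ t ∈ T, ∀ w y z : ℂ, P.IsNatural n t (A t) w y z →
          w = P.wDet e₀ e₁ n t ∧ y = P.yDet e₀ e₁ n t ∧
          (t / P.q ∈ T →
            ((y - P.a₁ * t) * (y - P.a₂ * t) ≠ 0 ∨ (y - P.a₃) * (y - P.a₄) ≠ 0) →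
            P.zDenom e₀ e₁ n t ≠ 0 ∧ z = P.zDet e₀ e₁ n t))) ∧
      -- they solve `q`-P_VI
      (∀ t ∈ T, t / P.q ∈ T → P.q * t ∈ T →
        P.zDenom e₀ e₁ n t ≠ 0 → P.zDenom e₀ e₁ n (P.q * t) ≠ 0 →
        P.κ₂ n * P.zDet e₀ e₁ n (P.q * t) - 1 ≠ 0 ∧
        P.wDet e₀ e₁ n (P.q * t) = P.wDet e₀ e₁ n t *
          ((P.q * P.κ₁ n * P.zDet e₀ e₁ n (P.q * t) - 1) /
            (P.κ₂ n * P.zDet e₀ e₁ n (P.q * t) - 1)) ∧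
        IsQPVIStep (P.qpviParams n) t (P.yDet e₀ e₁ n t) (P.zDet e₀ e₁ n t)
          (P.yDet e₀ e₁ n (P.q * t)) (P.zDet e₀ e₁ n (P.q * t))) := by
  refine ⟨fun t ht k hc₀ hc₁ => ?_, fun n hne => ⟨?_, fun t ht ht₁ ht₂ hz hz' => ?_⟩⟩
  · obtain ⟨ht0, hr₀, hr₁, -⟩ := hT t ht
    rw [LittleQJacobi.moment_eq, LittleQJacobi.endMoment_eq_heineTerm ht0 hr₁ hc₁,
      LittleQJacobi.endMoment_eq_heineTerm ht0 hr₀ hc₀]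
  · classical
    obtain ⟨A, hA⟩ : ∃ A : ℂ → Matrix (Fin 2) (Fin 2) ℂ[X],
        ∀ t (ht : t ∈ T), A t = (hT t ht).coeffMatrix n :=
      -- The matrix is defined from the proof of admissibility, so outside T an arbitrary value is
      -- taken.
      ⟨fun t => if ht : t ∈ T then (hT t ht).coeffMatrix n else 0, fun t ht => dif_pos ht⟩
    refine ⟨A, fun t ht B => ?_, fun t ht => ?_, fun t ht => ?_, fun t ht ht' hz => ?_,
      fun t ht w y z h => ?_⟩
    · rw [hA t ht]
      exact (hT t ht).isCoeffMatrix_iff n B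
    · rw [hA t ht]
      exact (hT t ht).charpoly_coeffMatrix n
    · rw [hA t ht]
      exact (hT t ht).coeffMatrix_zero_one n hne
    · rw [hA t ht]
      exact (hT t ht).isNatural_zDet (hT _ ht') rfl n hne hz
    · rw [hA t ht] at h
      obtain ⟨hw, hy, -⟩ := ((hT t ht).isNatural_iff n hne w y z).1 h
      exact ⟨hw, hy, fun ht' hy' => (hT t ht).zDet_unique (hT _ ht') rfl n hne h hy'⟩
  -- The step runs from t to qt; the point t/q serves only to define z at t.
  · exact (hT _ ht₂).qpvi_step (hT t ht) rfl n hne hz'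
      ((hT t ht).isNatural_zDet (hT _ ht₁) rfl n hne hz)
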